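/- Let $G=(V,E,w)$ be a finite weighted directed graph, $V\neq\emptyset$, $E\subseteq V\times V$, $w\colon E\to\mathbb Z$, and let $W=\max_{e\in E}|w(e)|$ (with $W=0$ if $E=\emptyset$). A plan is an infinite path $\rho=e_0e_1e_2\cdots$ in $G$; if an initial vertex $v_0$ is prescribed in the input, only plans starting at $v_0$ are considered, otherwise plans may start at any vertex. The plan $\rho$ has the utilities $u_t=\sum_{0\le k\le t}w(e_k)$, $t\ge 0$, and it is stationary if it takes the same outgoing edge at every visit of the same vertex. For a rational $T\ge 0$ let $$\mathrm{val}(\rho,T)=\inf_{\delta}\ \sum_{t\in\mathbb N}u_t\,\delta(t),\qquad \mathrm{val}(G,T)=\sup_{\rho}\ \mathrm{val}(\rho,T),$$ where $\delta$ ranges over the probability distributions on $\mathbb N$ with expectation $\sum_t t\,\delta(t)=T$ and $\rho$ over the plans ($\mathrm{val}(G,T)=-\infty$ if there is no plan). Given $G$ by its adjacency and weight matrices, $T$ by its numerator and denominator in lowest terms, and possibly an initial vertex, on a RAM with unit-cost integer arithmetic, comparisons and memory accesses, all of whose numbers stay bounded by a fixed power of $|V|+W+p+q$, where $T=p/q$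 (that is, on words of logarithmically many bits): 1. whether $\mathrm{val}(G,T)\ge 0$ can be decided in $O\big(|V|^{16}\cdot\log(T+2)\big)$ time; 2. in $O\big(|V|^{16}\cdot\log(W|V|+2)\cdot\log(T+2)\big)$ time one can determine whether there is a plan at all and, if there is one, compute $\mathrm{val}(G,T)$, which is then a rational number, as a fraction of integers, together with an optimal stationary plan, i.e. a stationary plan $\rho$ with $\mathrm{val}(\rho,T)=\mathrm{val}(G,T)$. In both parts a single program and a single constant in $O(\cdot)$ serve all inputs. -/

import Mathlib

namespace ExpHorizon

/-! ### Weighted graphs, plans and utilities -/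

/-- A weighted graph on the vertex set `V`: a set `E` of edges, and an integer weight for each edge.
The function `w` is only ever used on members of `E`. -/
structure WeightedGraph (V : Type) where
  E : Finset (V × V)
  w : V × V → ℤ

/-- `W`, the largest absolute value of the weight of an edge (`0` if there is no edge). -/
def WeightedGraph.maxWeight {V : Type} (G : WeightedGraph V) : ℕ :=
  G.E.sup fun e => (G.w e).natAbs

/-- A plan, i.e. an infinite path, given by the sequence of vertices it visits. -/
def IsPlan {V : Type} (G : WeightedGraph V) (ρ : ℕ → V) : Prop :=
  ∀ i, (ρ i, ρ (i + 1)) ∈ G.E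

/-- The sequence of utilities of a plan: `u t` is the sum of the weights of the edges
`e₀, …, e_t`. -/
def utility {V : Type} (G : WeightedGraph V) (ρ : ℕ → V) (t : ℕ) : ℝ :=
  ((∑ k ∈ Finset.range (t + 1), G.w (ρ k, ρ (k + 1)) : ℤ) : ℝ)

/-- The plan has the prescribed initial vertex, if one is prescribed. -/
def StartsAt {V : Type} (start : Option V) (ρ : ℕ → V) : Prop :=
  ∀ v ∈ start, ρ 0 = v

/-- The sequence of vertices `v, σ v, σ (σ v), …` that makes the choice `σ x` at each visit of the
vertex `x`. -/
def stationary {V : Type} (σ : V → V) (v : V) (t : ℕ) : V := σ^[t] v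

/-! ### Stopping times and values -/

/-- `δ` is a probability distribution on `ℕ`. -/
def IsStoppingDistribution (δ : ℕ → ℝ) : Prop :=
  (∀ t, 0 ≤ δ t) ∧ HasSum δ 1

/-- The expected time of `δ` is `T`. -/
def HasExpectedTime (δ : ℕ → ℝ) (T : ℝ) : Prop :=
  HasSum (fun t : ℕ => (t : ℝ) * δ t) T

/-- The expected utility of the sequence `u` under the distribution `δ`. -/
noncomputable def expectedUtility (δ : ℕ → ℝ) (u : ℕ → ℝ) : ℝ :=
  ∑' t, u t * δ t

/-- `val(u, T)`: the infimum of the expected utility over all distributions with expected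
time `T`. -/
noncomputable def seqValue (u : ℕ → ℝ) (T : ℝ) : EReal :=
  ⨅ (δ : ℕ → ℝ) (_ : IsStoppingDistribution δ) (_ : HasExpectedTime δ T),
    ((expectedUtility δ u : ℝ) : EReal)

/-- `val(G, T)`: the supremum of `val(ρ, T)` over all plans `ρ` of `G` (from the initial vertex
`start`, if one is prescribed). -/
noncomputable def value {V : Type} (G : WeightedGraph V) (start : Option V) (T : ℝ) : EReal :=
  ⨆ (ρ : ℕ → V) (_ : IsPlan G ρ) (_ : StartsAt start ρ), seqValue (utility G ρ) T

/-! ### Word RAM programs with a step count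

A machine has integer registers and an integer-valued, addressable memory. Each arithmetic
operation, comparison, register access and memory access takes one step. The numbers that occur
in a run have to stay within a given bound, so that no cell holds more than a machine word. -/

/-- The content of the registers and of the memory. -/
structure State where
  reg : ℕ → ℤ
  mem : ℤ → ℤ

/-- Expressions; `read a` is the content of the memory cell with address `a`. -/
inductive Expr where
  | lit (c : ℤ)
  | reg (i : ℕ)
  | read (a : Expr)
  | add (a b : Expr)
  | sub (a b : Expr)
  | mul (a b : Expr)
  | div (a b : Expr)

/-- The value of an expression (`div` is integer division). -/
def Expr.eval (s : State) : Expr → ℤ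
  | .lit c => c
  | .reg i => s.reg i
  | .read a => s.mem (a.eval s)
  | .add a b => a.eval s + b.eval s
  | .sub a b => a.eval s - b.eval s
  | .mul a b => a.eval s * b.eval s
  | .div a b => a.eval s / b.eval s

/-- The number of elementary operations needed to evaluate an expression. -/
def Expr.cost : Expr → ℕ
  | .lit _ => 1
  | .reg _ => 1
  | .read a => a.cost + 1
  | .add a b => a.cost + b.cost + 1
  | .sub a b => a.cost + b.cost + 1
  | .mul a b => a.cost + b.cost + 1
  | .div a b => a.cost + b.cost + 1

/-- All numbers that occur in the evaluation of the expression have absolute value at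
most `B`. -/
def Expr.Fits (B : ℕ) (s : State) : Expr → Prop
  | .lit c => c.natAbs ≤ B
  | .reg i => (s.reg i).natAbs ≤ B
  | .read a => a.Fits B s ∧ (s.mem (a.eval s)).natAbs ≤ B
  | .add a b => a.Fits B s ∧ b.Fits B s ∧ (a.eval s + b.eval s).natAbs ≤ B
  | .sub a b => a.Fits B s ∧ b.Fits B s ∧ (a.eval s - b.eval s).natAbs ≤ B
  | .mul a b => a.Fits B s ∧ b.Fits B s ∧ (a.eval s * b.eval s).natAbs ≤ B
  | .div a b => a.Fits B s ∧ b.Fits B s ∧ (a.eval s / b.eval s).natAbs ≤ B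

/-- Programs. A test `e` succeeds if the value of `e` is positive. -/
inductive Program where
  | skip
  | set (i : ℕ) (e : Expr)
  | write (a e : Expr)
  | seq (p q : Program)
  | ite (e : Expr) (p q : Program)
  | loop (e : Expr) (p : Program)

/-- `Run B p s t s'`: the program `p`, started in the state `s`, halts in the state `s'` after `t`
steps, and all numbers computed on the way have absolute value at most `B`. -/
inductive Run (B : ℕ) : Program → State → ℕ → State → Prop where
  | skip (s : State) : Run B .skip s 1 s
  | set (s : State) (i : ℕ) (e : Expr) (he : e.Fits B s) :
      Run B (.set i e) s (e.cost + 1) { s with reg := Function.update s.reg i (e.eval s) }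
  | write (s : State) (a e : Expr) (ha : a.Fits B s) (he : e.Fits B s) :
      Run B (.write a e) s (a.cost + e.cost + 1)
        { s with mem := Function.update s.mem (a.eval s) (e.eval s) }
  | seq (p q : Program) (s₁ s₂ s₃ : State) (t₁ t₂ : ℕ) (hp : Run B p s₁ t₁ s₂)
      (hq : Run B q s₂ t₂ s₃) : Run B (.seq p q) s₁ (t₁ + t₂) s₃
  | ite_pos (e : Expr) (p q : Program) (s s' : State) (t : ℕ) (he : e.Fits B s)
      (h : 0 < e.eval s) (hp : Run B p s t s') : Run B (.ite e p q) s (e.cost + 1 + t) s'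
  | ite_neg (e : Expr) (p q : Program) (s s' : State) (t : ℕ) (he : e.Fits B s)
      (h : e.eval s ≤ 0) (hq : Run B q s t s') : Run B (.ite e p q) s (e.cost + 1 + t) s'
  | loop_exit (e : Expr) (p : Program) (s : State) (he : e.Fits B s) (h : e.eval s ≤ 0) :
      Run B (.loop e p) s (e.cost + 1) s
  | loop_step (e : Expr) (p : Program) (s₁ s₂ s₃ : State) (t₁ t₂ : ℕ) (he : e.Fits B s₁)
      (h : 0 < e.eval s₁) (hp : Run B p s₁ t₁ s₂) (hl : Run B (.loop e p) s₂ t₂ s₃) :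
      Run B (.loop e p) s₁ (e.cost + 1 + t₁ + t₂) s₃

/-! ### Input and output -/

/-- The memory that holds the adjacency matrix and the weight matrix of a graph on the vertices
`0, …, n - 1`: for the pair `(i, j)`, the cell `2 (i n + j)` holds `1` or `0` according to whether
`(i, j)` is an edge, and the cell `2 (i n + j) + 1` holds the weight of that edge. All other cells
are `0`. -/
def graphMemory {n : ℕ} (G : WeightedGraph (Fin n)) (a : ℤ) : ℤ :=
  ∑ e ∈ G.E,
    ((if a = 2 * (((e.1 : ℕ) : ℤ) * n + ((e.2 : ℕ) : ℤ)) then 1 else 0) +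
      (if a = 2 * (((e.1 : ℕ) : ℤ) * n + ((e.2 : ℕ) : ℤ)) + 1 then G.w e else 0))

/-- The initial registers: the number of vertices, the numerator and the denominator of `T`, and
`0` if no initial vertex is prescribed, `v + 1` if it is `v`. All other registers are `0`. -/
def inputRegisters {n : ℕ} (start : Option (Fin n)) (T : ℚ) : ℕ → ℤ
  | 0 => n
  | 1 => T.num
  | 2 => T.den
  | 3 => start.elim 0 fun v => ((v : ℕ) : ℤ) + 1
  | _ => 0

/-- The initial state of a machine on the input `(G, start, T)`. -/
def inputState {n : ℕ} (G : WeightedGraph (Fin n)) (start : Option (Fin n)) (T : ℚ) : State where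
  reg := inputRegisters start T
  mem := graphMemory G

/-- The bound on the numbers in a run: a fixed power of the size of the numbers in the input, i.e.
words of `O(log (n + W + T.num + T.den))` bits. -/
def wordBound {n : ℕ} (k : ℕ) (G : WeightedGraph (Fin n)) (T : ℚ) : ℕ :=
  (n + G.maxWeight + T.num.natAbs + T.den) ^ k

/-- The final state gives the right answer to the question whether `val(G, T) ≥ 0`:
register `0` holds `1` for yes and `0` for no. -/
def AnswersNonneg {n : ℕ} (G : WeightedGraph (Fin n)) (start : Option (Fin n)) (T : ℚ)
    (s : State) : Prop :=
  (0 ≤ value G start (T : ℝ) ∧ s.reg 0 = 1) ∨ (¬ 0 ≤ value G start (T : ℝ) ∧ s.reg 0 = 0)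

/-- The final state gives the value `val(G, T)` and an optimal stationary plan. If there is no plan
at all (and only then), register `0` holds `0`. Otherwise register `0` holds `1`, the value is the
fraction of the registers `1` and `2`, register `3` holds the initial vertex of an optimal
stationary plan, and the memory cells `0, …, n - 1` hold the choices of that plan. -/
def GivesValueAndPlan {n : ℕ} (G : WeightedGraph (Fin n)) (start : Option (Fin n)) (T : ℚ)
    (s : State) : Prop :=
  ((¬ ∃ ρ, IsPlan G ρ ∧ StartsAt start ρ) ∧ s.reg 0 = 0) ∨
  (s.reg 0 = 1 ∧ 0 < s.reg 2 ∧
    value G start (T : ℝ) = (((s.reg 1 : ℝ) / (s.reg 2 : ℝ) : ℝ) : EReal) ∧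
    ∃ (σ : Fin n → Fin n) (v : Fin n),
      s.reg 3 = ((v : ℕ) : ℤ) ∧
      (∀ x : Fin n, s.mem ((x : ℕ) : ℤ) = ((σ x : ℕ) : ℤ)) ∧
      IsPlan G (stationary σ v) ∧ StartsAt start (stationary σ v) ∧
      seqValue (utility G (stationary σ v)) (T : ℝ) = value G start (T : ℝ))

end ExpHorizon

/-!
The value of a plan with utilities `u` is the height at `T` of the lower convex hull of `u`. A line
of slope `b` through `(T, ν)` below the graph of `u` witnesses that the value is at least `ν`
(`le_seqValue`); conversely, distributions on one or two points show that such a line exists, and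
that it touches the graph at a time `t₁ ≤ T` (`exists_slope`). From the vertex reached after `t₁`
the plan then sustains the slope `b`: all further partial sums are at least `b` times their length
(`Sustains`). So the graph problem splits into a part before `T`, which has to reach a suitable
vertex `y` without violating the line, and a part after it, for which only the largest slope that
`y` sustains matters, because for constraints at times up to `T` a larger slope is only better.

The largest sustained slopes are found in decreasing order, as in Dijkstra's algorithm. Let `S` be
the set of vertices that are done. The next slope `a` is the largest mean weight of a walk of
length at most `n` that stays outside `S` until it closes up or ends in `S`, or the previous slope
if that is smaller. No vertex outside `S` sustains more than `a` (`Sustains.le_of_walks_le`), and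
starting an optimal walk at a place where its partial sums relative to `a` are minimal yields a new
vertex `z` that returns to `S ∪ {z}` without ever falling below the slope `a` (`exists_returns`).
Which vertices return, and with which initial credit `S ∪ {z}` can be reached from a given vertex,
is decided by a table of minimal credits after `n` rounds of dynamic programming
(`canReach_iff_table`, `returns_iff_bestEdge`); `n` rounds are enough since no closed walk outside
`S` gains against `a` (`CyclesLE.shorten`). The greedy choices for this table form a stationary
plan, which is at least as good as the table promises (`IsGreedy.le_seqValue`), and the table
promises at least the value of any plan that gets to `z` in time (`le_bestEdge_of_plan`). The best
of these plans over all `z` and all initial vertices is therefore optimal. Slopes are fractions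
with a denominator of at most `n`, so that the tables hold integers once weights are scaled.

The algorithm is written in a small language of loop programs (`Cmd`), where each loop runs over
`0, …, n - 1`. Such a program is translated to a machine program with the same effect; its running
time is bounded by a polynomial in `n` that is read off from the program, and all numbers stay
polynomially bounded as soon as the stored ones do (`Cmd.run_compile`). The program has loops of
nesting depth `5` and does not look at the bits of numbers, so its running time is `O(n ^ 5)`, and
of the logarithmic factors only a positive lower bound is needed.
-/

namespace ExpHorizon

/-! ### Structured programs -/

/-- The state with the content of the register `i` replaced. -/
def State.setReg (s : State) (i : ℕ) (x : ℤ) : State :=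
  { s with reg := Function.update s.reg i x }

/-- The state with the content of the memory cell `a` replaced. -/
def State.setMem (s : State) (a x : ℤ) : State :=
  { s with mem := Function.update s.mem a x }

@[simp] theorem State.setReg_reg (s : State) (i j : ℕ) (x : ℤ) :
    (s.setReg i x).reg j = if j = i then x else s.reg j := by
  simp [State.setReg, Function.update_apply]

@[simp] theorem State.setReg_mem (s : State) (i : ℕ) (x : ℤ) : (s.setReg i x).mem = s.mem := rfl

@[simp] theorem State.setMem_reg (s : State) (a x : ℤ) : (s.setMem a x).reg = s.reg := rfl

theorem State.setMem_mem (s : State) (a b x : ℤ) :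
    (s.setMem a x).mem b = if b = a then x else s.mem b := by
  simp [State.setMem, Function.update_apply]

/-- The address of the cell `i` of the array `k`. Eight arrays are interleaved in the negative
addresses, so that cells of different arrays never coincide, whatever the indices are. -/
def cell (k : Fin 8) (i : ℤ) : ℤ := -1 - ((k : ℕ) : ℤ) - 8 * i

theorem cell_inj {k l : Fin 8} {i j : ℤ} : cell k i = cell l j ↔ k = l ∧ i = j := by
  unfold cell
  rw [Fin.ext_iff]
  omega

/-- The content of the cell `i` of the array `k`. -/
def State.arr (s : State) (k : Fin 8) (i : ℤ) : ℤ := s.mem (cell k i)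

@[simp] theorem State.arr_setReg (s : State) (r : ℕ) (x : ℤ) (k : Fin 8) (i : ℤ) :
    (s.setReg r x).arr k i = s.arr k i := rfl

@[simp] theorem State.arr_setMem (s : State) (k l : Fin 8) (i j x : ℤ) :
    (s.setMem (cell k i) x).arr l j = if l = k ∧ j = i then x else s.arr l j := by
  simp only [State.arr, State.setMem_mem, cell_inj]

/-- The expression for the address of a cell of the array `k`. -/
def Expr.cell (k : Fin 8) (e : Expr) : Expr := .sub (.lit (-1 - ((k : ℕ) : ℤ))) (.mul (.lit 8) e)

/-- The expression for the content of a cell of the array `k`. -/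
def Expr.arr (k : Fin 8) (e : Expr) : Expr := .read (.cell k e)

@[simp] theorem Expr.eval_cell (s : State) (k : Fin 8) (e : Expr) :
    (Expr.cell k e).eval s = ExpHorizon.cell k (e.eval s) := rfl

@[simp] theorem Expr.eval_arr (s : State) (k : Fin 8) (e : Expr) :
    (Expr.arr k e).eval s = s.arr k (e.eval s) := rfl

attribute [simp] Expr.eval

/-- Loop programs: the statement `loop i p` repeats `p` for the values `0, …, n - 1` of the
register `i`, where `n` is the content of the register `0`. -/
inductive Cmd where
  | skip
  | set (i : ℕ) (e : Expr)
  | store (k : Fin 8) (idx e : Expr)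
  | poke (a e : Expr)
  | seq (p q : Cmd)
  | ite (e : Expr) (p q : Cmd)
  | loop (i : ℕ) (p : Cmd)

/-- The state after `j` rounds of a loop over the register `i` whose body acts as `f`. -/
def iterLoop (f : State → State) (i : ℕ) (s : State) : ℕ → State
  | 0 => s.setReg i 0
  | j + 1 => (f (iterLoop f i s j)).setReg i ((f (iterLoop f i s j)).reg i + 1)

/-- The effect of a loop program on the state. -/
def Cmd.exec : Cmd → State → State
  | .skip, s => s
  | .set i e, s => s.setReg i (e.eval s)
  | .store k idx e, s => s.setMem (cell k (idx.eval s)) (e.eval s)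
  | .poke a e, s => s.setMem (a.eval s) (e.eval s)
  | .seq p q, s => q.exec (p.exec s)
  | .ite e p q, s => if 0 < e.eval s then p.exec s else q.exec s
  | .loop i p, s => iterLoop p.exec i s (s.reg 0).toNat

/-- All values that the loop program assigns to registers and memory cells, except to loop
counters, are at most `M` in absolute value. -/
def Cmd.Safe (M : ℕ) : Cmd → State → Prop
  | .skip, _ => True
  | .set _ e, s => |e.eval s| ≤ (M : ℤ)
  | .store _ _ e, s => |e.eval s| ≤ (M : ℤ)
  | .poke _ e, s => |e.eval s| ≤ (M : ℤ)
  | .seq p q, s => p.Safe M s ∧ q.Safe M (p.exec s)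
  | .ite e p q, s => if 0 < e.eval s then p.Safe M s else q.Safe M s
  | .loop i p, s => ∀ j < (s.reg 0).toNat, p.Safe M (iterLoop p.exec i s j)

/-- Translation of loop programs to machine programs. -/
def Cmd.compile : Cmd → Program
  | .skip => .skip
  | .set i e => .set i e
  | .store k idx e => .write (.cell k idx) e
  | .poke a e => .write a e
  | .seq p q => .seq p.compile q.compile
  | .ite e p q => .ite e p.compile q.compile
  | .loop i p => .seq (.set i (.lit 0)) (.loop (.sub (.reg 0) (.reg i))
      (.seq p.compile (.set i (.add (.reg i) (.lit 1)))))

/-- An upper bound on the running time when the register `0` holds `n`. -/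
def Cmd.cost (n : ℕ) : Cmd → ℕ
  | .skip => 1
  | .set _ e => e.cost + 1
  | .store k idx e => (Expr.cell k idx).cost + e.cost + 1
  | .poke a e => a.cost + e.cost + 1
  | .seq p q => p.cost n + q.cost n
  | .ite e p q => e.cost + 1 + (p.cost n + q.cost n)
  | .loop _ p => 6 + n * (p.cost n + 8)

/-- The loop program leaves the register `r` unchanged. -/
def Cmd.keepsReg (r : ℕ) : Cmd → Bool
  | .skip => true
  | .set i _ => decide (r ≠ i)
  | .store _ _ _ => true
  | .poke _ _ => true
  | .seq p q => p.keepsReg r && q.keepsReg r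
  | .ite _ p q => p.keepsReg r && q.keepsReg r
  | .loop i p => decide (r ≠ i) && p.keepsReg r

/-- The loop program leaves the array `k` unchanged. -/
def Cmd.keepsArr (k : Fin 8) : Cmd → Bool
  | .skip => true
  | .set _ _ => true
  | .store l _ _ => decide (k ≠ l)
  | .poke _ _ => false
  | .seq p q => p.keepsArr k && q.keepsArr k
  | .ite _ p q => p.keepsArr k && q.keepsArr k
  | .loop _ p => p.keepsArr k

/-- All literals in the expression are at most `8` in absolute value. -/
def Expr.smallLits : Expr → Bool
  | .lit c => decide (c.natAbs ≤ 8)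
  | .reg _ => true
  | .read a => a.smallLits
  | .add a b => a.smallLits && b.smallLits
  | .sub a b => a.smallLits && b.smallLits
  | .mul a b => a.smallLits && b.smallLits
  | .div a b => a.smallLits && b.smallLits

/-- The expression has small literals and at most `64` operations. -/
def Expr.small (e : Expr) : Bool := e.smallLits && decide (e.cost ≤ 64)

/-- All expressions in the loop program are small, and the register `0` and the loop counters are
not overwritten inside loops. -/
def Cmd.wf : Cmd → Bool
  | .skip => true
  | .set _ e => e.small
  | .store k idx e => (Expr.cell k idx).small && e.small
  | .poke a e => a.small && e.small
  | .seq p q => p.wf && q.wf && p.keepsReg 0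
  | .ite e p q => e.small && p.wf && q.wf
  | .loop i p => p.wf && p.keepsReg 0 && p.keepsReg i && decide (i ≠ 0)

/-- All registers and memory cells hold numbers of absolute value at most `M`. -/
def Bounded (M : ℕ) (s : State) : Prop := (∀ i, |s.reg i| ≤ (M : ℤ)) ∧ ∀ a, |s.mem a| ≤ (M : ℤ)

theorem Bounded.setReg {M : ℕ} {s : State} (h : Bounded M s) (i : ℕ) {x : ℤ}
    (hx : |x| ≤ (M : ℤ)) : Bounded M (s.setReg i x) := by
  refine ⟨fun j => ?_, h.2⟩
  rw [State.setReg_reg]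
  split_ifs
  · exact hx
  · exact h.1 j

theorem Bounded.setMem {M : ℕ} {s : State} (h : Bounded M s) (a : ℤ) {x : ℤ}
    (hx : |x| ≤ (M : ℤ)) : Bounded M (s.setMem a x) := by
  refine ⟨h.1, fun b => ?_⟩
  rw [State.setMem_mem]
  split_ifs
  · exact hx
  · exact h.2 b

theorem Expr.eval_le {M : ℕ} {s : State} (hM : 8 ≤ M) (hs : Bounded M s) (e : Expr)
    (he : e.smallLits = true) : (e.eval s).natAbs ≤ M ^ e.cost := by
  have hM1 : 1 ≤ M := by omega
  have key : ∀ a b : ℕ, M ^ a + M ^ b ≤ M ^ (a + b + 1) := by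
    intro a b
    have h1 : M ^ a ≤ M ^ (a + b) := Nat.pow_le_pow_right hM1 (by omega)
    have h2 : M ^ b ≤ M ^ (a + b) := Nat.pow_le_pow_right hM1 (by omega)
    calc M ^ a + M ^ b ≤ M ^ (a + b) * 2 := by omega
      _ ≤ M ^ (a + b) * M := Nat.mul_le_mul_left _ (by omega)
      _ = _ := (pow_succ _ _).symm
  induction e with
  | lit c => simp only [smallLits, decide_eq_true_eq] at he; simp [cost]; omega
  | reg i => have := hs.1 i; rw [Int.abs_eq_natAbs] at this; simp only [Expr.eval, cost, pow_one]; omega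
  | read a ih =>
    have := hs.2 (a.eval s)
    rw [Int.abs_eq_natAbs] at this
    have h2 : M ^ 1 ≤ M ^ (a.cost + 1) := Nat.pow_le_pow_right hM1 (by omega)
    simp only [Expr.eval, cost]; rw [pow_one] at h2; omega
  | add a b iha ihb =>
    simp only [smallLits, Bool.and_eq_true] at he
    have := iha he.1; have := ihb he.2; have := key a.cost b.cost
    simp only [Expr.eval, cost]; omega
  | sub a b iha ihb =>
    simp only [smallLits, Bool.and_eq_true] at he
    have := iha he.1; have := ihb he.2; have := key a.cost b.cost
    simp only [Expr.eval, cost]; omega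
  | mul a b iha ihb =>
    simp only [smallLits, Bool.and_eq_true] at he
    simp only [Expr.eval, cost, Int.natAbs_mul]
    calc _ ≤ M ^ a.cost * M ^ b.cost := Nat.mul_le_mul (iha he.1) (ihb he.2)
      _ = M ^ (a.cost + b.cost) := (pow_add _ _ _).symm
      _ ≤ _ := Nat.pow_le_pow_right hM1 (by omega)
  | div a b iha ihb =>
    simp only [smallLits, Bool.and_eq_true] at he
    simp only [Expr.eval, cost]
    calc _ ≤ (a.eval s).natAbs := Int.natAbs_ediv_le_natAbs _ _
      _ ≤ M ^ a.cost := iha he.1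
      _ ≤ _ := Nat.pow_le_pow_right hM1 (by omega)

theorem Expr.fits {M B : ℕ} {s : State} (hM : 8 ≤ M) (hs : Bounded M s) (e : Expr)
    (he : e.smallLits = true) (hB : M ^ e.cost ≤ B) : e.Fits B s := by
  have hM1 : 1 ≤ M := by omega
  have mono : ∀ {a b : ℕ}, a ≤ b → M ^ b ≤ B → M ^ a ≤ B := fun h h' =>
    (Nat.pow_le_pow_right hM1 h).trans h'
  have hv := (Expr.eval_le hM hs e he).trans hB
  induction e with
  | lit c => exact hv
  | reg i => exact hv
  | read a ih =>
    have h1 := mono (Nat.le_succ _) hB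
    exact ⟨ih he h1 ((Expr.eval_le hM hs a he).trans h1), hv⟩
  | add a b iha ihb | sub a b iha ihb | mul a b iha ihb | div a b iha ihb =>
    simp only [smallLits, Bool.and_eq_true] at he
    have h1 : M ^ a.cost ≤ B := mono (by simp only [cost]; omega) hB
    have h2 : M ^ b.cost ≤ B := mono (by simp only [cost]; omega) hB
    exact ⟨iha he.1 h1 ((Expr.eval_le hM hs a he.1).trans h1),
      ihb he.2 h2 ((Expr.eval_le hM hs b he.2).trans h2), hv⟩

theorem Expr.small.fits {M : ℕ} {s : State} (hM : 8 ≤ M) (hs : Bounded M s) {e : Expr}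
    (he : e.small = true) : e.Fits (M ^ 64) s := by
  simp only [Expr.small, Bool.and_eq_true, decide_eq_true_eq] at he
  exact Expr.fits hM hs e he.1 (Nat.pow_le_pow_right (by omega) he.2)

theorem Cmd.exec_reg {r : ℕ} (c : Cmd) (h : c.keepsReg r = true) (s : State) :
    (c.exec s).reg r = s.reg r := by
  induction c generalizing s with
  | skip => rfl
  | set i e =>
    simp only [keepsReg, decide_eq_true_eq] at h
    simp [exec, h]
  | store k i e => rfl
  | poke a e => rfl
  | seq p q ihp ihq =>
    simp only [keepsReg, Bool.and_eq_true] at h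
    simp [exec, ihp h.1, ihq h.2]
  | ite e p q ihp ihq =>
    simp only [keepsReg, Bool.and_eq_true] at h
    simp only [exec]
    split_ifs
    · exact ihp h.1 s
    · exact ihq h.2 s
  | loop i p ih =>
    simp only [keepsReg, Bool.and_eq_true, decide_eq_true_eq] at h
    simp only [exec]
    generalize (s.reg 0).toNat = m
    induction m with
    | zero => simp [iterLoop, h.1]
    | succ m ihm => simp [iterLoop, h.1, ih h.2, ihm]

theorem Cmd.exec_arr {k : Fin 8} (c : Cmd) (h : c.keepsArr k = true) (s : State) (j : ℤ) :
    (c.exec s).arr k j = s.arr k j := by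
  induction c generalizing s with
  | skip => rfl
  | set i e => rfl
  | store l i e =>
    simp only [keepsArr, decide_eq_true_eq] at h
    simp [exec, h]
  | poke a e => simp [keepsArr] at h
  | seq p q ihp ihq =>
    simp only [keepsArr, Bool.and_eq_true] at h
    simp [exec, ihp h.1, ihq h.2]
  | ite e p q ihp ihq =>
    simp only [keepsArr, Bool.and_eq_true] at h
    simp only [exec]
    split_ifs
    · exact ihp h.1 s
    · exact ihq h.2 s
  | loop i p ih =>
    simp only [keepsArr] at h
    simp only [exec]
    generalize (s.reg 0).toNat = m
    induction m with
    | zero => rfl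
    | succ m ihm => simp [iterLoop, ih h, ihm]

/-- The states `s` and `s'` agree on everything that `c` does not write to. -/
def Same (c : Cmd) (s s' : State) : Prop :=
  (∀ r, c.keepsReg r = true → s'.reg r = s.reg r) ∧
    ∀ k, c.keepsArr k = true → ∀ i, s'.arr k i = s.arr k i

theorem Cmd.exec_same (c : Cmd) (s : State) : Same c s (c.exec s) :=
  ⟨fun _ h => c.exec_reg h s, fun _ h i => c.exec_arr h s i⟩

/-- The loop program is safe in the state `s` and leads to a state that satisfies `Q`. -/
def Sat (M : ℕ) (c : Cmd) (s : State) (Q : State → Prop) : Prop := c.Safe M s ∧ Q (c.exec s)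

theorem Sat.seq {M : ℕ} {p q : Cmd} {s : State} {Q : State → Prop}
    (h : Sat M p s fun s' => Sat M q s' Q) : Sat M (.seq p q) s Q :=
  ⟨⟨h.1, h.2.1⟩, h.2.2⟩

theorem Sat.mono {M : ℕ} {p : Cmd} {s : State} {Q R : State → Prop} (h : Sat M p s Q)
    (hQ : ∀ s', Same p s s' → Q s' → R s') : Sat M p s R :=
  ⟨h.1, hQ _ (p.exec_same s) h.2⟩

theorem Sat.set {M : ℕ} {i : ℕ} {e : Expr} {s : State} {Q : State → Prop}
    (h : |e.eval s| ≤ (M : ℤ)) (hQ : Q (s.setReg i (e.eval s))) : Sat M (.set i e) s Q := ⟨h, hQ⟩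

theorem Sat.store {M : ℕ} {k : Fin 8} {i e : Expr} {s : State} {Q : State → Prop}
    (h : |e.eval s| ≤ (M : ℤ)) (hQ : Q (s.setMem (cell k (i.eval s)) (e.eval s))) :
    Sat M (.store k i e) s Q := ⟨h, hQ⟩

theorem Sat.skip {M : ℕ} {s : State} {Q : State → Prop} (hQ : Q s) : Sat M .skip s Q :=
  ⟨trivial, hQ⟩

theorem Sat.ite {M : ℕ} {e : Expr} {p q : Cmd} {s : State} {Q : State → Prop}
    (hp : 0 < e.eval s → Sat M p s Q) (hq : e.eval s ≤ 0 → Sat M q s Q) :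
    Sat M (.ite e p q) s Q := by
  by_cases h : 0 < e.eval s
  · have := hp h
    exact ⟨by simpa only [Cmd.Safe, h, if_true] using this.1,
      by simpa only [Cmd.exec, h, if_true] using this.2⟩
  · have := hq (by omega)
    exact ⟨by simpa only [Cmd.Safe, h, if_false] using this.1,
      by simpa only [Cmd.exec, h, if_false] using this.2⟩

theorem iterLoop_reg (c : Cmd) (i : ℕ) (h : c.keepsReg i = true) (s : State) (j : ℕ) :
    (iterLoop c.exec i s j).reg i = j := by
  induction j with
  | zero => simp [iterLoop]
  | succ j ih => simp [iterLoop, Cmd.exec_reg c h, ih]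

theorem iterLoop_same (c : Cmd) (i : ℕ) (s : State) (j : ℕ) :
    Same (.loop i c) s (iterLoop c.exec i s j) := by
  constructor
  · intro r h
    simp only [Cmd.keepsReg, Bool.and_eq_true, decide_eq_true_eq] at h
    induction j with
    | zero => simp [iterLoop, h.1]
    | succ j ih => simp [iterLoop, h.1, Cmd.exec_reg c h.2, ih]
  · intro k h a
    simp only [Cmd.keepsArr] at h
    induction j with
    | zero => rfl
    | succ j ih => simp [iterLoop, Cmd.exec_arr c h, ih]

/-- The invariant rule for loops. The invariant need not mention what the loop does not write
to. -/
theorem Sat.loop {M n : ℕ} {i : ℕ} {p : Cmd} {s : State} {Q : State → Prop}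
    (Inv : ℕ → State → Prop) (hn : s.reg 0 = n) (hi : p.keepsReg i = true)
    (h0 : Inv 0 (s.setReg i 0))
    (hstep : ∀ j < n, ∀ s', Same (.loop i p) s s' → s'.reg i = j → Inv j s' →
      Sat M p s' fun s'' => Inv (j + 1) (s''.setReg i (j + 1)))
    (hQ : ∀ s', Same (.loop i p) s s' → Inv n s' → Q s') : Sat M (.loop i p) s Q := by
  have hn' : (s.reg 0).toNat = n := by omega
  have inv : ∀ j ≤ n, Inv j (iterLoop p.exec i s j) := by
    intro j hj
    induction j with
    | zero => exact h0
    | succ j ih =>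
      have := (hstep j (by omega) _ (iterLoop_same p i s j) (iterLoop_reg p i hi s j)
        (ih (by omega))).2
      rw [iterLoop, Cmd.exec_reg p hi, iterLoop_reg p i hi]
      exact this
  refine ⟨?_, hQ _ (Cmd.exec_same _ _) ?_⟩
  · intro j hj
    rw [hn'] at hj
    exact (hstep j hj _ (iterLoop_same p i s j) (iterLoop_reg p i hi s j) (inv j hj.le)).1
  · simp only [Cmd.exec, hn']
    exact inv n le_rfl

/-- The translation to machine programs is correct: it has the same effect, it runs within the
bound on the running time, and the numbers stay within a fixed power of the bound on the stored
values. -/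
theorem Cmd.run_compile {M : ℕ} (hM : 8 ≤ M) {n : ℕ} (c : Cmd) (hc : c.wf = true) (s : State)
    (hs : Bounded M s) (hn : s.reg 0 = n) (hsafe : c.Safe M s) :
    (∃ t ≤ c.cost n, Run (M ^ 64) c.compile s t (c.exec s)) ∧ Bounded M (c.exec s) := by
  induction c generalizing s with
  | skip => exact ⟨⟨1, le_rfl, .skip s⟩, hs⟩
  | set i e =>
    exact ⟨⟨_, le_rfl, .set s i e (Expr.small.fits hM hs hc)⟩, hs.setReg i hsafe⟩
  | store k i e =>
    simp only [wf, Bool.and_eq_true] at hc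
    exact ⟨⟨_, le_rfl, .write s _ e (Expr.small.fits hM hs hc.1) (Expr.small.fits hM hs hc.2)⟩,
      hs.setMem _ hsafe⟩
  | poke a e =>
    simp only [wf, Bool.and_eq_true] at hc
    exact ⟨⟨_, le_rfl, .write s _ e (Expr.small.fits hM hs hc.1) (Expr.small.fits hM hs hc.2)⟩,
      hs.setMem _ hsafe⟩
  | seq p q ihp ihq =>
    simp only [wf, Bool.and_eq_true] at hc
    obtain ⟨⟨t1, ht1, h1⟩, hb1⟩ := ihp hc.1.1 s hs hn hsafe.1
    obtain ⟨⟨t2, ht2, h2⟩, hb2⟩ := ihq hc.1.2 _ hb1 (by rw [exec_reg p hc.2, hn]) hsafe.2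
    exact ⟨⟨t1 + t2, by simp only [cost]; omega, .seq _ _ _ _ _ _ _ h1 h2⟩, hb2⟩
  | ite e p q ihp ihq =>
    simp only [wf, Bool.and_eq_true] at hc
    simp only [Safe] at hsafe
    simp only [exec]
    split_ifs at hsafe ⊢ with h
    · obtain ⟨⟨t1, ht1, h1⟩, hb1⟩ := ihp hc.1.2 s hs hn hsafe
      exact ⟨⟨e.cost + 1 + t1, by simp only [cost]; omega,
        .ite_pos _ _ _ _ _ _ (Expr.small.fits hM hs hc.1.1) h h1⟩, hb1⟩
    · obtain ⟨⟨t1, ht1, h1⟩, hb1⟩ := ihq hc.2 s hs hn hsafe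
      exact ⟨⟨e.cost + 1 + t1, by simp only [cost]; omega,
        .ite_neg _ _ _ _ _ _ (Expr.small.fits hM hs hc.1.1) (by omega) h1⟩, hb1⟩
  | loop i p ih =>
    simp only [wf, Bool.and_eq_true, decide_eq_true_eq] at hc
    obtain ⟨⟨⟨hp, h0⟩, hi⟩, hi0⟩ := hc
    have hn' : (s.reg 0).toNat = n := by omega
    simp only [Safe, hn'] at hsafe
    simp only [exec, hn']
    have hnM : n ≤ M := by have := hs.1 0; rw [hn, Nat.abs_cast] at this; exact_mod_cast this
    have reg0 : ∀ j, (iterLoop p.exec i s j).reg 0 = n := by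
      intro j
      rw [(iterLoop_same p i s j).1 0 (by simp [keepsReg, h0, hi0.symm]), hn]
    have bd : ∀ j ≤ n, Bounded M (iterLoop p.exec i s j) := by
      intro j hj
      induction j with
      | zero => exact hs.setReg i (by simp)
      | succ j ihj =>
        refine (ih hp _ (ihj (by omega)) (reg0 j) (hsafe j (by omega))).2.setReg i ?_
        rw [exec_reg p hi, iterLoop_reg p i hi]
        rw [abs_of_nonneg (by positivity)]
        omega
    refine ⟨?_, bd n le_rfl⟩
    have fe : ∀ j ≤ n, (Expr.sub (.reg 0) (.reg i)).Fits (M ^ 64) (iterLoop p.exec i s j) :=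
      fun j hj => Expr.small.fits hM (bd j hj) rfl
    have main : ∀ m ≤ n, ∃ t ≤ 4 + m * (p.cost n + 8),
        Run (M ^ 64) (.loop (.sub (.reg 0) (.reg i))
          (.seq p.compile (.set i (.add (.reg i) (.lit 1))))) (iterLoop p.exec i s (n - m)) t
          (iterLoop p.exec i s n) := by
      intro m hm
      induction m with
      | zero =>
        refine ⟨_, ?_, .loop_exit _ _ _ (fe n le_rfl) ?_⟩
        · simp [Expr.cost]
        · simp [iterLoop_reg p i hi, reg0]
      | succ m ihm =>
        obtain ⟨t, ht, h⟩ := ihm (by omega)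
        obtain ⟨⟨t1, ht1, h1⟩, hb1⟩ :=
          ih hp _ (bd (n - (m + 1)) (by omega)) (reg0 _) (hsafe _ (by omega))
        have e1 : n - m = (n - (m + 1)) + 1 := by omega
        rw [e1] at h
        refine ⟨_, ?_, .loop_step _ _ _ _ _ _ _ (fe _ (by omega)) ?_
          (.seq _ _ _ _ _ _ _ h1 (.set _ _ _ (Expr.small.fits hM hb1 rfl))) h⟩
        · simp only [Expr.cost]
          rw [Nat.succ_mul]
          omega
        · simp only [Expr.eval, iterLoop_reg p i hi, reg0]
          omega
    obtain ⟨t, ht, h⟩ := main n le_rfl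
    rw [Nat.sub_self] at h
    refine ⟨2 + t, ?_, .seq _ _ _ _ _ _ _ (.set _ _ _ (Expr.small.fits hM hs rfl)) h⟩
    simp only [cost]
    omega

/-! ### Stopping distributions and slopes -/

/-- A sequence that lies above a line has at least the value of the line at `T`. -/
theorem le_seqValue {u : ℕ → ℝ} {W : ℝ} (hu : ∀ t, |u t| ≤ W * (t + 1)) {T ν b : ℝ}
    (h : ∀ t : ℕ, ν ≤ u t + b * (T - t)) : (ν : EReal) ≤ seqValue u T := by
  refine le_iInf fun δ => le_iInf fun hδ => le_iInf fun hT => ?_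
  rw [EReal.coe_le_coe_iff]
  have hsum : Summable fun t => u t * δ t := by
    have h1 : Summable fun t : ℕ => W * (t * δ t) + W * δ t :=
      (hT.summable.mul_left W).add (hδ.2.summable.mul_left W)
    refine Summable.of_norm_bounded h1 fun t => ?_
    rw [Real.norm_eq_abs, abs_mul, abs_of_nonneg (hδ.1 t)]
    nlinarith [hu t, hδ.1 t, mul_le_mul_of_nonneg_right (hu t) (hδ.1 t)]
  have h2 : HasSum (fun t : ℕ => (ν - b * T) * δ t + b * (t * δ t)) ((ν - b * T) * 1 + b * T) :=
    (hδ.2.mul_left _).add (hT.mul_left _)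
  have h3 := hasSum_le (fun t => ?_) h2 hsum.hasSum
  · unfold expectedUtility
    linarith
  · have := mul_le_mul_of_nonneg_right (h t) (hδ.1 t)
    nlinarith

theorem seqValue_le_single {u : ℕ → ℝ} (t : ℕ) : seqValue u t ≤ (u t : ℝ) := by
  have key : ∀ f : ℕ → ℝ, HasSum (fun s => f s * if s = t then 1 else 0) (f t) := by
    intro f
    convert hasSum_ite_eq t (f t) using 2 with s
    by_cases hs : s = t <;> simp [hs]
  refine iInf_le_of_le (fun s => if s = t then 1 else 0) (iInf_le_of_le ⟨?_, ?_⟩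
    (iInf_le_of_le (key fun s => (s : ℝ)) ?_))
  · intro s; dsimp only; split_ifs <;> norm_num
  · exact hasSum_ite_eq t 1
  · rw [expectedUtility, (key u).tsum_eq]

theorem seqValue_le_two {u : ℕ → ℝ} {t₁ t₂ : ℕ} {T : ℝ} (h₁ : (t₁ : ℝ) < T) (h₂ : T < t₂) :
    seqValue u T ≤ (((t₂ - T) / (t₂ - t₁) * u t₁ + (T - t₁) / (t₂ - t₁) * u t₂ : ℝ) : EReal) := by
  set α : ℝ := (t₂ - T) / (t₂ - t₁) with hα
  set β : ℝ := (T - t₁) / (t₂ - t₁) with hβ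
  have hd : (0 : ℝ) < t₂ - t₁ := by linarith
  have hα0 : 0 ≤ α := div_nonneg (by linarith) hd.le
  have hβ0 : 0 ≤ β := div_nonneg (by linarith) hd.le
  have hαβ : α + β = 1 := by rw [hα, hβ, ← add_div, div_eq_one_iff_eq hd.ne']; ring
  have key : ∀ f : ℕ → ℝ, HasSum
      (fun s => f s * ((if s = t₁ then α else 0) + if s = t₂ then β else 0))
      (f t₁ * α + f t₂ * β) := by
    intro f
    have := (hasSum_ite_eq t₁ (f t₁ * α)).add (hasSum_ite_eq t₂ (f t₂ * β))
    convert this using 2 with s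
    rw [mul_add]
    congr 1 <;> split_ifs with hs <;> simp [hs]
  refine iInf_le_of_le (fun s => (if s = t₁ then α else 0) + if s = t₂ then β else 0)
    (iInf_le_of_le ⟨?_, ?_⟩ (iInf_le_of_le ?_ ?_))
  · intro s; dsimp only; split_ifs <;> linarith
  · have := key fun _ => 1
    simpa [hαβ] using this
  · have := key fun s => s
    have e : (t₁ : ℝ) * α + t₂ * β = T := by
      rw [hα, hβ]; field_simp; ring
    rwa [e] at this
  · rw [expectedUtility, (key u).tsum_eq]
    rw [EReal.coe_le_coe_iff]
    linarith

/-- If the value of a sequence is at least `ν`, then some line that takes the value `ν` at `T` lies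
below the sequence, and it touches the sequence at a time before `T` (this is the lower convex
hull of the sequence at `T`). Only the constraints up to the touching time and those relative to
the touching point are recorded, as this covers the case `T = 0` too. -/
theorem exists_slope {u : ℕ → ℝ} {W : ℝ} (hu : ∀ t : ℕ, u 0 - W * t ≤ u t) {T ν : ℝ} (hT : 0 ≤ T)
    (h : (ν : EReal) ≤ seqValue u T) :
    ∃ (b : ℝ) (t₁ : ℕ), (t₁ : ℝ) ≤ T ∧ (∀ k : ℕ, b * k ≤ u (t₁ + k) - u t₁) ∧
      ∀ j ≤ t₁, ν ≤ u j + b * (T - j) := by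
  rcases hT.eq_or_lt with rfl | hT
  · refine ⟨-W, 0, by simp, fun k => ?_, fun j hj => ?_⟩
    · have := hu k; rw [zero_add]; linarith
    · obtain rfl : j = 0 := by omega
      have := h.trans (by simpa using seqValue_le_single (u := u) 0)
      rw [EReal.coe_le_coe_iff] at this
      simpa using this
  · -- the steepest line through `(T, ν)` and one of the points before `T`
    have hne : (Finset.range ⌈T⌉₊).Nonempty := by simpa using hT
    obtain ⟨t₁, ht₁, hmax⟩ := Finset.exists_max_image (Finset.range ⌈T⌉₊)
      (fun t : ℕ => (ν - u t) / (T - t)) hne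
    rw [Finset.mem_range, Nat.lt_ceil] at ht₁
    set b := (ν - u t₁) / (T - t₁) with hb
    have htouch : u t₁ + b * (T - t₁) = ν := by
      rw [hb]; field_simp [(sub_pos.2 ht₁).ne']; ring
    have hall : ∀ t : ℕ, ν ≤ u t + b * (T - t) := by
      intro t
      rcases lt_trichotomy (t : ℝ) T with ht | ht | ht
      · have := hmax t (by rwa [Finset.mem_range, Nat.lt_ceil])
        rw [div_le_iff₀ (sub_pos.2 ht)] at this
        linarith
      · subst ht
        have := h.trans (seqValue_le_single t)
        rw [EReal.coe_le_coe_iff] at this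
        linarith
      · have := h.trans (seqValue_le_two ht₁ ht)
        rw [EReal.coe_le_coe_iff] at this
        have hd : (0 : ℝ) < t - t₁ := by linarith
        have h1 : ν * (t - t₁) ≤ (t - T) * u t₁ + (T - t₁) * u t := by
          calc ν * (t - t₁) ≤ _ := mul_le_mul_of_nonneg_right this hd.le
            _ = _ := by field_simp
        have h2 : 0 ≤ (T - t₁) * (u t + b * (T - t) - ν) := by
          have e : u t₁ = ν - b * (T - t₁) := by linarith
          rw [e] at h1
          nlinarith
        have := nonneg_of_mul_nonneg_right h2 (sub_pos.2 ht₁)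
        linarith
    refine ⟨b, t₁, ht₁.le, fun k => ?_, fun j _ => hall j⟩
    have := hall (t₁ + k)
    push_cast at this
    linarith

/-! ### Utilities of plans -/

section
variable {V : Type} {G : WeightedGraph V}

/-- The total weight of the first `k` edges of a path. -/
def pathWeight (G : WeightedGraph V) (x : ℕ → V) (k : ℕ) : ℤ :=
  ∑ i ∈ Finset.range k, G.w (x i, x (i + 1))

theorem pathWeight_zero (x : ℕ → V) : pathWeight G x 0 = 0 := rfl

theorem pathWeight_succ (x : ℕ → V) (k : ℕ) :
    pathWeight G x (k + 1) = pathWeight G x k + G.w (x k, x (k + 1)) :=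
  Finset.sum_range_succ _ _

theorem pathWeight_add (x : ℕ → V) (k l : ℕ) :
    pathWeight G x (k + l) = pathWeight G x k + pathWeight G (fun i => x (k + i)) l :=
  Finset.sum_range_add _ _ _

theorem pathWeight_succ' (x : ℕ → V) (k : ℕ) :
    pathWeight G x (k + 1) = G.w (x 0, x 1) + pathWeight G (fun i => x (i + 1)) k := by
  rw [add_comm k 1, pathWeight_add]
  simp [pathWeight, add_comm]

theorem pathWeight_congr {x y : ℕ → V} {k : ℕ} (h : ∀ i ≤ k, x i = y i) :
    pathWeight G x k = pathWeight G y k := by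
  refine Finset.sum_congr rfl fun i hi => ?_
  rw [Finset.mem_range] at hi
  rw [h i hi.le, h (i + 1) hi]

theorem utility_eq (x : ℕ → V) (t : ℕ) : utility G x t = (pathWeight G x (t + 1) : ℝ) := rfl

theorem abs_weight_le {e : V × V} (he : e ∈ G.E) : |G.w e| ≤ (G.maxWeight : ℤ) := by
  rw [Int.abs_eq_natAbs]
  exact_mod_cast Finset.le_sup (f := fun e => (G.w e).natAbs) he

theorem abs_pathWeight_le {x : ℕ → V} {k : ℕ} (hx : ∀ i < k, (x i, x (i + 1)) ∈ G.E) :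
    |pathWeight G x k| ≤ k * (G.maxWeight : ℤ) := by
  refine (Finset.abs_sum_le_sum_abs _ _).trans ?_
  calc _ ≤ ∑ i ∈ Finset.range k, (G.maxWeight : ℤ) :=
        Finset.sum_le_sum fun i hi => abs_weight_le (hx i (Finset.mem_range.1 hi))
    _ = _ := by simp

theorem IsPlan.shift {x : ℕ → V} (hx : IsPlan G x) (k : ℕ) : IsPlan G fun i => x (k + i) :=
  fun i => hx (k + i)

theorem IsPlan.le_seqValue {x : ℕ → V} (hx : IsPlan G x) {T ν b : ℝ}
    (h : ∀ t : ℕ, ν ≤ utility G x t + b * (T - t)) : (ν : EReal) ≤ seqValue (utility G x) T := by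
  refine ExpHorizon.le_seqValue (W := G.maxWeight) (fun t => ?_) h
  have := abs_pathWeight_le (G := G) (k := t + 1) fun i _ => hx i
  rw [utility_eq, mul_comm]
  exact_mod_cast this

/-- A plan from `y` all of whose initial parts have mean weight at least `b` exists. -/
def Sustains (G : WeightedGraph V) (y : V) (b : ℝ) : Prop :=
  ∃ x, IsPlan G x ∧ x 0 = y ∧ ∀ k : ℕ, b * k ≤ pathWeight G x k

/-- A plan of value at least `ν` has a time `t₁ ≤ T` after which it sustains a slope `b`, such that
no constraint of the line of slope `b` through `(T, ν)` is violated up to `t₁`. -/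
theorem IsPlan.exists_slope {x : ℕ → V} (hx : IsPlan G x) {T ν : ℝ} (hT : 0 ≤ T)
    (h : (ν : EReal) ≤ seqValue (utility G x) T) :
    ∃ (b : ℝ) (t₁ : ℕ), (t₁ : ℝ) ≤ T ∧ Sustains G (x (t₁ + 1)) b ∧
      ∀ j ≤ t₁, ν ≤ utility G x j + b * (T - j) := by
  have hu : ∀ t : ℕ, utility G x 0 - G.maxWeight * t ≤ utility G x t := by
    intro t
    have h1 := abs_pathWeight_le (G := G) (k := t) fun i _ => hx.shift 1 i
    have h2 := pathWeight_add (G := G) x 1 t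
    rw [add_comm 1 t] at h2
    have h3 := neg_abs_le (pathWeight G (fun i => x (1 + i)) t)
    rw [utility_eq, utility_eq, h2]
    have h4 : -(t * (G.maxWeight : ℤ)) ≤ pathWeight G (fun i => x (1 + i)) t := by linarith
    have h5 : -((t : ℝ) * G.maxWeight) ≤ pathWeight G (fun i => x (1 + i)) t := by exact_mod_cast h4
    push_cast
    linarith
  obtain ⟨b, t₁, ht₁, hs, hj⟩ := ExpHorizon.exists_slope hu hT h
  refine ⟨b, t₁, ht₁, ⟨fun i => x (t₁ + 1 + i), hx.shift _, rfl, fun k => ?_⟩, hj⟩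
  have := hs k
  rw [utility_eq, utility_eq, show t₁ + k + 1 = t₁ + 1 + k by omega, pathWeight_add] at this
  push_cast at this
  linarith

end
/-! ### Walks outside a set of vertices -/

section
variable {n : ℕ} {G : WeightedGraph (Fin n)}

/-- The first `m` steps of `x` use edges of `G` and start at vertices outside `S`. -/
def IsWalk (G : WeightedGraph (Fin n)) (S : Finset (Fin n)) (m : ℕ) (x : ℕ → Fin n) : Prop :=
  ∀ i < m, (x i, x (i + 1)) ∈ G.E ∧ x i ∉ S

theorem IsWalk.mono {S S' : Finset (Fin n)} (hS : S ⊆ S') {m : ℕ} {x : ℕ → Fin n}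
    (h : IsWalk G S' m x) : IsWalk G S m x :=
  fun i hi => ⟨(h i hi).1, fun hx => (h i hi).2 (hS hx)⟩

/-- The short closed walks outside `S` have mean weight at most `a`. -/
def CyclesLE (G : WeightedGraph (Fin n)) (S : Finset (Fin n)) (a : ℝ) : Prop :=
  ∀ m x, 1 ≤ m → m ≤ n → IsWalk G S m x → x m = x 0 → (pathWeight G x m : ℝ) ≤ a * m

theorem CyclesLE.mono {S S' : Finset (Fin n)} (hS : S ⊆ S') {a : ℝ} (h : CyclesLE G S a) :
    CyclesLE G S' a :=
  fun m x h1 hm hx hc => h m x h1 hm (hx.mono hS) hc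

/-- If no closed walk gains against the slope `a`, then closed parts can be cut out of a long walk
without lowering any of its partial sums relative to `a`. -/
theorem CyclesLE.shorten {S : Finset (Fin n)} {a : ℝ} (h : CyclesLE G S a) (m : ℕ)
    (x : ℕ → Fin n) (hx : IsWalk G S m x) :
    ∃ m' ≤ n, ∃ x', IsWalk G S m' x' ∧ x' 0 = x 0 ∧ x' m' = x m ∧
      pathWeight G x m - a * m ≤ pathWeight G x' m' - a * m' ∧
      ∀ i' ≤ m', ∃ i ≤ m, pathWeight G x i - a * i ≤ pathWeight G x' i' - a * i' := by
  induction m using Nat.strong_induction_on generalizing x with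
  | _ m ih =>
  rcases le_or_gt m n with hm | hm
  · exact ⟨m, hm, x, hx, rfl, rfl, le_rfl, fun i hi => ⟨i, hi, le_rfl⟩⟩
  obtain ⟨i, j, hij, hjn, hxij⟩ : ∃ i j : ℕ, i < j ∧ j ≤ n ∧ x i = x j := by
    obtain ⟨i, j, hne, he⟩ := Fintype.exists_ne_map_eq_of_card_lt
      (fun i : Fin (n + 1) => x i) (by simp)
    rcases lt_or_gt_of_ne hne with hlt | hlt
    · exact ⟨i, j, hlt, by omega, he⟩
    · exact ⟨j, i, hlt, by omega, he.symm⟩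
  obtain ⟨d, rfl⟩ := Nat.exists_eq_add_of_lt hij
  set y : ℕ → Fin n := fun t => if t ≤ i then x t else x (t + (d + 1)) with hy
  have y1 : ∀ t ≤ i, y t = x t := fun t ht => by simp [hy, ht]
  have y2 : ∀ s, y (i + s) = x (i + d + 1 + s) := by
    intro s
    rcases Nat.eq_zero_or_pos s with rfl | hs
    · simpa [hy] using hxij
    · simp only [hy]
      rw [if_neg (by omega)]
      congr 1
      omega
  have hclosed := h (d + 1) (fun s => x (i + s)) (by omega) (by omega)
    (fun s hs => hx (i + s) (by omega)) (by simpa [add_assoc] using hxij.symm)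
  have w1 : ∀ t ≤ i, pathWeight G y t = pathWeight G x t := fun t ht =>
    pathWeight_congr fun s hs => y1 s (by omega)
  have w2 : ∀ s, (pathWeight G x (i + d + 1 + s) : ℝ) - a * ((i + d + 1 + s : ℕ) : ℝ) ≤
      pathWeight G y (i + s) - a * ((i + s : ℕ) : ℝ) := by
    intro s
    rw [pathWeight_add x (i + d + 1) s, pathWeight_add y i s, w1 i le_rfl,
      show (fun s => y (i + s)) = fun s => x (i + d + 1 + s) from funext y2,
      show i + d + 1 = i + (d + 1) by omega, pathWeight_add x i (d + 1)]
    push_cast at hclosed ⊢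
    linarith
  obtain ⟨e, rfl⟩ : ∃ e, m = i + d + 1 + e := ⟨m - (i + d + 1), by omega⟩
  have hyw : IsWalk G S (i + e) y := by
    intro t ht
    rcases lt_or_ge t i with hti | hti
    · rw [y1 t hti.le, y1 (t + 1) hti]
      exact hx t (by omega)
    · obtain ⟨s, rfl⟩ := Nat.exists_eq_add_of_le hti
      rw [add_assoc, y2, y2]
      exact hx (i + d + 1 + s) (by omega)
  obtain ⟨m', hm', x', hx', h0, hl, hw, hp⟩ := ih (i + e) (by omega) y hyw
  refine ⟨m', hm', x', hx', by rw [h0, y1 0 (by omega)], by rw [hl, y2], (w2 e).trans hw, ?_⟩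
  intro i' hi'
  obtain ⟨t, ht, hle⟩ := hp i' hi'
  rcases le_or_gt t i with hti | hti
  · exact ⟨t, by omega, by rwa [w1 t hti] at hle⟩
  · obtain ⟨s, rfl⟩ := Nat.exists_eq_add_of_le hti.le
    exact ⟨i + d + 1 + s, by omega, (w2 s).trans hle⟩

/-- If the short walks outside `S` that close up or end in `S` have mean weight at most `a`, then no
vertex outside `S` sustains a slope larger than `a`. -/
theorem Sustains.le_of_walks_le {S : Finset (Fin n)} {a b : ℝ} {y : Fin n} (hy : y ∉ S)
    (hb : Sustains G y b) (hC : CyclesLE G S a)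
    (hS : ∀ m x, 1 ≤ m → m ≤ n → IsWalk G S m x → x m ∈ S → (pathWeight G x m : ℝ) ≤ a * m) :
    b ≤ a := by
  by_contra hab
  rw [not_le] at hab
  obtain ⟨x, hx, rfl, hxb⟩ := hb
  by_cases hj : ∃ j, x j ∈ S
  · classical
    set j := Nat.find hj with hjd
    have hjS : x j ∈ S := Nat.find_spec hj
    have hw : IsWalk G S j x := fun i hi => ⟨hx i, Nat.find_min hj hi⟩
    have hj0 : 0 < j := by
      rcases Nat.eq_zero_or_pos j with h0 | h0
      · rw [h0] at hjS; exact absurd hjS hy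
      · exact h0
    obtain ⟨m', hm', x', hx', h0, hl, hle, -⟩ := hC.shorten j x hw
    have hm1 : 1 ≤ m' := by
      rcases Nat.eq_zero_or_pos m' with h1 | h1
      · subst h1; rw [← hl, h0] at hjS; exact absurd hjS hy
      · exact h1
    have := hS m' x' hm1 hm' hx' (hl ▸ hjS)
    have hj0' : (0 : ℝ) < j := by exact_mod_cast hj0
    nlinarith [hxb j]
  · push Not at hj
    obtain ⟨N, hN⟩ := exists_nat_gt ((n * (G.maxWeight + |a|) : ℝ) / (b - a))
    rw [div_lt_iff₀ (by linarith)] at hN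
    obtain ⟨m', hm', x', hx', h0, hl, hle, -⟩ := hC.shorten N x fun i _ => ⟨hx i, hj i⟩
    have h1 : (pathWeight G x' m' : ℝ) ≤ m' * G.maxWeight := by
      exact_mod_cast (le_abs_self _).trans (abs_pathWeight_le fun i hi => (hx' i hi).1)
    have h2 : (m' : ℝ) * (G.maxWeight + |a|) ≤ n * (G.maxWeight + |a|) := by
      have : (m' : ℝ) ≤ n := by exact_mod_cast hm'
      gcongr
    have h3 : -(a * m') ≤ |a| * m' := by
      have := mul_le_mul_of_nonneg_right (neg_le_abs a) (Nat.cast_nonneg (α := ℝ) m')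
      linarith
    nlinarith [hxb N]

/-! ### Reaching a set of vertices with limited credit -/

/-- From the vertex `v` with credit `c`, the set `T` can be reached in at most `k` steps such that
the credit, to which each edge adds the difference of its weight and `b`, is never negative. -/
def CanReach (G : WeightedGraph (Fin n)) (b : ℝ) (T : Finset (Fin n)) : ℕ → Fin n → ℝ → Prop
  | 0, v, c => 0 ≤ c ∧ v ∈ T
  | k + 1, v, c => 0 ≤ c ∧ (v ∈ T ∨ ∃ u, (v, u) ∈ G.E ∧ CanReach G b T k u (c + (G.w (v, u) - b)))

theorem CanReach.nonneg {b : ℝ} {T : Finset (Fin n)} {k : ℕ} {v : Fin n} {c : ℝ}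
    (h : CanReach G b T k v c) : 0 ≤ c := by
  cases k <;> exact h.1

theorem CanReach.of_mem {b : ℝ} {T : Finset (Fin n)} {k : ℕ} {v : Fin n} {c : ℝ}
    (hv : v ∈ T) (hc : 0 ≤ c) : CanReach G b T k v c := by
  cases k
  · exact ⟨hc, hv⟩
  · exact ⟨hc, .inl hv⟩

theorem CanReach.mono {b b' : ℝ} {T T' : Finset (Fin n)} {k k' : ℕ} {v : Fin n} {c c' : ℝ}
    (h : CanReach G b T k v c) (hb : b' ≤ b) (hT : T ⊆ T') (hk : k ≤ k') (hc : c ≤ c') :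
    CanReach G b' T' k' v c' := by
  induction k generalizing v c c' k' with
  | zero => exact .of_mem (hT h.2) (h.1.trans hc)
  | succ k ih =>
    obtain ⟨k', rfl⟩ : ∃ l, k' = l + 1 := ⟨k' - 1, by omega⟩
    refine ⟨h.1.trans hc, ?_⟩
    rcases h.2 with h2 | ⟨u, hu, h2⟩
    · exact .inl (hT h2)
    · exact .inr ⟨u, hu, ih h2 (by omega) (by linarith)⟩

theorem CanReach.of_path {b : ℝ} {T : Finset (Fin n)} {k m : ℕ} {x : ℕ → Fin n} {c : ℝ}
    (hx : ∀ i < m, (x i, x (i + 1)) ∈ G.E) (hc : ∀ i < m, 0 ≤ c + (pathWeight G x i - b * i))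
    (h : CanReach G b T k (x m) (c + (pathWeight G x m - b * m))) :
    CanReach G b T (m + k) (x 0) c := by
  induction m generalizing x c with
  | zero => simpa [pathWeight_zero] using h
  | succ m ih =>
    rw [show m + 1 + k = m + k + 1 by omega]
    refine ⟨by simpa [pathWeight_zero] using hc 0 (by omega), .inr ⟨x 1, hx 0 (by omega), ?_⟩⟩
    refine ih (x := fun i => x (i + 1)) (fun i hi => hx (i + 1) (by omega)) (fun i hi => ?_) ?_
    · have := hc (i + 1) (by omega)
      rw [pathWeight_succ'] at this
      push_cast at this
      linarith
    · rw [pathWeight_succ'] at h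
      push_cast at h
      convert h using 1
      ring

theorem CanReach.exists_walk {b : ℝ} {T : Finset (Fin n)} {k : ℕ} {v : Fin n} {c : ℝ}
    (h : CanReach G b T k v c) : ∃ m, ∃ x, IsWalk G T m x ∧ x 0 = v ∧ x m ∈ T ∧
      ∀ i ≤ m, 0 ≤ c + (pathWeight G x i - b * i) := by
  have stay : ∀ {v : Fin n} {c : ℝ}, 0 ≤ c → v ∈ T → ∃ m, ∃ x, IsWalk G T m x ∧ x 0 = v ∧
      x m ∈ T ∧ ∀ i ≤ m, 0 ≤ c + (pathWeight G x i - b * i) := by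
    intro v c hc hv
    refine ⟨0, fun _ => v, fun i hi => absurd hi (by omega), rfl, hv, fun i hi => ?_⟩
    obtain rfl : i = 0 := by omega
    simpa [pathWeight_zero] using hc
  induction k generalizing v c with
  | zero => exact stay h.1 h.2
  | succ k ih =>
    by_cases hv : v ∈ T
    · exact stay h.1 hv
    obtain ⟨u, hu, h2⟩ := h.2.resolve_left hv
    obtain ⟨m, x, hx, rfl, hT, hc⟩ := ih h2
    refine ⟨m + 1, fun i => Nat.casesOn i v x, ?_, rfl, hT, ?_⟩
    · rintro (_ | i) hi
      · exact ⟨hu, hv⟩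
      · exact hx i (by omega)
    · rintro (_ | i) hi
      · simpa [pathWeight_zero] using h.1
      · have := hc i (by omega)
        rw [pathWeight_succ']
        push_cast
        change 0 ≤ c + ((G.w (v, x 0) : ℝ) + (pathWeight G x i : ℝ) - b * (i + 1))
        linarith

/-- Without closed walks that gain against the slope, `n` steps are enough. -/
theorem CanReach.le_card {b : ℝ} {T : Finset (Fin n)} (hT : CyclesLE G T b) {k : ℕ} {v : Fin n}
    {c : ℝ} (h : CanReach G b T k v c) : CanReach G b T n v c := by
  obtain ⟨m, x, hx, rfl, hm, hc⟩ := h.exists_walk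
  obtain ⟨m', hm', x', hx', h0, hl, -, hp⟩ := hT.shorten m x hx
  have hc' : ∀ i ≤ m', 0 ≤ c + (pathWeight G x' i - b * i) := by
    intro i hi
    obtain ⟨j, hj, hle⟩ := hp i hi
    linarith [hc j hj]
  rw [← h0]
  refine (CanReach.of_path (k := 0) (fun i hi => (hx' i hi).1) (fun i hi => hc' i hi.le)
    (.of_mem (hl ▸ hm) (hc' m' le_rfl))).mono le_rfl subset_rfl (by omega) le_rfl

/-- From `v`, the set `T` can be reached by a nonempty walk of short length whose initial parts
all have mean weight at least `b`. -/
def Returns (G : WeightedGraph (Fin n)) (b : ℝ) (T : Finset (Fin n)) (v : Fin n) : Prop :=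
  ∃ u, (v, u) ∈ G.E ∧ CanReach G b T n u (G.w (v, u) - b)

theorem Returns.mono {b b' : ℝ} {T T' : Finset (Fin n)} {v : Fin n} (h : Returns G b T v)
    (hb : b' ≤ b) (hT : T ⊆ T') : Returns G b' T' v := by
  obtain ⟨u, hu, h⟩ := h
  exact ⟨u, hu, h.mono hb hT le_rfl (by linarith)⟩

/-- A walk of mean weight at least `a` that closes up or ends in `S` has a vertex from which it can
be followed without ever falling below the slope `a`: the one where the partial sums relative to
`a` are minimal. -/
theorem exists_returns {S : Finset (Fin n)} {a : ℝ} {m : ℕ} {x : ℕ → Fin n} (h1 : 1 ≤ m)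
    (hm : m ≤ n) (hx : IsWalk G S m x) (hend : x m ∈ S ∨ x m = x 0)
    (hw : a * m ≤ pathWeight G x m) : ∃ z ∉ S, Returns G a (insert z S) z := by
  obtain ⟨i, hi, hmin⟩ := Finset.exists_min_image (Finset.range m)
    (fun i => (pathWeight G x i : ℝ) - a * i) ⟨0, Finset.mem_range.2 h1⟩
  rw [Finset.mem_range] at hi
  have h0 : (pathWeight G x i : ℝ) - a * i ≤ 0 := by
    have := hmin 0 (Finset.mem_range.2 h1)
    simpa [pathWeight_zero] using this
  have hall : ∀ j ≤ m, (pathWeight G x i : ℝ) - a * i ≤ pathWeight G x j - a * j := by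
    intro j hj
    rcases hj.lt_or_eq with hj | rfl
    · exact hmin j (by simpa using hj)
    · linarith
  have hfin : CanReach G a (insert (x i) S) i (x m)
      ((pathWeight G x m - a * m) - (pathWeight G x i - a * i)) := by
    rcases hend with hS | hcl
    · exact .of_mem (Finset.mem_insert_of_mem hS) (by linarith)
    · rw [hcl]
      exact CanReach.of_path (k := 0) (fun j hj => (hx j (by omega)).1)
        (fun j hj => by have := hall j (by omega); linarith)
        (.of_mem (Finset.mem_insert_self _ _) (by linarith))
  have step := pathWeight_succ (G := G) x i
  obtain ⟨l, rfl⟩ : ∃ l, m = i + 1 + l := ⟨m - (i + 1), by omega⟩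
  refine ⟨x i, (hx i hi).2, x (i + 1), (hx i hi).1, ?_⟩
  have e : ∀ j, (G.w (x i, x (i + 1)) - a : ℝ) + (pathWeight G (fun s => x (i + 1 + s)) j - a * j) =
      (pathWeight G x (i + 1 + j) - a * ((i + 1 + j : ℕ) : ℝ)) - (pathWeight G x i - a * i) := by
    intro j
    rw [pathWeight_add x (i + 1) j, step]
    push_cast
    ring
  refine (CanReach.of_path (x := fun s => x (i + 1 + s)) (m := l) (k := i)
    (fun j hj => (hx (i + 1 + j) (by omega)).1) (fun j hj => ?_) ?_).mono le_rfl subset_rfl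
    (by omega) le_rfl
  · rw [e]
    linarith [hall (i + 1 + j) (by omega)]
  · rw [e]
    exact hfin

/-! ### The two dynamic programs -/

/-- The weight of an edge, scaled and shifted to `Q w - P`, and `⊥` if there is no edge. -/
def scaledWeight (G : WeightedGraph (Fin n)) (Q P : ℤ) (v u : Fin n) : WithBot ℤ :=
  if (v, u) ∈ G.E then ((Q * G.w (v, u) - P : ℤ) : WithBot ℤ) else ⊥

/-- The largest sum of the scaled weight of an edge from `v` and the entry of its end in the
table `X`. -/
def bestEdge (G : WeightedGraph (Fin n)) (Q P : ℤ) (X : Fin n → WithBot ℤ) (v : Fin n) :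
    WithBot ℤ :=
  Finset.univ.sup fun u => scaledWeight G Q P v u + X u

/-- One round of a dynamic program, in one of two modes. In the mode `false`, the entries are the
largest weights of walks of a given length outside `S`; in the mode `true`, the negatives of the
smallest credits that are needed to reach `insert z S`. -/
def tableStep (G : WeightedGraph (Fin n)) (mode : Bool) (S : Finset (Fin n)) (z : Fin n) (Q P : ℤ)
    (X : Fin n → WithBot ℤ) (v : Fin n) : WithBot ℤ :=
  if mode then (if v ∈ insert z S then 0 else min 0 (bestEdge G Q P X v))
  else (if v ∈ S then ⊥ else bestEdge G Q P X v)

/-- The table after `k` rounds; at the beginning, the entries are `0` on `insert z S` and `⊥`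
elsewhere. -/
def table (G : WeightedGraph (Fin n)) (mode : Bool) (S : Finset (Fin n)) (z : Fin n) (Q P : ℤ) :
    ℕ → Fin n → WithBot ℤ
  | 0, v => if v ∈ insert z S then 0 else ⊥
  | k + 1, v => tableStep G mode S z Q P (table G mode S z Q P k) v

theorem le_bestEdge {Q P : ℤ} {X : Fin n → WithBot ℤ} {v u : Fin n} {f : ℤ} (h : (v, u) ∈ G.E)
    (hX : X u = (f : WithBot ℤ)) :
    ((Q * G.w (v, u) - P + f : ℤ) : WithBot ℤ) ≤ bestEdge G Q P X v := by
  have := Finset.le_sup (f := fun u => scaledWeight G Q P v u + X u) (Finset.mem_univ u)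
  simp only [hX] at this
  rwa [scaledWeight, if_pos h, ← WithBot.coe_add] at this

theorem scaledWeight_add_eq_coe {Q P : ℤ} {x : WithBot ℤ} {v u : Fin n} {e : ℤ}
    (h : scaledWeight G Q P v u + x = (e : WithBot ℤ)) :
    (v, u) ∈ G.E ∧ ∃ f : ℤ, x = (f : WithBot ℤ) ∧ e = Q * G.w (v, u) - P + f := by
  unfold scaledWeight at h
  split_ifs at h with hE
  · refine ⟨hE, ?_⟩
    cases x with
    | bot => simp at h
    | coe f => exact ⟨f, rfl, by rw [← WithBot.coe_add, WithBot.coe_inj] at h; exact h.symm⟩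
  · simp at h

theorem exists_of_bestEdge {Q P : ℤ} {X : Fin n → WithBot ℤ} {v : Fin n} {e : ℤ}
    (h : bestEdge G Q P X v = (e : WithBot ℤ)) :
    ∃ u, (v, u) ∈ G.E ∧ ∃ f : ℤ, X u = (f : WithBot ℤ) ∧ e = Q * G.w (v, u) - P + f := by
  have hne : (Finset.univ : Finset (Fin n)).Nonempty := ⟨v, Finset.mem_univ v⟩
  obtain ⟨u, -, hu⟩ := Finset.exists_mem_eq_sup _ hne fun u => scaledWeight G Q P v u + X u
  rw [bestEdge, hu] at h
  exact ⟨u, scaledWeight_add_eq_coe h⟩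

theorem abs_table_le {mode : Bool} {S : Finset (Fin n)} {z : Fin n} {Q P R : ℤ}
    (hR : ∀ e ∈ G.E, |Q * G.w e - P| ≤ R) (hR0 : 0 ≤ R) {k : ℕ} {v : Fin n} {d : ℤ}
    (h : table G mode S z Q P k v = (d : WithBot ℤ)) : |d| ≤ k * R := by
  have best : ∀ k : ℕ, (∀ {v : Fin n} {d : ℤ}, table G mode S z Q P k v = (d : WithBot ℤ) →
      |d| ≤ k * R) → ∀ {v : Fin n} {d : ℤ},
      bestEdge G Q P (table G mode S z Q P k) v = (d : WithBot ℤ) → |d| ≤ (k + 1 : ℕ) * R := by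
    intro k ih v d h
    obtain ⟨u, hu, f, hf, rfl⟩ := exists_of_bestEdge h
    have := abs_add_le (Q * G.w (v, u) - P) f
    have h1 := hR _ hu
    have h2 := ih hf
    push_cast
    linarith
  induction k generalizing v d with
  | zero =>
    simp only [table] at h
    split_ifs at h
    · rw [← WithBot.coe_zero, WithBot.coe_inj] at h
      simp [← h]
    · exact absurd h (by simp)
  | succ k ih =>
    have hk : (0 : ℤ) ≤ (k + 1 : ℕ) * R := by positivity
    simp only [table, tableStep] at h
    split_ifs at h with hm hT hS
    · rw [← WithBot.coe_zero, WithBot.coe_inj] at h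
      rw [← h, abs_zero]
      exact hk
    · rcases min_choice 0 (bestEdge G Q P (table G mode S z Q P k) v) with h' | h' <;> rw [h'] at h
      · rw [← WithBot.coe_zero, WithBot.coe_inj] at h
        rw [← h, abs_zero]
        exact hk
      · exact best k ih h
    · exact absurd h (by simp)
    · exact best k ih h

theorem exists_walk_of_table {S : Finset (Fin n)} {z : Fin n} {k : ℕ} {v : Fin n} {d : ℤ}
    (h : table G false S z 1 0 k v = (d : WithBot ℤ)) :
    ∃ x, IsWalk G S k x ∧ x 0 = v ∧ x k ∈ insert z S ∧ pathWeight G x k = d := by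
  induction k generalizing v d with
  | zero =>
    simp only [table] at h
    split_ifs at h with hv
    · rw [← WithBot.coe_zero, WithBot.coe_inj] at h
      exact ⟨fun _ => v, fun i hi => absurd hi (by omega), rfl, hv, h⟩
    · exact absurd h (by simp)
  | succ k ih =>
    simp only [table, tableStep, Bool.false_eq_true, if_false] at h
    split_ifs at h with h2
    · exact absurd h (by simp)
    obtain ⟨u, hu, f, hf, rfl⟩ := exists_of_bestEdge h
    obtain ⟨x, hx, rfl, hT, rfl⟩ := ih hf
    refine ⟨fun i => Nat.casesOn i v x, ?_, rfl, hT, ?_⟩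
    · rintro (_ | i) hi
      · exact ⟨hu, h2⟩
      · exact hx i (by omega)
    · rw [pathWeight_succ']
      change G.w (v, x 0) + pathWeight G x k = _
      ring

theorem le_table_of_walk {S : Finset (Fin n)} {z : Fin n} {k : ℕ} {x : ℕ → Fin n}
    (hx : IsWalk G S k x) (hT : x k ∈ insert z S) :
    ∃ d : ℤ, table G false S z 1 0 k (x 0) = (d : WithBot ℤ) ∧ pathWeight G x k ≤ d := by
  induction k generalizing x with
  | zero => exact ⟨0, by simp only [table]; rw [if_pos hT]; rfl, le_rfl⟩
  | succ k ih =>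
    obtain ⟨d, hd, hle⟩ := ih (x := fun i => x (i + 1)) (fun i hi => hx (i + 1) (by omega)) hT
    have h1 := le_bestEdge (Q := 1) (P := 0) (hx 0 (by omega)).1 hd
    have h2 : table G false S z 1 0 (k + 1) (x 0) =
        bestEdge G 1 0 (table G false S z 1 0 k) (x 0) := by
      simp [table, tableStep, (hx 0 (by omega)).2]
    rw [h2]
    cases hb : bestEdge G 1 0 (table G false S z 1 0 k) (x 0) with
    | bot => rw [hb] at h1; exact absurd h1 (by simp)
    | coe e =>
      refine ⟨e, rfl, ?_⟩
      rw [hb, WithBot.coe_le_coe] at h1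
      rw [pathWeight_succ']
      simp only [zero_add] at h1
      linarith

theorem canReach_iff_table {S : Finset (Fin n)} {z : Fin n} {Q P : ℤ} (hQ : 0 < Q) {k : ℕ}
    {v : Fin n} {c : ℝ} : CanReach G ((P : ℝ) / Q) (insert z S) k v c ↔
      ∃ f : ℤ, table G true S z Q P k v = (f : WithBot ℤ) ∧ -(f : ℝ) ≤ Q * c := by
  have hQ' : (0 : ℝ) < Q := by exact_mod_cast hQ
  have hmul : (Q : ℝ) * (P / Q) = P := by field_simp
  have zero : ∀ {c : ℝ}, (∃ f : ℤ, (0 : WithBot ℤ) = (f : WithBot ℤ) ∧ -(f : ℝ) ≤ Q * c) ↔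
      0 ≤ c := by
    intro c
    constructor
    · rintro ⟨f, hf, h⟩
      rw [← WithBot.coe_zero, WithBot.coe_inj] at hf
      subst hf
      simp only [Int.cast_zero, neg_zero] at h
      exact nonneg_of_mul_nonneg_right h hQ'
    · exact fun h => ⟨0, rfl, by simpa using mul_nonneg hQ'.le h⟩
  induction k generalizing v c with
  | zero =>
    simp only [table, CanReach]
    split_ifs with hv
    · simp only [zero, hv, and_true]
    · simp [hv]
  | succ k ih =>
    by_cases hv : v ∈ insert z S
    · simp only [table, tableStep, hv, if_true, zero, CanReach, true_or, and_true]
    simp only [table, tableStep, hv, if_true, if_false, CanReach, false_or]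
    constructor
    · rintro ⟨hc, u, hu, h⟩
      obtain ⟨f, hf, hle⟩ := ih.1 h
      have h1 := le_bestEdge (Q := Q) (P := P) hu hf
      cases hb : bestEdge G Q P (table G true S z Q P k) v with
      | bot => rw [hb] at h1; exact absurd h1 (by simp)
      | coe e =>
        rw [hb, WithBot.coe_le_coe] at h1
        refine ⟨min 0 e, by rw [WithBot.coe_min]; rfl, ?_⟩
        have h1' : ((Q : ℝ) * G.w (v, u) - P + f) ≤ e := by exact_mod_cast h1
        have h2 : 0 ≤ Q * c := mul_nonneg hQ'.le hc
        rw [Int.cast_min, neg_le]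
        refine le_min (by simpa using h2) ?_
        nlinarith
    · rintro ⟨f, hf, hle⟩
      have hf0 : f ≤ 0 := by
        have : (f : WithBot ℤ) ≤ ((0 : ℤ) : WithBot ℤ) := hf ▸ min_le_left _ _
        exact WithBot.coe_le_coe.1 this
      have hfb : (f : WithBot ℤ) ≤ bestEdge G Q P (table G true S z Q P k) v :=
        hf ▸ min_le_right _ _
      cases hb : bestEdge G Q P (table G true S z Q P k) v with
      | bot => rw [hb] at hfb; exact absurd hfb (by simp)
      | coe e =>
        rw [hb, WithBot.coe_le_coe] at hfb
        obtain ⟨u, hu, g, hg, rfl⟩ := exists_of_bestEdge hb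
        have hf0' : (f : ℝ) ≤ 0 := by exact_mod_cast hf0
        have hfb' : (f : ℝ) ≤ Q * G.w (v, u) - P + g := by exact_mod_cast hfb
        refine ⟨nonneg_of_mul_nonneg_right (by linarith : 0 ≤ (Q : ℝ) * c) hQ', u, hu,
          ih.2 ⟨g, hg, ?_⟩⟩
        nlinarith

theorem returns_iff_bestEdge {S : Finset (Fin n)} {z v : Fin n} {Q P : ℤ} (hQ : 0 < Q) :
    Returns G ((P : ℝ) / Q) (insert z S) v ↔
      ∃ e : ℤ, bestEdge G Q P (table G true S z Q P n) v = (e : WithBot ℤ) ∧ 0 ≤ e := by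
  have hQ' : (0 : ℝ) < Q := by exact_mod_cast hQ
  have hmul : (Q : ℝ) * (P / Q) = P := by field_simp
  constructor
  · rintro ⟨u, hu, h⟩
    obtain ⟨f, hf, hle⟩ := (canReach_iff_table hQ).1 h
    have h1 := le_bestEdge (Q := Q) (P := P) hu hf
    cases hb : bestEdge G Q P (table G true S z Q P n) v with
    | bot => rw [hb] at h1; exact absurd h1 (by simp)
    | coe e =>
      rw [hb, WithBot.coe_le_coe] at h1
      have h2 : (0 : ℝ) ≤ ((Q * G.w (v, u) - P + f : ℤ) : ℝ) := by
        push_cast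
        nlinarith
      exact ⟨e, rfl, le_trans (by exact_mod_cast h2) h1⟩
  · rintro ⟨e, he, h0⟩
    obtain ⟨u, hu, f, hf, rfl⟩ := exists_of_bestEdge he
    refine ⟨u, hu, (canReach_iff_table hQ).2 ⟨f, hf, ?_⟩⟩
    have : (0 : ℝ) ≤ Q * G.w (v, u) - P + f := by exact_mod_cast h0
    nlinarith

/-! ### Plans from tables -/

/-- The choices `σ` attain the maxima in `bestEdge`. -/
def IsGreedy (G : WeightedGraph (Fin n)) (Q P : ℤ) (X : Fin n → WithBot ℤ) (σ : Fin n → Fin n) :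
    Prop :=
  ∀ v, bestEdge G Q P X v ≠ ⊥ → bestEdge G Q P X v = scaledWeight G Q P v (σ v) + X (σ v)

/-- The greedy choices for the table of credits lead to a plan that never needs more than the
initial credit. -/
theorem IsGreedy.isPlan {S : Finset (Fin n)} {z v : Fin n} {Q P : ℤ} (hQ : 0 < Q)
    (hS : ∀ x ∈ insert z S, Returns G ((P : ℝ) / Q) (insert z S) x) {σ : Fin n → Fin n}
    (hσ : IsGreedy G Q P (table G true S z Q P n) σ) {e : ℤ}
    (he : bestEdge G Q P (table G true S z Q P n) v = (e : WithBot ℤ)) :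
    IsPlan G (stationary σ v) ∧
      ∀ t : ℕ, e ≤ Q * pathWeight G (stationary σ v) (t + 1) - P * (t + 1 : ℕ) := by
  set X := table G true S z Q P n with hX
  have hQ' : (0 : ℝ) < Q := by exact_mod_cast hQ
  have hmul : (Q : ℝ) * (P / Q) = P := by field_simp
  -- an entry of the table is at most the value of the greedy choice
  have hle : ∀ x f, X x = ((f : ℤ) : WithBot ℤ) →
      f ≤ 0 ∧ ∃ e : ℤ, bestEdge G Q P X x = (e : WithBot ℤ) ∧ f ≤ e := by
    intro x f hf
    have hc : CanReach G ((P : ℝ) / Q) (insert z S) n x (-(f : ℝ) / Q) :=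
      (canReach_iff_table hQ).2 ⟨f, hf, by rw [mul_div_cancel₀ _ hQ'.ne']⟩
    have hf0 : f ≤ 0 := by
      have := (le_div_iff₀ hQ').1 hc.nonneg
      have h2 : (f : ℝ) ≤ 0 := by linarith
      exact_mod_cast h2
    refine ⟨hf0, ?_⟩
    by_cases hx : x ∈ insert z S
    · obtain ⟨e, he, h0⟩ := (returns_iff_bestEdge hQ).1 (hS x hx)
      exact ⟨e, he, hf0.trans h0⟩
    · have h1 : CanReach G ((P : ℝ) / Q) (insert z S) (n + 1) x (-(f : ℝ) / Q) :=
        hc.mono le_rfl subset_rfl (by omega) le_rfl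
      obtain ⟨u, hu, h2⟩ := h1.2.resolve_left hx
      obtain ⟨g, hg, hgle⟩ := (canReach_iff_table hQ).1 h2
      have h3 := le_bestEdge (Q := Q) (P := P) hu hg
      cases hb : bestEdge G Q P X x with
      | bot => rw [hX] at hb; rw [hb] at h3; exact absurd h3 (by simp)
      | coe e =>
        rw [hX] at hb
        rw [hb, WithBot.coe_le_coe] at h3
        refine ⟨e, rfl, le_trans ?_ h3⟩
        have h4 : (f : ℝ) ≤ Q * G.w (x, u) - P + g := by
          have h5 : (Q : ℝ) * (-(f : ℝ) / Q) = -f := mul_div_cancel₀ _ hQ'.ne'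
          nlinarith
        exact_mod_cast h4
  have hstep : ∀ t x, stationary σ v t = x → ∀ e' : ℤ, bestEdge G Q P X x = (e' : WithBot ℤ) →
      (x, stationary σ v (t + 1)) ∈ G.E ∧ ∃ f : ℤ, X (stationary σ v (t + 1)) = (f : WithBot ℤ) ∧
        e' = Q * G.w (x, stationary σ v (t + 1)) - P + f := by
    rintro t x rfl e' he'
    have h1 := hσ _ (by rw [he']; simp)
    rw [he'] at h1
    have h2 : stationary σ v (t + 1) = σ (stationary σ v t) := Function.iterate_succ_apply' σ t v
    rw [h2]
    exact scaledWeight_add_eq_coe h1.symm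
  have main : ∀ t : ℕ, (stationary σ v t, stationary σ v (t + 1)) ∈ G.E ∧
      ∃ f : ℤ, X (stationary σ v (t + 1)) = (f : WithBot ℤ) ∧
        e ≤ Q * pathWeight G (stationary σ v) (t + 1) - P * (t + 1 : ℕ) + f := by
    intro t
    induction t with
    | zero =>
      obtain ⟨hE, f, hf, rfl⟩ := hstep 0 v rfl e he
      refine ⟨hE, f, hf, ?_⟩
      rw [pathWeight_succ, pathWeight_zero]
      change Q * G.w (v, _) - P + f ≤ Q * (0 + G.w (v, _)) - _ + f
      simp
    | succ t ih =>
      obtain ⟨-, f, hf, hle'⟩ := ih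
      obtain ⟨-, e', he', hfe⟩ := hle _ f hf
      obtain ⟨hE, g, hg, rfl⟩ := hstep (t + 1) _ rfl e' he'
      refine ⟨hE, g, hg, ?_⟩
      rw [pathWeight_succ]
      push_cast at hle' ⊢
      linarith
  refine ⟨fun t => (main t).1, fun t => ?_⟩
  obtain ⟨-, f, hf, h⟩ := main t
  linarith [(hle _ f hf).1]

/-- The greedy plan has at least the value that the table promises. -/
theorem IsGreedy.le_seqValue {S : Finset (Fin n)} {z v : Fin n} {Q P : ℤ} (hQ : 0 < Q)
    (hS : ∀ x ∈ insert z S, Returns G ((P : ℝ) / Q) (insert z S) x) {σ : Fin n → Fin n}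
    (hσ : IsGreedy G Q P (table G true S z Q P n) σ) {e : ℤ}
    (he : bestEdge G Q P (table G true S z Q P n) v = (e : WithBot ℤ)) (T : ℝ) :
    (((P * (T + 1) + e) / Q : ℝ) : EReal) ≤ seqValue (utility G (stationary σ v)) T := by
  have hQ' : (0 : ℝ) < Q := by exact_mod_cast hQ
  obtain ⟨hp, h⟩ := hσ.isPlan hQ hS he
  refine hp.le_seqValue (b := (P : ℝ) / Q) fun t => ?_
  have h1 : (e : ℝ) ≤ Q * pathWeight G (stationary σ v) (t + 1) - P * ((t + 1 : ℕ) : ℝ) := by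
    exact_mod_cast h t
  rw [utility_eq, div_le_iff₀ hQ']
  have h2 : (P : ℝ) / Q * Q = P := by field_simp
  push_cast at h1
  have h3 : (P : ℝ) / Q * (T - t) * Q = P * (T - t) := by rw [mul_right_comm, h2]
  nlinarith

/-- The table promises at least the value of every plan that reaches `insert z S` without violating
the constraints of a line whose slope is at most `P / Q`. -/
theorem le_bestEdge_of_plan {S : Finset (Fin n)} {z : Fin n} {Q P : ℤ} (hQ : 0 < Q)
    (hC : CyclesLE G S ((P : ℝ) / Q)) {x : ℕ → Fin n} (hx : IsPlan G x) {b T ν : ℝ} {t₁ : ℕ}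
    (hb : b ≤ (P : ℝ) / Q) (ht₁ : (t₁ : ℝ) ≤ T)
    (h : ∀ j ≤ t₁, ν ≤ utility G x j + b * (T - j)) (hz : x (t₁ + 1) ∈ insert z S) :
    ∃ e : ℤ, bestEdge G Q P (table G true S z Q P n) (x 0) = (e : WithBot ℤ) ∧
      ν ≤ (P * (T + 1) + e) / Q := by
  have hQ' : (0 : ℝ) < Q := by exact_mod_cast hQ
  set a := (P : ℝ) / Q with ha
  have hmul : (Q : ℝ) * a = P := by rw [ha]; field_simp
  set c := G.w (x 0, x 1) - a - (ν - a * (T + 1)) with hc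
  have key : ∀ i ≤ t₁, 0 ≤ c + (pathWeight G (fun s => x (s + 1)) i - a * i) := by
    intro i hi
    have h1 := h i hi
    have h2 : (i : ℝ) ≤ T := le_trans (by exact_mod_cast hi) ht₁
    rw [utility_eq, pathWeight_succ'] at h1
    push_cast at h1
    have h3 := mul_le_mul_of_nonneg_right hb (sub_nonneg.2 h2)
    rw [hc]
    linarith
  have hcan : CanReach G a (insert z S) n (x 1) c :=
    (CanReach.of_path (x := fun s => x (s + 1)) (k := 0) (m := t₁) (fun i _ => hx (i + 1))
      (fun i hi => key i hi.le) (.of_mem hz (key t₁ le_rfl))).le_card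
      (hC.mono (Finset.subset_insert z S))
  obtain ⟨f, hf, hle⟩ := (canReach_iff_table hQ).1 hcan
  have h1 := le_bestEdge (Q := Q) (P := P) (hx 0) hf
  cases hb : bestEdge G Q P (table G true S z Q P n) (x 0) with
  | bot => rw [hb] at h1; exact absurd h1 (by simp)
  | coe e =>
    refine ⟨e, rfl, ?_⟩
    rw [hb, WithBot.coe_le_coe] at h1
    have h2 : ((Q : ℝ) * G.w (x 0, x 1) - P + f) ≤ e := by
      have : (((Q * G.w (x 0, x (0 + 1)) - P + f : ℤ)) : ℝ) ≤ e := by exact_mod_cast h1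
      push_cast at this
      simpa using this
    rw [le_div_iff₀ hQ']
    rw [hc] at hle
    nlinarith

end
/-! ### The program for one table

Memory layout of the loop programs. The registers `0` to `3` keep the input and `4` to `8` and `25`
are loop counters, with the vertices `z` in `5`, `v` in `7` and `u` in `8`. The registers `9`, `10`
and `11` are the result of `bestCmd`, `12` and `13` are the scale `Q` and the shift `P` of the
weights, and `26` is the mode of the table. The registers `14` to `16` hold the current slope, `17`
to `19` the largest mean weight and `20` to `23` the best value with its initial vertex; the first
register of each group is a flag. The arrays `0` and `1` are the adjacency and the weight matrix,
`2` is the set `S`, the pair `3`, `4` is the current table, the pair `5`, `6` the next one, and `7`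
holds the choices of the best plan. -/

/-- The test `a = b`. -/
def Expr.eq (a b : Expr) : Expr := .sub (.lit 1) (.mul (.sub a b) (.sub a b))

theorem Expr.eval_eq_pos {s : State} {a b : Expr} :
    0 < (Expr.eq a b).eval s ↔ a.eval s = b.eval s := by
  simp only [Expr.eq, Expr.eval]
  constructor
  · intro h
    by_contra hne
    have : 0 < (a.eval s - b.eval s) * (a.eval s - b.eval s) :=
      mul_self_pos.2 (sub_ne_zero.2 hne)
    omega
  · intro h
    simp [h]

/-- The test that the flag `f` is `0` or `x` is positive. -/
def Expr.unlessFlag (f x : Expr) : Expr := .add (.mul f x) (.sub (.lit 1) f)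

theorem Expr.eval_unlessFlag_pos {s : State} {f x : Expr} (hf : f.eval s = 0 ∨ f.eval s = 1) :
    0 < (Expr.unlessFlag f x).eval s ↔ f.eval s = 0 ∨ 0 < x.eval s := by
  rcases hf with h | h <;> simp [Expr.unlessFlag, h]

/-- The registers `9`, `10` and `11` receive the flag, the value and the argument of the maximum
over all edges from the vertex in the register `7` of the scaled weight of the edge plus the entry
of its end in the table. -/
def bestCmd : Cmd :=
  .seq (.set 9 (.lit 0)) <| .seq (.set 10 (.lit 0)) <| .seq (.set 11 (.lit 0)) <|
  .loop 8 <|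
    .ite (.mul (.arr 0 (.add (.mul (.reg 7) (.reg 0)) (.reg 8))) (.arr 3 (.reg 8)))
      (.seq (.set 24 (.add (.sub (.mul (.reg 12)
          (.arr 1 (.add (.mul (.reg 7) (.reg 0)) (.reg 8)))) (.reg 13)) (.arr 4 (.reg 8)))) <|
        .ite (.unlessFlag (.reg 9) (.sub (.reg 24) (.reg 10)))
          (.seq (.set 9 (.lit 1)) <| .seq (.set 10 (.reg 24)) (.set 11 (.reg 8)))
          .skip)
      .skip

/-- One round of the dynamic program for the entry of the vertex in the register `7`, after the
maximum has been computed. The register `26` holds the mode. -/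
def adjustCmd : Cmd :=
  .ite (.arr 2 (.reg 7)) (.seq (.set 9 (.reg 26)) (.set 10 (.lit 0))) <|
  .ite (.reg 26)
    (.ite (.eq (.reg 7) (.reg 5)) (.seq (.set 9 (.lit 1)) (.set 10 (.lit 0))) <|
      .ite (.reg 10) (.set 10 (.lit 0)) .skip)
    .skip

/-- Computes the next table in the arrays `5` and `6`. -/
def fillCmd : Cmd :=
  .loop 7 <| .seq bestCmd <| .seq adjustCmd <|
    .seq (.store 5 (.reg 7) (.reg 9)) (.store 6 (.reg 7) (.reg 10))

/-- Makes the arrays `5` and `6` the current table. -/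
def copyCmd : Cmd :=
  .loop 7 <| .seq (.store 3 (.reg 7) (.arr 5 (.reg 7))) (.store 4 (.reg 7) (.arr 6 (.reg 7)))

/-- One round of the dynamic program. -/
def roundCmd : Cmd := .seq fillCmd copyCmd

/-- The initial table. -/
def initCmd : Cmd :=
  .loop 7 <| .seq
    (.ite (.arr 2 (.reg 7)) (.store 3 (.reg 7) (.lit 1)) <|
      .ite (.eq (.reg 7) (.reg 5)) (.store 3 (.reg 7) (.lit 1)) (.store 3 (.reg 7) (.lit 0)))
    (.store 4 (.reg 7) (.lit 0))

/-! ### What the arrays represent -/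

section
variable {n : ℕ} {G : WeightedGraph (Fin n)}

/-- A flag `f` and a value `v` encode an element of `WithBot ℤ`; the flag of `⊥` is `0`. -/
def Enc (f v : ℤ) (x : WithBot ℤ) : Prop := f = (if x = ⊥ then 0 else 1) ∧ v = x.unbotD 0

theorem enc_bot {f v : ℤ} : Enc f v ⊥ ↔ f = 0 ∧ v = 0 := by simp [Enc]

theorem enc_coe {f v a : ℤ} : Enc f v (a : WithBot ℤ) ↔ f = 1 ∧ v = a := by simp [Enc]

theorem enc_zero {f v : ℤ} : Enc f v 0 ↔ f = 1 ∧ v = 0 := enc_coe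

theorem Enc.flag {f v : ℤ} {x : WithBot ℤ} (h : Enc f v x) : f = 0 ∨ f = 1 := by
  cases x with
  | bot => exact .inl (enc_bot.1 h).1
  | coe a => exact .inr (enc_coe.1 h).1

theorem Enc.eq_coe {f v : ℤ} {x : WithBot ℤ} (h : Enc f v x) (hf : 0 < f) : x = (v : WithBot ℤ) := by
  cases x with
  | bot => have := (enc_bot.1 h).1; omega
  | coe a => rw [(enc_coe.1 h).2]

theorem Enc.eq_bot {f v : ℤ} {x : WithBot ℤ} (h : Enc f v x) (hf : f ≤ 0) : x = ⊥ := by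
  cases x with
  | bot => rfl
  | coe a => have := (enc_coe.1 h).1; omega

theorem Enc.abs_le {f v M : ℤ} {x : WithBot ℤ} (h : Enc f v x) (hM : 1 ≤ M)
    (hx : ∀ a : ℤ, x = a → |a| ≤ M) : |f| ≤ M ∧ |v| ≤ M := by
  cases x with
  | bot => rw [(enc_bot.1 h).1, (enc_bot.1 h).2, abs_zero]; omega
  | coe a => rw [(enc_coe.1 h).1, (enc_coe.1 h).2, abs_one]; exact ⟨hM, hx a rfl⟩

/-- The register `0` and the arrays `0` and `1` hold the graph. -/
structure HoldsGraph (G : WeightedGraph (Fin n)) (s : State) : Prop where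
  card : s.reg 0 = n
  edge : ∀ v u : Fin n, s.arr 0 ((v : ℕ) * n + (u : ℕ)) = if (v, u) ∈ G.E then 1 else 0
  weight : ∀ v u : Fin n, (v, u) ∈ G.E → s.arr 1 ((v : ℕ) * n + (u : ℕ)) = G.w (v, u)

/-- The arrays `k` and `l` hold the table `X`. -/
def HoldsTable (k l : Fin 8) (X : Fin n → WithBot ℤ) (s : State) : Prop :=
  ∀ u : Fin n, Enc (s.arr k (u : ℕ)) (s.arr l (u : ℕ)) (X u)

/-- The array `2` holds the set `S`. -/
def HoldsSet (S : Finset (Fin n)) (s : State) : Prop :=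
  ∀ u : Fin n, s.arr 2 (u : ℕ) = if u ∈ S then 1 else 0

theorem HoldsGraph.of_same {c : Cmd} {s s' : State} (h : HoldsGraph G s) (hs : Same c s s')
    (h0 : c.keepsReg 0 = true) (h1 : c.keepsArr 0 = true) (h2 : c.keepsArr 1 = true) :
    HoldsGraph G s' :=
  ⟨(hs.1 0 h0).trans h.card, fun v u => (hs.2 0 h1 _).trans (h.edge v u),
    fun v u hE => (hs.2 1 h2 _).trans (h.weight v u hE)⟩

theorem HoldsTable.of_same {k l : Fin 8} {X : Fin n → WithBot ℤ} {c : Cmd} {s s' : State}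
    (h : HoldsTable k l X s) (hs : Same c s s') (h1 : c.keepsArr k = true)
    (h2 : c.keepsArr l = true) : HoldsTable k l X s' := fun u => by
  rw [hs.2 k h1, hs.2 l h2]
  exact h u

theorem HoldsSet.of_same {S : Finset (Fin n)} {c : Cmd} {s s' : State}
    (h : HoldsSet S s) (hs : Same c s s') (h1 : c.keepsArr 2 = true) : HoldsSet S s' := fun u => by
  rw [hs.2 2 h1]
  exact h u

/-- The sums that occur in the computation of `bestEdge` are at most `M`. -/
def SumsLE (G : WeightedGraph (Fin n)) (Q P : ℤ) (X : Fin n → WithBot ℤ) (M : ℕ) : Prop :=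
  ∀ (v u : Fin n) (f : ℤ), (v, u) ∈ G.E → X u = (f : WithBot ℤ) → |Q * G.w (v, u) - P + f| ≤ M

theorem bestCmd_sat {M : ℕ} {s : State} {v : Fin n} {Q P : ℤ} {X : Fin n → WithBot ℤ}
    (hM : n ≤ M) (hG : HoldsGraph G s) (hX : HoldsTable 3 4 X s) (hv : s.reg 7 = (v : ℕ))
    (hQ : s.reg 12 = Q) (hP : s.reg 13 = P) (hb : SumsLE G Q P X M) :
    Sat M bestCmd s fun s' => Enc (s'.reg 9) (s'.reg 10) (bestEdge G Q P X v) ∧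
      ∃ u : Fin n, s'.reg 11 = (u : ℕ) ∧ (bestEdge G Q P X v ≠ ⊥ →
        bestEdge G Q P X v = scaledWeight G Q P v u + X u) := by
  have hn : 0 < n := v.pos
  have hM1 : (1 : ℤ) ≤ M := by omega
  unfold bestCmd
  refine .seq <| .set (by simp) <| .seq <| .set (by simp) <| .seq <| .set (by simp) ?_
  refine Sat.loop (n := n) (fun j s' => ∃ Y : WithBot ℤ, Enc (s'.reg 9) (s'.reg 10) Y ∧
    (∀ u : Fin n, (u : ℕ) < j → scaledWeight G Q P v u + X u ≤ Y) ∧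
    ∃ u : Fin n, s'.reg 11 = (u : ℕ) ∧ (Y ≠ ⊥ → Y = scaledWeight G Q P v u + X u))
    (by simp [hG.card]) rfl ?_ ?_ ?_
  · exact ⟨⊥, by simp [Enc], by simp, ⟨0, hn⟩, by simp, by simp⟩
  · rintro j hj s' hs hsj ⟨Y, hY, hle, u, hu, hYu⟩
    have r0 : s'.reg 0 = n := by simpa [hG.card] using hs.1 0 rfl
    have r7 : s'.reg 7 = (v : ℕ) := by simpa [hv] using hs.1 7 rfl
    have r12 : s'.reg 12 = Q := by simpa [hQ] using hs.1 12 rfl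
    have r13 : s'.reg 13 = P := by simpa [hP] using hs.1 13 rfl
    have a0 := (hs.2 0 rfl ((v : ℕ) * n + j)).trans (hG.edge v ⟨j, hj⟩)
    have a1 := fun hE => (hs.2 1 rfl ((v : ℕ) * n + j)).trans (hG.weight v ⟨j, hj⟩ hE)
    have hXj : Enc (s'.arr 3 j) (s'.arr 4 j) (X ⟨j, hj⟩) := by
      rw [hs.2 3 rfl, hs.2 4 rfl]
      exact hX ⟨j, hj⟩
    have hlt : ∀ (Z : WithBot ℤ), Y ≤ Z → scaledWeight G Q P v ⟨j, hj⟩ + X ⟨j, hj⟩ ≤ Z →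
        ∀ u : Fin n, (u : ℕ) < j + 1 → scaledWeight G Q P v u + X u ≤ Z := by
      intro Z hZ hj' u hu
      rcases Nat.lt_succ_iff_lt_or_eq.1 hu with h | h
      · exact (hle u h).trans hZ
      · obtain rfl : u = ⟨j, hj⟩ := Fin.ext h
        exact hj'
    have keep : scaledWeight G Q P v ⟨j, hj⟩ + X ⟨j, hj⟩ ≤ Y → ∃ Y : WithBot ℤ,
        Enc (s'.reg 9) (s'.reg 10) Y ∧
        (∀ u : Fin n, (u : ℕ) < j + 1 → scaledWeight G Q P v u + X u ≤ Y) ∧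
        ∃ u : Fin n, s'.reg 11 = (u : ℕ) ∧ (Y ≠ ⊥ → Y = scaledWeight G Q P v u + X u) :=
      fun h => ⟨Y, hY, hlt Y le_rfl h, u, hu, hYu⟩
    refine .ite (fun hpos => ?_) fun hneg => .skip ?_
    · simp only [Expr.eval, Expr.eval_arr, r0, r7, hsj, a0] at hpos
      have hE : (v, (⟨j, hj⟩ : Fin n)) ∈ G.E := by
        by_contra h
        simp [h] at hpos
      simp only [hE, if_true, one_mul] at hpos
      have hf := hXj.eq_coe hpos
      have hc := hb v _ _ hE hf
      have hsum : scaledWeight G Q P v ⟨j, hj⟩ + X ⟨j, hj⟩ =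
          ((Q * G.w (v, ⟨j, hj⟩) - P + s'.arr 4 j : ℤ) : WithBot ℤ) := by
        rw [hf, scaledWeight, if_pos hE, ← WithBot.coe_add]
      have a1' := a1 hE
      set c := Q * G.w (v, ⟨j, hj⟩) - P + s'.arr 4 j with hcd
      have hev : ∀ e1 : Expr, e1 = (.add (.sub (.mul (.reg 12)
          (.arr 1 (.add (.mul (.reg 7) (.reg 0)) (.reg 8)))) (.reg 13)) (.arr 4 (.reg 8))) →
          e1.eval s' = c := by
        rintro e1 rfl
        simp only [Expr.eval, Expr.eval_arr, r0, r7, hsj, a1', r12, r13, hcd]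
      have hev := hev _ rfl
      refine .seq <| .set (by rw [hev]; exact hc) ?_
      rw [hev]
      refine .ite (fun ht => ?_) fun ht => .skip ?_
      · rw [Expr.eval_unlessFlag_pos (by simpa using hY.flag)] at ht
        simp only [Expr.eval, State.setReg_reg] at ht
        norm_num at ht
        refine .seq <| .set (by simpa using hM1) <| .seq <| .set (by simpa using hc) <| .set ?_ ?_
        · simp [hsj]; omega
        · refine ⟨(c : WithBot ℤ), by simp [enc_coe], hlt _ ?_ hsum.le, ⟨j, hj⟩, by simp [hsj],
            fun _ => hsum.symm⟩
          rcases ht with h0 | h0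
          · rw [hY.eq_bot h0.le]; exact bot_le
          · rcases hY.flag with h1 | h1
            · rw [hY.eq_bot h1.le]; exact bot_le
            · rw [hY.eq_coe (by omega), WithBot.coe_le_coe]; omega
      · rw [← not_lt, Expr.eval_unlessFlag_pos (by simpa using hY.flag)] at ht
        simp only [Expr.eval, State.setReg_reg] at ht
        norm_num at ht
        suffices hle' : scaledWeight G Q P v ⟨j, hj⟩ + X ⟨j, hj⟩ ≤ Y by simpa using keep hle'
        have h1 := hY.flag.resolve_left ht.1
        rw [hsum, hY.eq_coe (by omega), WithBot.coe_le_coe]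
        exact ht.2
    · simp only [Expr.eval, Expr.eval_arr, r0, r7, hsj, a0] at hneg
      suffices hle' : scaledWeight G Q P v ⟨j, hj⟩ + X ⟨j, hj⟩ ≤ Y by simpa using keep hle'
      by_cases hE : (v, (⟨j, hj⟩ : Fin n)) ∈ G.E
      · simp only [hE, if_true, one_mul] at hneg
        rw [hXj.eq_bot hneg]
        simp
      · simp [scaledWeight, hE]
  · rintro s' hs ⟨Y, hY, hle, u, hu, hYu⟩
    have hYb : bestEdge G Q P X v = Y := by
      refine le_antisymm (Finset.sup_le fun u _ => hle u u.2) ?_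
      by_cases h : Y = ⊥
      · rw [h]; exact bot_le
      · rw [hYu h]
        exact Finset.le_sup (f := fun u => scaledWeight G Q P v u + X u) (Finset.mem_univ u)
    rw [hYb]
    exact ⟨hY, u, hu, hYu⟩

end
/-! ### Correctness of the program for one table -/

section
variable {n : ℕ} {G : WeightedGraph (Fin n)}

/-- The input of the program for one table: the graph, the set `S`, the vertex `z`, the scaling of
the weights and the mode. -/
structure Setup (G : WeightedGraph (Fin n)) (mode : Bool) (S : Finset (Fin n)) (z : Fin n)
    (Q P : ℤ) (s : State) : Prop where
  graph : HoldsGraph G s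
  set : HoldsSet S s
  vertex : s.reg 5 = (z : ℕ)
  scale : s.reg 12 = Q
  shift : s.reg 13 = P
  mode : s.reg 26 = if mode then 1 else 0

/-- The loop program does not overwrite the input of the program for one table. -/
def Cmd.keepsSetup (c : Cmd) : Bool :=
  c.keepsReg 0 && c.keepsReg 5 && c.keepsReg 12 && c.keepsReg 13 && c.keepsReg 26 &&
    c.keepsArr 0 && c.keepsArr 1 && c.keepsArr 2

theorem Setup.of_same {mode : Bool} {S : Finset (Fin n)} {z : Fin n} {Q P : ℤ} {c : Cmd}
    {s s' : State} (h : Setup G mode S z Q P s) (hs : Same c s s') (hc : c.keepsSetup = true) :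
    Setup G mode S z Q P s' := by
  simp only [Cmd.keepsSetup, Bool.and_eq_true] at hc
  obtain ⟨⟨⟨⟨⟨⟨⟨h0, h5⟩, h12⟩, h13⟩, h26⟩, a0⟩, a1⟩, a2⟩ := hc
  exact ⟨h.graph.of_same hs h0 a0 a1, h.set.of_same hs a2, (hs.1 5 h5).trans h.vertex,
    (hs.1 12 h12).trans h.scale, (hs.1 13 h13).trans h.shift, (hs.1 26 h26).trans h.mode⟩

theorem Setup.setReg {mode : Bool} {S : Finset (Fin n)} {z : Fin n} {Q P : ℤ} {s : State}
    (h : Setup G mode S z Q P s) {i : ℕ} {x : ℤ} (hi : i ∉ [0, 5, 12, 13, 26]) :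
    Setup G mode S z Q P (s.setReg i x) := by
  simp only [List.mem_cons, List.not_mem_nil, or_false, not_or] at hi
  obtain ⟨h0, h5, h12, h13, h26⟩ := hi
  have hr : ∀ j, j ≠ i → (s.setReg i x).reg j = s.reg j := fun j hj => by simp [hj]
  exact ⟨⟨(hr 0 (Ne.symm h0)).trans h.graph.card, h.graph.edge, h.graph.weight⟩, h.set,
    (hr 5 (Ne.symm h5)).trans h.vertex, (hr 12 (Ne.symm h12)).trans h.scale,
    (hr 13 (Ne.symm h13)).trans h.shift, (hr 26 (Ne.symm h26)).trans h.mode⟩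

theorem adjustCmd_sat {M : ℕ} {mode : Bool} {S : Finset (Fin n)} {z v : Fin n} {Q P : ℤ}
    {s : State} (h : Setup G mode S z Q P s) (hM : 1 ≤ M) (hv : s.reg 7 = (v : ℕ))
    {Y : WithBot ℤ} (hY : Enc (s.reg 9) (s.reg 10) Y) :
    Sat M adjustCmd s fun s' => Enc (s'.reg 9) (s'.reg 10)
      (if mode then (if v ∈ insert z S then 0 else min 0 Y) else (if v ∈ S then ⊥ else Y)) := by
  have hS := h.set v
  have hM' : (1 : ℤ) ≤ M := by omega
  unfold adjustCmd
  refine .ite (fun h1 => ?_) fun h1 => .ite (fun h2 => ?_) fun h2 => ?_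
  · simp only [Expr.eval, Expr.eval_arr, hv, hS] at h1
    have hvS : v ∈ S := by by_contra hvS; simp [hvS] at h1
    refine .seq <| .set ?_ <| .set (by simp) ?_
    · simp only [Expr.eval, h.mode]; split_ifs <;> simp; omega
    · cases mode <;> simp [h.mode, hvS, enc_bot, enc_zero]
  · simp only [Expr.eval, Expr.eval_arr, hv, hS] at h1
    have hvS : v ∉ S := by intro hvS; simp [hvS] at h1
    simp only [Expr.eval, h.mode] at h2
    have hm : mode = true := by by_contra hm; simp [hm] at h2
    subst hm
    refine .ite (fun h3 => ?_) fun h3 => ?_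
    · rw [Expr.eval_eq_pos] at h3
      simp only [Expr.eval, hv, h.vertex] at h3
      obtain rfl : v = z := Fin.ext (by exact_mod_cast h3)
      refine .seq <| .set (by simpa using hM') <| .set (by simp) ?_
      simp [enc_zero]
    · rw [← not_lt, Expr.eval_eq_pos] at h3
      simp only [Expr.eval, hv, h.vertex] at h3
      have hvz : v ≠ z := by rintro rfl; exact h3 rfl
      simp only [if_true, Finset.mem_insert, hvz, hvS, or_self, if_false]
      refine .ite (fun h4 => .set (by simp) ?_) fun h4 => .skip ?_
      · simp only [Expr.eval] at h4
        cases Y with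
        | bot => have := (enc_bot.1 hY).2; omega
        | coe a =>
          obtain ⟨h5, h6⟩ := enc_coe.1 hY
          rw [min_eq_left (by exact_mod_cast (h6 ▸ h4).le)]
          simp [enc_zero, h5]
      · simp only [Expr.eval] at h4
        rw [min_eq_right]
        · exact hY
        · cases Y with
          | bot => exact bot_le
          | coe a =>
            rw [(enc_coe.1 hY).2] at h4
            exact_mod_cast h4
  · simp only [Expr.eval, Expr.eval_arr, hv, hS] at h1
    have hvS : v ∉ S := by intro hvS; simp [hvS] at h1
    simp only [Expr.eval, h.mode] at h2
    have hm : mode = false := by cases mode <;> simp_all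
    subst hm
    refine .skip ?_
    simpa [hvS] using hY

/-- The entries of the table are at most `M`. -/
def TableLE (X : Fin n → WithBot ℤ) (M : ℕ) : Prop := ∀ u (f : ℤ), X u = (f : WithBot ℤ) → |f| ≤ M

theorem fillCmd_sat {M : ℕ} {mode : Bool} {S : Finset (Fin n)} {z : Fin n} {Q P : ℤ}
    {s : State} {X : Fin n → WithBot ℤ} (h : Setup G mode S z Q P s) (hM : n ≤ M) (hM1 : 1 ≤ M)
    (hX : HoldsTable 3 4 X s) (hb : SumsLE G Q P X M)
    (hX' : TableLE (tableStep G mode S z Q P X) M) :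
    Sat M fillCmd s (HoldsTable 5 6 (tableStep G mode S z Q P X)) := by
  unfold fillCmd
  refine Sat.loop (n := n) (fun j s' => ∀ u : Fin n, (u : ℕ) < j →
    Enc (s'.arr 5 (u : ℕ)) (s'.arr 6 (u : ℕ)) (tableStep G mode S z Q P X u))
    h.graph.card rfl (by simp) ?_ fun s' _ hs u => hs u u.2
  intro j hj s1 hs1 hj1 hinv
  have k1 := h.of_same hs1 rfl
  refine .seq <| (bestCmd_sat hM k1.graph (hX.of_same hs1 rfl rfl) (v := ⟨j, hj⟩) hj1 k1.scale
    k1.shift hb).mono fun s2 hs2 ⟨hY, _⟩ => ?_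
  have k2 := k1.of_same hs2 rfl
  have hj2 : s2.reg 7 = j := (hs2.1 7 rfl).trans hj1
  refine .seq <| (adjustCmd_sat k2 hM1 (v := ⟨j, hj⟩) hj2 hY).mono fun s3 hs3 hY3 => ?_
  have hj3 : s3.reg 7 = j := (hs3.1 7 rfl).trans hj2
  change Enc _ _ (tableStep G mode S z Q P X ⟨j, hj⟩) at hY3
  have hle := hY3.abs_le (by omega) (hX' ⟨j, hj⟩)
  refine .seq <| .store hle.1 <| .store (by simpa using hle.2) ?_
  intro u hu
  have h5 : ∀ i, s3.arr 5 i = s1.arr 5 i := fun i => (hs3.2 5 rfl i).trans (hs2.2 5 rfl i)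
  have h6 : ∀ i, s3.arr 6 i = s1.arr 6 i := fun i => (hs3.2 6 rfl i).trans (hs2.2 6 rfl i)
  by_cases huj : (u : ℕ) = j
  · obtain rfl : u = ⟨j, hj⟩ := Fin.ext huj
    simpa [hj3] using hY3
  · have := hinv u (by omega)
    simpa [hj3, huj, h5, h6] using this

theorem copyCmd_sat {M : ℕ} {s : State} {X : Fin n → WithBot ℤ} (hn : s.reg 0 = n) (hM1 : 1 ≤ M)
    (hX : HoldsTable 5 6 X s) (hX' : TableLE X M) : Sat M copyCmd s (HoldsTable 3 4 X) := by
  unfold copyCmd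
  refine Sat.loop (n := n) (fun j s' => ∀ u : Fin n, (u : ℕ) < j →
    Enc (s'.arr 3 (u : ℕ)) (s'.arr 4 (u : ℕ)) (X u))
    hn rfl (by simp) ?_ fun s' _ hs u => hs u u.2
  intro j hj s1 hs1 hj1 hinv
  have hY := (hX.of_same hs1 rfl rfl) ⟨j, hj⟩
  have hle := hY.abs_le (M := M) (by omega) (hX' ⟨j, hj⟩)
  refine .seq <| .store (by simpa [hj1] using hle.1) <| .store (by simpa [hj1] using hle.2) ?_
  intro u hu
  by_cases huj : (u : ℕ) = j
  · obtain rfl : u = ⟨j, hj⟩ := Fin.ext huj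
    simpa [hj1] using hY
  · have := hinv u (by omega)
    simpa [hj1, huj] using this

theorem roundCmd_sat {M : ℕ} {mode : Bool} {S : Finset (Fin n)} {z : Fin n} {Q P : ℤ}
    {s : State} {X : Fin n → WithBot ℤ} (h : Setup G mode S z Q P s) (hM : n ≤ M) (hM1 : 1 ≤ M)
    (hX : HoldsTable 3 4 X s) (hb : SumsLE G Q P X M)
    (hX' : TableLE (tableStep G mode S z Q P X) M) :
    Sat M roundCmd s (HoldsTable 3 4 (tableStep G mode S z Q P X)) :=
  .seq <| (fillCmd_sat h hM hM1 hX hb hX').mono fun _ hs hY =>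
    copyCmd_sat (h.of_same hs rfl).graph.card hM1 hY hX'

theorem initCmd_sat {M : ℕ} {mode : Bool} {S : Finset (Fin n)} {z : Fin n} {Q P : ℤ}
    {s : State} (h : Setup G mode S z Q P s) (hM1 : 1 ≤ M) :
    Sat M initCmd s (HoldsTable 3 4 (table G mode S z Q P 0)) := by
  have hM' : (1 : ℤ) ≤ M := by omega
  unfold initCmd
  refine Sat.loop (n := n) (fun j s' => ∀ u : Fin n, (u : ℕ) < j →
    Enc (s'.arr 3 (u : ℕ)) (s'.arr 4 (u : ℕ)) (table G mode S z Q P 0 u))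
    h.graph.card rfl (by simp) ?_ fun s' _ hs u => hs u u.2
  intro j hj s1 hs1 hj1 hinv
  have k1 := h.of_same hs1 rfl
  have hS := k1.set ⟨j, hj⟩
  have hz := k1.vertex
  -- all three branches store the same flag
  have key : ∀ f : ℤ, f = (if (⟨j, hj⟩ : Fin n) ∈ insert z S then 1 else 0) →
      Sat M (.store 4 (.reg 7) (.lit 0)) (s1.setMem (cell 3 j) f) fun s'' => ∀ u : Fin n,
        (u : ℕ) < j + 1 → Enc ((s''.setReg 7 (j + 1)).arr 3 (u : ℕ))
          ((s''.setReg 7 (j + 1)).arr 4 (u : ℕ)) (table G mode S z Q P 0 u) := by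
    intro f hf
    refine .store (by simp) fun u hu => ?_
    by_cases huj : (u : ℕ) = j
    · obtain rfl : u = ⟨j, hj⟩ := Fin.ext huj
      by_cases hT : (⟨j, hj⟩ : Fin n) ∈ insert z S
      · rw [if_pos hT] at hf
        rw [table, if_pos hT, enc_zero]
        simp [hj1, hf]
      · rw [if_neg hT] at hf
        rw [table, if_neg hT, enc_bot]
        simp [hj1, hf]
    · have := hinv u (by omega)
      simpa [hj1, huj] using this
  refine .seq <| .ite (fun h1 => .store (by simpa using hM') ?_) fun h1 =>
    .ite (fun h2 => .store (by simpa using hM') ?_) fun h2 => .store (by simp) ?_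
  all_goals
    simp only [Expr.eval, hj1]
    refine key _ ?_
    simp only [Expr.eval, Expr.eval_arr, hj1] at h1
    change s1.arr 2 j = _ at hS
    rw [hS] at h1
  · have : (⟨j, hj⟩ : Fin n) ∈ S := by by_contra h; simp [h] at h1
    simp [this]
  · rw [Expr.eval_eq_pos] at h2
    simp only [Expr.eval, hj1, hz] at h2
    have : (⟨j, hj⟩ : Fin n) = z := Fin.ext (by exact_mod_cast h2)
    simp [this]
  · rw [← not_lt, Expr.eval_eq_pos] at h2
    simp only [Expr.eval, hj1, hz] at h2
    have h3 : (⟨j, hj⟩ : Fin n) ≠ z := by rintro rfl; exact h2 rfl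
    have h4 : (⟨j, hj⟩ : Fin n) ∉ S := by intro h; simp [h] at h1
    simp [h3, h4]

end
/-! ### Bounds on the numbers in the tables -/

section
variable {n N M : ℕ} {G : WeightedGraph (Fin n)}

/-- `N` bounds the size of the graph and the weights, and `M` is a power of `N` that bounds all
stored numbers. -/
structure SizeBound (G : WeightedGraph (Fin n)) (N M : ℕ) : Prop where
  two_le : 2 ≤ N
  card_le : n ≤ N
  weight_le : G.maxWeight ≤ N
  eq_pow : M = N ^ 10

theorem SizeBound.pow_le (h : SizeBound G N M) {j : ℕ} (hj : j ≤ 10) : (N : ℤ) ^ j ≤ M := by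
  rw [h.eq_pow]
  exact_mod_cast Nat.pow_le_pow_right (by have := h.two_le; omega) hj

theorem SizeBound.one_le (h : SizeBound G N M) : 1 ≤ M := by
  have := h.pow_le (j := 0) (by omega)
  rw [pow_zero] at this
  omega

theorem SizeBound.card_le' (h : SizeBound G N M) : n ≤ M := by
  have := h.pow_le (j := 1) (by omega)
  rw [pow_one] at this
  have := h.card_le
  omega

theorem SizeBound.mul_two_le (h : SizeBound G N M) {x : ℤ} (hx : 0 ≤ x) : x + x ≤ x * N := by
  have : (2 : ℤ) ≤ N := by exact_mod_cast h.two_le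
  nlinarith

/-- The numerator and the denominator of a slope have the size of those of the mean weight of a
short closed walk. -/
def ScaleLE (N : ℕ) (Q P : ℤ) : Prop := |Q| ≤ (N : ℤ) ∧ |P| ≤ (N : ℤ) ^ 2

theorem ScaleLE.edge (h : SizeBound G N M) {Q P : ℤ} (hs : ScaleLE N Q P) :
    ∀ e ∈ G.E, |Q * G.w e - P| ≤ (N : ℤ) ^ 3 := by
  intro e he
  have h1 : |G.w e| ≤ N := (abs_weight_le he).trans (by exact_mod_cast h.weight_le)
  calc |Q * G.w e - P| ≤ |Q * G.w e| + |P| := abs_sub _ _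
    _ ≤ (N : ℤ) * N + N ^ 2 := by
      rw [abs_mul]
      exact add_le_add (mul_le_mul hs.1 h1 (abs_nonneg _) (by positivity)) hs.2
    _ = (N : ℤ) ^ 2 + N ^ 2 := by ring
    _ ≤ (N : ℤ) ^ 2 * N := h.mul_two_le (by positivity)
    _ = _ := by ring

theorem ScaleLE.tableLE' (h : SizeBound G N M) {Q P : ℤ} (hs : ScaleLE N Q P) {mode : Bool}
    {S : Finset (Fin n)} {z v : Fin n} {k : ℕ} (hk : k ≤ n) {f : ℤ}
    (hf : table G mode S z Q P k v = (f : WithBot ℤ)) : |f| ≤ (N : ℤ) ^ 4 := by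
  have hk' : (k : ℤ) ≤ N := by exact_mod_cast hk.trans h.card_le
  calc |f| ≤ k * (N : ℤ) ^ 3 := abs_table_le (hs.edge h) (by positivity) hf
    _ ≤ N * (N : ℤ) ^ 3 := by gcongr
    _ = _ := by ring

theorem ScaleLE.tableLE (h : SizeBound G N M) {Q P : ℤ} (hs : ScaleLE N Q P) {mode : Bool}
    {S : Finset (Fin n)} {z : Fin n} {k : ℕ} (hk : k ≤ n) : TableLE (table G mode S z Q P k) M :=
  fun _ _ hf => (hs.tableLE' h hk hf).trans (h.pow_le (by omega))

theorem ScaleLE.sum_le (h : SizeBound G N M) {Q P : ℤ} (hs : ScaleLE N Q P) {mode : Bool}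
    {S : Finset (Fin n)} {z v u : Fin n} {k : ℕ} (hk : k ≤ n) {f : ℤ} (hE : (v, u) ∈ G.E)
    (hf : table G mode S z Q P k u = (f : WithBot ℤ)) :
    |Q * G.w (v, u) - P + f| ≤ (N : ℤ) ^ 5 := by
  have h1 : (N : ℤ) ^ 3 ≤ N ^ 4 := by
    have : (1 : ℤ) ≤ N := by exact_mod_cast (by have := h.two_le; omega : 1 ≤ N)
    exact pow_le_pow_right₀ this (by omega)
  calc _ ≤ |Q * G.w (v, u) - P| + |f| := abs_add_le _ _
    _ ≤ (N : ℤ) ^ 4 + N ^ 4 := add_le_add ((hs.edge h _ hE).trans h1) (hs.tableLE' h hk hf)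
    _ ≤ (N : ℤ) ^ 4 * N := h.mul_two_le (by positivity)
    _ = _ := by ring

theorem ScaleLE.sumsLE (h : SizeBound G N M) {Q P : ℤ} (hs : ScaleLE N Q P) {mode : Bool}
    {S : Finset (Fin n)} {z : Fin n} {k : ℕ} (hk : k ≤ n) :
    SumsLE G Q P (table G mode S z Q P k) M :=
  fun _ _ _ hE hf => (hs.sum_le h hk hE hf).trans (h.pow_le (by omega))

theorem ScaleLE.bestEdge_le (h : SizeBound G N M) {Q P : ℤ} (hs : ScaleLE N Q P) {mode : Bool}
    {S : Finset (Fin n)} {z v : Fin n} {k : ℕ} (hk : k ≤ n) {e : ℤ}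
    (he : bestEdge G Q P (table G mode S z Q P k) v = (e : WithBot ℤ)) : |e| ≤ (N : ℤ) ^ 5 := by
  obtain ⟨u, hu, f, hf, rfl⟩ := exists_of_bestEdge he
  exact hs.sum_le h hk hu hf

theorem scaleLE_one (h : SizeBound G N M) : ScaleLE N 1 0 := by
  have : (1 : ℤ) ≤ N := by exact_mod_cast (by have := h.two_le; omega : 1 ≤ N)
  exact ⟨by simpa using this, by simp⟩

/-! ### The program for the largest mean weight -/

/-- The table after `n` rounds. -/
def sweepCmd : Cmd := .seq initCmd (.loop 6 roundCmd)

/-- Compares the mean weight from the current table with the largest one found so far, which is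
kept, with a flag, as the fraction of the registers `18` and `19`. -/
def candidateCmd : Cmd :=
  .ite (.arr 3 (.reg 5))
    (.ite (.unlessFlag (.reg 17) (.sub (.mul (.arr 4 (.reg 5)) (.reg 19))
        (.mul (.reg 18) (.add (.reg 6) (.lit 1)))))
      (.seq (.set 17 (.lit 1)) <| .seq (.set 18 (.arr 4 (.reg 5)))
        (.set 19 (.add (.reg 6) (.lit 1))))
      .skip)
    .skip

/-- The largest mean weight of short walks outside `S` that close up or end in `S`. -/
def searchCmd : Cmd :=
  .seq (.set 17 (.lit 0)) <| .seq (.set 12 (.lit 1)) <| .seq (.set 13 (.lit 0)) <|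
  .seq (.set 26 (.lit 0)) <|
  .loop 5 <| .seq initCmd <| .loop 6 <| .seq roundCmd candidateCmd

theorem sweepCmd_sat (hN : SizeBound G N M) {mode : Bool} {S : Finset (Fin n)} {z : Fin n}
    {Q P : ℤ} {s : State} (h : Setup G mode S z Q P s) (hs : ScaleLE N Q P) :
    Sat M sweepCmd s (HoldsTable 3 4 (table G mode S z Q P n)) := by
  refine .seq <| (initCmd_sat h hN.one_le).mono fun s1 hs1 hX => ?_
  have h1 := h.of_same hs1 rfl
  exact Sat.loop (n := n) (fun j => HoldsTable 3 4 (table G mode S z Q P j)) h1.graph.card rfl hX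
    (fun j hj s' hs' _ hX' => roundCmd_sat (h1.of_same hs' rfl) hN.card_le' hN.one_le hX'
      (hs.sumsLE hN hj.le) (hs.tableLE hN (k := j + 1) hj)) fun _ _ h => h

/-- The largest mean weight found so far is attained. -/
def MeanSound (G : WeightedGraph (Fin n)) (S : Finset (Fin n)) (s : State) : Prop :=
  s.reg 17 = 0 ∨ s.reg 17 = 1 ∧ ∃ (z : Fin n) (k : ℕ), 1 ≤ k ∧ k ≤ n ∧
    table G false S z 1 0 k z = (s.reg 18 : WithBot ℤ) ∧ s.reg 19 = k

/-- The largest mean weight found so far is at least `a`. -/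
def MeanGE (s : State) (a : ℝ) : Prop := s.reg 17 = 1 ∧ a ≤ (s.reg 18 : ℝ) / s.reg 19

theorem candidateCmd_sat (hN : SizeBound G N M) {S : Finset (Fin n)} {z : Fin n} {s : State}
    {j : ℕ} (hj : j < n) (hz : s.reg 5 = (z : ℕ)) (hk : s.reg 6 = j)
    (hX : HoldsTable 3 4 (table G false S z 1 0 (j + 1)) s) (hm : MeanSound G S s) :
    Sat M candidateCmd s fun s' => MeanSound G S s' ∧ (∀ a, MeanGE s a → MeanGE s' a) ∧
      ∀ d : ℤ, table G false S z 1 0 (j + 1) z = (d : WithBot ℤ) →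
        MeanGE s' ((d : ℝ) / (j + 1 : ℕ)) := by
  have hXz := hX z
  have hj0 : (0 : ℝ) < (j + 1 : ℕ) := by positivity
  have hflag : s.reg 17 = 0 ∨ s.reg 17 = 1 := hm.imp_right And.left
  have hM := hN.one_le
  have hnM := hN.card_le'
  refine .ite (fun h1 => ?_) fun h1 => .skip ⟨hm, fun _ h => h, fun d hd => ?_⟩
  · simp only [Expr.eval, Expr.eval_arr, hz] at h1
    have hd := hXz.eq_coe h1
    refine .ite (fun h2 => ?_) fun h2 => .skip ⟨hm, fun _ h => h, fun d' hd' => ?_⟩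
    · rw [Expr.eval_unlessFlag_pos (by simpa using hflag)] at h2
      simp only [Expr.eval, Expr.eval_arr, hz, hk] at h2
      have hbd := (scaleLE_one hN).tableLE hN (k := j + 1) hj z _ hd
      refine .seq <| .set ?_ <| .seq <| .set ?_ <| .set ?_ ⟨.inr ?_, ?_, ?_⟩
      · simpa using by omega
      · simpa [hz] using hbd
      · simp [hk]; rw [abs_of_nonneg (by positivity)]; omega
      · refine ⟨by simp, z, j + 1, by omega, hj, ?_, ?_⟩
        · simpa [hz] using hd
        · simp [hk]
      · rintro a ⟨ha1, ha2⟩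
        refine ⟨by simp, ?_⟩
        rcases hm with hm | ⟨-, z', k', hk1, hkn, hd', hq⟩
        · omega
        have h3 := h2.resolve_left (by omega)
        have hk0 : (0 : ℝ) < k' := by positivity
        have h4 : (s.reg 18 : ℝ) / s.reg 19 ≤ (s.arr 4 (z : ℕ) : ℝ) / (j + 1 : ℕ) := by
          rw [hq] at h3 ⊢
          rw [Int.cast_natCast, div_le_div_iff₀ hk0 hj0]
          have h5 : s.reg 18 * (j + 1 : ℕ) ≤ s.arr 4 (z : ℕ) * k' := by push_cast; omega
          exact_mod_cast h5
        have h5 := ha2.trans h4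
        simpa [hz, hk] using h5
      · intro d' hd'
        rw [hd, WithBot.coe_inj] at hd'
        subst hd'
        exact ⟨by simp, by simp [hz, hk]⟩
    · rw [← not_lt, Expr.eval_unlessFlag_pos (by simpa using hflag)] at h2
      simp only [Expr.eval, Expr.eval_arr, hz, hk, not_or] at h2
      rw [hd, WithBot.coe_inj] at hd'
      subst hd'
      rcases hm with hm | ⟨hm, z', k', hk1, hkn, hd', hq⟩
      · exact absurd hm h2.1
      have hk0 : (0 : ℝ) < k' := by positivity
      refine ⟨hm, ?_⟩
      have h3 := h2.2
      rw [hq] at h3 ⊢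
      rw [Int.cast_natCast, div_le_div_iff₀ hj0 hk0]
      have h5 : s.arr 4 (z : ℕ) * k' ≤ s.reg 18 * (j + 1 : ℕ) := by push_cast; omega
      exact_mod_cast h5
  · simp only [Expr.eval, Expr.eval_arr, hz] at h1
    rw [hXz.eq_bot h1] at hd
    simp at hd

/-- All mean weights were considered. -/
def MeanComplete (G : WeightedGraph (Fin n)) (S : Finset (Fin n)) (s : State) : Prop :=
  ∀ (z : Fin n) (k : ℕ), 1 ≤ k → k ≤ n → ∀ d : ℤ,
    table G false S z 1 0 k z = (d : WithBot ℤ) → MeanGE s ((d : ℝ) / k)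

theorem searchCmd_sat (hN : SizeBound G N M) {S : Finset (Fin n)} {s : State}
    (hG : HoldsGraph G s) (hS : HoldsSet S s) :
    Sat M searchCmd s fun s' => MeanSound G S s' ∧ MeanComplete G S s' := by
  have hM : (1 : ℤ) ≤ M := by exact_mod_cast hN.one_le
  unfold searchCmd
  refine .seq <| .set (by simp) <| .seq <| .set (by simpa using hM) <| .seq <| .set (by simp) <|
    .seq <| .set (by simp) ?_
  refine Sat.loop (n := n) (fun i s' => MeanSound G S s' ∧ ∀ (z : Fin n), (z : ℕ) < i → ∀ k : ℕ,
    1 ≤ k → k ≤ n → ∀ d : ℤ, table G false S z 1 0 k z = (d : WithBot ℤ) → MeanGE s' ((d : ℝ) / k))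
    (by simp [hG.card]) rfl ⟨.inl (by simp), by simp⟩ ?_ fun s' _ h => ⟨h.1, fun z => h.2 z z.2⟩
  rintro i hi s1 hs1 hi1 ⟨hm, hc⟩
  have k1 : Setup G false S ⟨i, hi⟩ 1 0 s1 := by
    refine ⟨⟨?_, ?_, ?_⟩, ?_, hi1, ?_, ?_, ?_⟩
    · simpa [hG.card] using hs1.1 0 rfl
    · exact fun v u => (hs1.2 0 rfl _).trans (hG.edge v u)
    · exact fun v u hE => (hs1.2 1 rfl _).trans (hG.weight v u hE)
    · exact fun u => (hs1.2 2 rfl _).trans (hS u)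
    · simpa using hs1.1 12 rfl
    · simpa using hs1.1 13 rfl
    · simpa using hs1.1 26 rfl
  refine .seq <| (initCmd_sat k1 hN.one_le).mono fun s2 hs2 hX2 => ?_
  have k2 := k1.of_same hs2 rfl
  have sc := scaleLE_one hN
  have same17 : ∀ {c : Cmd} {s s' : State}, Same c s s' → c.keepsReg 17 = true →
      c.keepsReg 18 = true → c.keepsReg 19 = true →
      (MeanSound G S s → MeanSound G S s') ∧ ∀ a, MeanGE s a → MeanGE s' a := by
    intro c s s' h h17 h18 h19
    simp only [MeanSound, MeanGE, h.1 17 h17, h.1 18 h18, h.1 19 h19]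
    exact ⟨id, fun _ => id⟩
  refine Sat.loop (n := n) (fun j s' => HoldsTable 3 4 (table G false S ⟨i, hi⟩ 1 0 j) s' ∧
    MeanSound G S s' ∧ (∀ a, MeanGE s1 a → MeanGE s' a) ∧ ∀ k : ℕ, 1 ≤ k → k ≤ j → ∀ d : ℤ,
      table G false S ⟨i, hi⟩ 1 0 k ⟨i, hi⟩ = (d : WithBot ℤ) → MeanGE s' ((d : ℝ) / k))
    k2.graph.card rfl ⟨hX2, ?_, ?_, by omega⟩ ?_ ?_
  · simpa [MeanSound] using (same17 hs2 rfl rfl rfl).1 hm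
  · simpa [MeanGE] using (same17 hs2 rfl rfl rfl).2
  · rintro j hj s3 hs3 hj3 ⟨hX3, hm3, hc3, hk3⟩
    have k3 := k2.of_same hs3 rfl
    refine .seq <| (roundCmd_sat k3 hN.card_le' hN.one_le hX3
      (sc.sumsLE hN hj.le) (sc.tableLE hN (k := j + 1) hj)).mono fun s4 hs4 hX4 => ?_
    have k4 := k3.of_same hs4 rfl
    have m4 := same17 hs4 rfl rfl rfl
    refine (candidateCmd_sat hN hj k4.vertex ((hs4.1 6 rfl).trans hj3) hX4 (m4.1 hm3)).mono
      fun s5 hs5 ⟨hm5, hc5, hd5⟩ => ?_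
    have hX5 := hX4.of_same hs5 rfl rfl
    refine ⟨hX5, by simpa [MeanSound] using hm5, ?_, ?_⟩
    · intro a ha
      simpa [MeanGE] using hc5 a (m4.2 a (hc3 a ha))
    · intro k hk1 hk d hd
      rcases hk.lt_or_eq with hk | rfl
      · simpa [MeanGE] using hc5 _ (m4.2 _ (hk3 k hk1 (by omega) d hd))
      · simpa [MeanGE] using hd5 d hd
  · rintro s6 hs6 ⟨-, hm6, hc6, hk6⟩
    refine ⟨by simpa [MeanSound] using hm6, fun z hz k hk1 hkn d hd => ?_⟩
    rcases Nat.lt_succ_iff_lt_or_eq.1 hz with h | h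
    · simpa [MeanGE] using hc6 _ (hc z h k hk1 hkn d hd)
    · obtain rfl : z = ⟨i, hi⟩ := Fin.ext h
      simpa [MeanGE] using hk6 k hk1 hkn d hd

/-! ### The current slope -/

/-- The current slope, with a flag, is the fraction of the registers `15` and `16`; it is lowered
to the largest mean weight if that is smaller. -/
def slopeCmd : Cmd :=
  .ite (.reg 17)
    (.ite (.unlessFlag (.reg 14) (.sub (.mul (.reg 15) (.reg 19)) (.mul (.reg 18) (.reg 16))))
      (.seq (.set 14 (.lit 1)) <| .seq (.set 15 (.reg 18)) (.set 16 (.reg 19)))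
      .skip)
    .skip

/-- The current slope. -/
noncomputable def State.slope (s : State) : ℝ := (s.reg 15 : ℝ) / s.reg 16

/-- What holds for a slope `a` and a set `S` at all times: the vertices in `S` sustain `a`, and
all other vertices sustain at most `a`. -/
structure SlopeFor (G : WeightedGraph (Fin n)) (S : Finset (Fin n)) (a : ℝ) : Prop where
  cycles : CyclesLE G S a
  returns : ∀ x ∈ S, Returns G a S x
  sustains : ∀ y ∉ S, ∀ b, Sustains G y b → b ≤ a

/-- The registers `14`, `15` and `16` hold a slope for `S`, or none, if `S` is empty. -/
def HoldsSlope (G : WeightedGraph (Fin n)) (N : ℕ) (S : Finset (Fin n)) (s : State) : Prop :=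
  s.reg 14 = 0 ∧ S = ∅ ∨ s.reg 14 = 1 ∧ 0 < s.reg 16 ∧ ScaleLE N (s.reg 16) (s.reg 15) ∧
    SlopeFor G S s.slope

/-- If no mean weight was found, then no vertex outside `S` is on a plan. -/
theorem MeanComplete.not_sustains {S : Finset (Fin n)} {s : State} (hc : MeanComplete G S s)
    (h0 : s.reg 17 = 0) {y : Fin n} (hy : y ∉ S) {b : ℝ} (hb : Sustains G y b) : False := by
  have none : ∀ m x, 1 ≤ m → m ≤ n → IsWalk G S m x → x m ∉ insert (x 0) S := by
    intro m x h1 hm hx hT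
    obtain ⟨d, hd, -⟩ := le_table_of_walk hx hT
    have := (hc _ m h1 hm d hd).1
    omega
  have := hb.le_of_walks_le hy (a := b - 1)
    (fun m x h1 hm hx he => absurd (he ▸ Finset.mem_insert_self _ _) (none m x h1 hm hx))
    (fun m x h1 hm hx he => absurd (Finset.mem_insert_of_mem he) (none m x h1 hm hx))
  linarith

/-- The largest mean weight bounds the closed walks outside `S` and the slopes that are sustained
outside `S`, and it is attained. -/
theorem MeanComplete.spec {S : Finset (Fin n)} {s : State} (hc : MeanComplete G S s)
    (hm : MeanSound G S s) (h1 : s.reg 17 = 1) :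
    CyclesLE G S ((s.reg 18 : ℝ) / s.reg 19) ∧
      (∀ y ∉ S, ∀ b, Sustains G y b → b ≤ (s.reg 18 : ℝ) / s.reg 19) ∧
      ∃ (k : ℕ) (x : ℕ → Fin n), 1 ≤ k ∧ k ≤ n ∧ s.reg 19 = k ∧ IsWalk G S k x ∧
        (x k ∈ S ∨ x k = x 0) ∧ pathWeight G x k = s.reg 18 := by
  have walks : ∀ m x, 1 ≤ m → m ≤ n → IsWalk G S m x → x m ∈ insert (x 0) S →
      (pathWeight G x m : ℝ) ≤ (s.reg 18 : ℝ) / s.reg 19 * m := by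
    intro m x h1 hm hx hT
    obtain ⟨d, hd, hle⟩ := le_table_of_walk hx hT
    have hm0 : (0 : ℝ) < m := by positivity
    have h2 := (hc _ m h1 hm d hd).2
    rw [div_le_iff₀ hm0] at h2
    exact le_trans (by exact_mod_cast hle) h2
  have hC : CyclesLE G S ((s.reg 18 : ℝ) / s.reg 19) := fun m x h1 hm hx he =>
    walks m x h1 hm hx (he ▸ Finset.mem_insert_self _ _)
  refine ⟨hC, fun y hy b hb => hb.le_of_walks_le hy hC fun m x h1 hm hx he =>
    walks m x h1 hm hx (Finset.mem_insert_of_mem he), ?_⟩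
  obtain ⟨z, k, hk1, hkn, hz, hk⟩ := (hm.resolve_left (by omega)).2
  obtain ⟨x, hx, rfl, hT, hw⟩ := exists_walk_of_table hz
  exact ⟨k, x, hk1, hkn, hk, hx, (Finset.mem_insert.1 hT).symm, hw⟩

theorem slopeCmd_sat (hN : SizeBound G N M) {S : Finset (Fin n)} {s : State}
    (hs : HoldsSlope G N S s) (hm : MeanSound G S s) (hc : MeanComplete G S s) :
    Sat M slopeCmd s fun s' => HoldsSlope G N S s' ∧ ∀ y ∉ S, ∀ b, Sustains G y b →
      s'.reg 14 = 1 ∧ ∃ z ∉ S, Returns G s'.slope (insert z S) z := by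
  have hM : (1 : ℤ) ≤ M := by exact_mod_cast hN.one_le
  have hflag : s.reg 14 = 0 ∨ s.reg 14 = 1 := hs.imp And.left And.left
  refine .ite (fun h1 => ?_) fun h1 => .skip ⟨hs, fun y hy b hb => ?_⟩
  · simp only [Expr.eval] at h1
    have h1 : s.reg 17 = 1 := (hm.resolve_left (by omega)).1
    obtain ⟨hC, hb, k, x, hk1, hkn, hk, hx, hend, hw⟩ := hc.spec hm h1
    have hk0 : (0 : ℝ) < k := by positivity
    have hmul : (s.reg 18 : ℝ) / s.reg 19 * k = pathWeight G x k := by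
      rw [hk, hw, Int.cast_natCast, div_mul_cancel₀ _ hk0.ne']
    have hsc : ScaleLE N (s.reg 19) (s.reg 18) := by
      have hkN : (k : ℤ) ≤ N := by exact_mod_cast hkn.trans hN.card_le
      constructor
      · rw [hk, Nat.abs_cast]; exact hkN
      · rw [← hw]
        refine (abs_pathWeight_le fun i hi => (hx i hi).1).trans ?_
        have : (G.maxWeight : ℤ) ≤ N := by exact_mod_cast hN.weight_le
        rw [sq]
        gcongr
    refine .ite (fun h2 => ?_) fun h2 => .skip ?_
    · rw [Expr.eval_unlessFlag_pos (by simpa using hflag)] at h2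
      simp only [Expr.eval] at h2
      refine .seq <| .set (by simpa using hM) <| .seq <| .set ?_ <| .set ?_ ?_
      · simpa using hsc.2.trans (hN.pow_le (by omega))
      · simpa using hsc.1.trans (by simpa using hN.pow_le (j := 1) (by omega))
      have e : ∀ t : State, (((t.setReg 14 1).setReg 15 (s.reg 18)).setReg 16 (s.reg 19)).slope =
          (s.reg 18 : ℝ) / s.reg 19 := fun t => by simp [State.slope]
      simp only [Expr.eval, State.setReg_reg]
      norm_num
      simp only [e]
      refine ⟨.inr ⟨by simp, by simp; omega, by simpa using hsc, ?_⟩, fun _ _ _ _ => ?_⟩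
      · rw [e]
        refine ⟨hC, fun y hy => ?_, hb⟩
        rcases hs with ⟨-, rfl⟩ | ⟨h14, h16, -, hsl⟩
        · simp at hy
        · refine (hsl.returns y hy).mono ?_ subset_rfl
          have h3 := h2.resolve_left (by omega)
          have h16' : (0 : ℝ) < s.reg 16 := by exact_mod_cast h16
          rw [State.slope, hk, Int.cast_natCast, div_le_div_iff₀ hk0 h16']
          rw [hk] at h3
          have h4 : s.reg 18 * s.reg 16 ≤ s.reg 15 * k := by omega
          exact_mod_cast h4
      · exact exists_returns hk1 hkn hx hend hmul.le
    · rw [← not_lt, Expr.eval_unlessFlag_pos (by simpa using hflag)] at h2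
      simp only [Expr.eval, not_or] at h2
      refine ⟨hs, fun y hy b hb => ?_⟩
      rcases hs with ⟨h14, -⟩ | ⟨h14, h16, -, hsl⟩
      · exact absurd h14 h2.1
      refine ⟨h14, exists_returns hk1 hkn hx hend ?_⟩
      rw [← hmul]
      have h16' : (0 : ℝ) < s.reg 16 := by exact_mod_cast h16
      refine mul_le_mul_of_nonneg_right ?_ hk0.le
      rw [State.slope, hk, Int.cast_natCast, div_le_div_iff₀ h16' hk0]
      have h3 := h2.2
      rw [hk] at h3
      have h4 : s.reg 15 * k ≤ s.reg 18 * s.reg 16 := by omega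
      exact_mod_cast h4
  · simp only [Expr.eval] at h1
    have h0 : s.reg 17 = 0 := hm.elim id fun h => by omega
    exact (hc.not_sustains h0 hy hb).elim

end
/-! ### The program for the best value and plan -/

/-- Stores the greedy choices in the array `7`. -/
def policyCmd : Cmd := .loop 7 <| .seq bestCmd (.store 7 (.reg 7) (.reg 11))

/-- Compares the value for the initial vertex in the register `25` with the best value found so
far, which is kept, with a flag, as the fraction of the registers `21` and `22`, together with the
initial vertex in the register `23` and the choices in the array `7`. -/
def compareCmd : Cmd :=
  .seq (.set 27 (.add (.mul (.reg 13) (.add (.reg 1) (.reg 2))) (.mul (.reg 10) (.reg 2)))) <|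
  .seq (.set 28 (.mul (.reg 12) (.reg 2))) <|
  .ite (.unlessFlag (.reg 20) (.sub (.mul (.reg 27) (.reg 22)) (.mul (.reg 21) (.reg 28))))
    (.seq (.set 20 (.lit 1)) <| .seq (.set 21 (.reg 27)) <| .seq (.set 22 (.reg 28)) <|
      .seq (.set 23 (.reg 25)) policyCmd)
    .skip

/-- The test that no initial vertex is prescribed or that it is the one in the register `25`. -/
def startTest : Expr :=
  .sub (.lit 1) (.mul (.reg 3) (.mul (.sub (.sub (.reg 3) (.lit 1)) (.reg 25))
    (.sub (.sub (.reg 3) (.lit 1)) (.reg 25))))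

/-- Evaluates the current table at all allowed initial vertices. -/
def evalCmd : Cmd :=
  .loop 25 <| .ite startTest
    (.seq (.set 7 (.reg 25)) <| .seq bestCmd <| .ite (.reg 9) compareCmd .skip) .skip

/-- For the current slope, finds vertices that sustain it, adds them to `S`, and evaluates the
tables. -/
def growCmd : Cmd :=
  .ite (.reg 14)
    (.seq (.set 12 (.reg 16)) <| .seq (.set 13 (.reg 15)) <| .seq (.set 26 (.lit 1)) <|
      .loop 5 <| .seq sweepCmd <| .seq (.set 7 (.reg 5)) <| .seq bestCmd <|
        .ite (.mul (.reg 9) (.add (.reg 10) (.lit 1)))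
          (.seq (.store 2 (.reg 5) (.lit 1)) evalCmd) .skip)
    .skip

section
variable {n N M : ℕ} {G : WeightedGraph (Fin n)} {start : Option (Fin n)} {T : ℚ}

/-- The registers `1`, `2` and `3` hold the rest of the input. -/
structure HoldsInput (start : Option (Fin n)) (T : ℚ) (s : State) : Prop where
  num : s.reg 1 = T.num
  den : s.reg 2 = T.den
  start : s.reg 3 = start.elim 0 fun v => ((v : ℕ) : ℤ) + 1

theorem HoldsInput.of_same {c : Cmd} {s s' : State} (h : HoldsInput start T s) (hs : Same c s s')
    (h1 : c.keepsReg 1 = true) (h2 : c.keepsReg 2 = true) (h3 : c.keepsReg 3 = true) :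
    HoldsInput start T s' :=
  ⟨(hs.1 1 h1).trans h.num, (hs.1 2 h2).trans h.den, (hs.1 3 h3).trans h.start⟩

/-- The best value found so far is attained by the plan found with it. -/
def BestSound (G : WeightedGraph (Fin n)) (start : Option (Fin n)) (T : ℚ) (M : ℕ) (s : State) :
    Prop :=
  s.reg 20 = 0 ∨ s.reg 20 = 1 ∧ 0 < s.reg 22 ∧ |s.reg 21| ≤ (M : ℤ) ∧ |s.reg 22| ≤ (M : ℤ) ∧
    ∃ (σ : Fin n → Fin n) (v : Fin n), s.reg 23 = (v : ℕ) ∧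
      (∀ x : Fin n, s.arr 7 (x : ℕ) = (σ x : ℕ)) ∧ IsPlan G (stationary σ v) ∧
      StartsAt start (stationary σ v) ∧
      (((s.reg 21 : ℝ) / s.reg 22 : ℝ) : EReal) ≤ seqValue (utility G (stationary σ v)) (T : ℝ)

/-- The best value found so far is at least `ν`. -/
def BestGE (s : State) (ν : ℝ) : Prop := s.reg 20 = 1 ∧ ν ≤ (s.reg 21 : ℝ) / s.reg 22

/-- The loop program does not overwrite the best value and plan found so far. -/
def Cmd.keepsBest (c : Cmd) : Bool :=
  c.keepsReg 20 && c.keepsReg 21 && c.keepsReg 22 && c.keepsReg 23 && c.keepsArr 7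

theorem BestSound.of_same {c : Cmd} {s s' : State} (h : BestSound G start T M s)
    (hs : Same c s s') (hc : c.keepsBest = true) : BestSound G start T M s' := by
  simp only [Cmd.keepsBest, Bool.and_eq_true] at hc
  simpa only [BestSound, hs.1 20 hc.1.1.1.1, hs.1 21 hc.1.1.1.2, hs.1 22 hc.1.1.2, hs.1 23 hc.1.2,
    hs.2 7 hc.2] using h

theorem BestGE.of_same {c : Cmd} {s s' : State} {ν : ℝ} (h : BestGE s ν) (hs : Same c s s')
    (hc : c.keepsBest = true) : BestGE s' ν := by
  simp only [Cmd.keepsBest, Bool.and_eq_true] at hc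
  simpa only [BestGE, hs.1 20 hc.1.1.1.1, hs.1 21 hc.1.1.1.2, hs.1 22 hc.1.1.2] using h

theorem policyCmd_sat {s : State} {Q P : ℤ} {X : Fin n → WithBot ℤ}
    (hM : n ≤ M) (hG : HoldsGraph G s) (hX : HoldsTable 3 4 X s)
    (hQ : s.reg 12 = Q) (hP : s.reg 13 = P) (hb : SumsLE G Q P X M) :
    Sat M policyCmd s fun s' => ∃ σ : Fin n → Fin n, IsGreedy G Q P X σ ∧
      ∀ x : Fin n, s'.arr 7 (x : ℕ) = (σ x : ℕ) := by
  unfold policyCmd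
  refine Sat.loop (n := n) (fun j s' => ∀ v : Fin n, (v : ℕ) < j → ∃ u : Fin n,
    s'.arr 7 (v : ℕ) = (u : ℕ) ∧ (bestEdge G Q P X v ≠ ⊥ →
      bestEdge G Q P X v = scaledWeight G Q P v u + X u)) hG.card rfl (by simp) ?_ ?_
  · intro j hj s1 hs1 hj1 hinv
    refine .seq <| (bestCmd_sat hM (hG.of_same hs1 rfl rfl rfl) (hX.of_same hs1 rfl rfl)
      (v := ⟨j, hj⟩) hj1 ((hs1.1 12 rfl).trans hQ) ((hs1.1 13 rfl).trans hP) hb).mono ?_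
    rintro s2 hs2 ⟨-, u, hu, hbest⟩
    have hj2 : s2.reg 7 = j := (hs2.1 7 rfl).trans hj1
    refine .store ?_ fun v hv => ?_
    · simp only [Expr.eval, hu, Nat.abs_cast]
      have := u.2
      omega
    · by_cases hvj : (v : ℕ) = j
      · obtain rfl : v = ⟨j, hj⟩ := Fin.ext hvj
        exact ⟨u, by simp [hj2, hu], hbest⟩
      · obtain ⟨u', hu', hb'⟩ := hinv v (by omega)
        exact ⟨u', by simpa [hj2, hvj, hs2.2 7 rfl] using hu', hb'⟩
  · intro s' _ h
    choose σ h1 h2 using fun v : Fin n => h v v.2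
    exact ⟨σ, h2, h1⟩

theorem compareCmd_sat (hN : SizeBound G N M) (hT : T.num.natAbs + T.den ≤ N) {s : State}
    {S : Finset (Fin n)} {z v : Fin n} {Q P e : ℤ} (hQ : 0 < Q) (hs : ScaleLE N Q P)
    (hG : HoldsGraph G s) (hX : HoldsTable 3 4 (table G true S z Q P n) s)
    (h12 : s.reg 12 = Q) (h13 : s.reg 13 = P) (hin : HoldsInput start T s)
    (hret : ∀ x ∈ insert z S, Returns G ((P : ℝ) / Q) (insert z S) x)
    (hb : BestSound G start T M s) (hv : s.reg 25 = (v : ℕ)) (hstart : ∀ v' ∈ start, v = v')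
    (he : bestEdge G Q P (table G true S z Q P n) v = (e : WithBot ℤ)) (h10 : s.reg 10 = e) :
    Sat M compareCmd s fun s' => BestSound G start T M s' ∧
      (∀ ν, BestGE s ν → BestGE s' ν) ∧ BestGE s' ((P * ((T : ℝ) + 1) + e) / Q) := by
  have hQ' : (0 : ℝ) < Q := by exact_mod_cast hQ
  have hden : (0 : ℝ) < T.den := by exact_mod_cast T.den_pos
  have hM : (1 : ℤ) ≤ M := by exact_mod_cast hN.one_le
  set a := P * (T.num + T.den) + e * T.den with ha
  set d := Q * T.den with hd
  have hd0 : 0 < d := mul_pos hQ (by exact_mod_cast T.den_pos)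
  have hd0' : (0 : ℝ) < d := by exact_mod_cast hd0
  have hval : (a : ℝ) / d = (P * ((T : ℝ) + 1) + e) / Q := by
    have hTd : (T : ℝ) * T.den = T.num := by
      rw [Rat.cast_def, div_mul_cancel₀ _ hden.ne']
    rw [div_eq_div_iff hd0'.ne' hQ'.ne', ha, hd]
    push_cast
    linear_combination (-(P : ℝ) * Q) * hTd
  have hTd1 : |T.num + (T.den : ℤ)| ≤ N := by
    refine (abs_add_le _ _).trans ?_
    rw [Int.abs_eq_natAbs, Nat.abs_cast]
    exact_mod_cast hT
  have hTd2 : |(T.den : ℤ)| ≤ N := by rw [Nat.abs_cast]; omega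
  have hale : |a| ≤ M := by
    have hN1 : (1 : ℤ) ≤ N := by exact_mod_cast (by have := hN.two_le; omega : 1 ≤ N)
    calc |a| ≤ |P| * |T.num + (T.den : ℤ)| + |e| * |(T.den : ℤ)| := by
          rw [ha, ← abs_mul, ← abs_mul]; exact abs_add_le _ _
      _ ≤ (N : ℤ) ^ 2 * N + N ^ 5 * N := by
          have := hs.2
          have := hs.bestEdge_le hN le_rfl he
          gcongr
      _ = (N : ℤ) ^ 3 + N ^ 6 := by ring
      _ ≤ (N : ℤ) ^ 6 + N ^ 6 := by gcongr; first | exact hN1 | omega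
      _ ≤ (N : ℤ) ^ 6 * N := hN.mul_two_le (by positivity)
      _ = (N : ℤ) ^ 7 := by ring
      _ ≤ M := hN.pow_le (by omega)
  have hdle : |d| ≤ M := by
    calc |d| ≤ |Q| * |(T.den : ℤ)| := by rw [hd, abs_mul]
      _ ≤ (N : ℤ) * N := mul_le_mul hs.1 hTd2 (abs_nonneg _) (by positivity)
      _ = (N : ℤ) ^ 2 := by ring
      _ ≤ M := hN.pow_le (by omega)
  have hflag : s.reg 20 = 0 ∨ s.reg 20 = 1 := hb.imp_right And.left
  have e27 : (Expr.add (.mul (.reg 13) (.add (.reg 1) (.reg 2))) (.mul (.reg 10) (.reg 2))).eval s =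
      a := by simp only [Expr.eval, hin.num, hin.den, h13, h10]; rfl
  have e28 : ∀ x, (Expr.mul (.reg 12) (.reg 2)).eval (s.setReg 27 x) = d := by
    intro x; simp [hin.den, h12, hd]
  refine .seq <| .set (by rw [e27]; exact hale) <| .seq <| .set (by rw [e28]; exact hdle) <| ?_
  rw [e27, e28]
  set s1 := (s.setReg 27 a).setReg 28 d with hs1
  have r1 : ∀ i, i ≠ 27 → i ≠ 28 → s1.reg i = s.reg i := fun i h h' => by simp [hs1, h, h']
  have r27 : s1.reg 27 = a := by simp [hs1]
  have r28 : s1.reg 28 = d := by simp [hs1]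
  have r20 := r1 20 (by omega) (by omega)
  have r21 := r1 21 (by omega) (by omega)
  have r22 := r1 22 (by omega) (by omega)
  refine .ite (fun h2 => ?_) fun h2 => .skip ?_
  · rw [Expr.eval_unlessFlag_pos (by simpa [r1] using hflag)] at h2
    simp only [Expr.eval, r20, r21, r22, r27, r28] at h2
    refine .seq <| .set (by simpa using hM) <| .seq <| .set (by simpa [r27] using hale) <|
      .seq <| .set (by simpa [r28] using hdle) <| .seq <| .set ?_ ?_
    · simp only [Expr.eval, State.setReg_reg]
      norm_num
      rw [r1 25 (by omega) (by omega), hv, Nat.abs_cast]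
      have := v.2
      have := hN.card_le'
      omega
    · simp only [Expr.eval, State.setReg_reg]
      norm_num
      rw [r27, r28, r1 25 (by omega) (by omega), hv]
      refine (policyCmd_sat (s := (((s1.setReg 20 1).setReg 21 a).setReg 22 d).setReg 23 (v : ℕ))
        (Q := Q) (P := P) (X := table G true S z Q P n) hN.card_le' ?_ hX ?_ ?_ (hs.sumsLE hN le_rfl)).mono ?_
      · exact ⟨by simpa [hs1] using hG.card, hG.edge, hG.weight⟩
      · simpa [hs1] using h12
      · simpa [hs1] using h13
      rintro s3 hs3 ⟨σ, hσ, h7⟩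
      have q20 : s3.reg 20 = 1 := by simpa using hs3.1 20 rfl
      have q21 : s3.reg 21 = a := by simpa using hs3.1 21 rfl
      have q22 : s3.reg 22 = d := by simpa using hs3.1 22 rfl
      have q23 : s3.reg 23 = (v : ℕ) := by simpa using hs3.1 23 rfl
      refine ⟨.inr ⟨q20, by rwa [q22], by rwa [q21], by rwa [q22], σ, v, q23, h7,
        (hσ.isPlan hQ hret he).1, hstart, ?_⟩, ?_, q20, ?_⟩
      · rw [q21, q22, hval]
        exact hσ.le_seqValue hQ hret he T
      · rintro ν ⟨hν1, hν2⟩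
        refine ⟨q20, hν2.trans ?_⟩
        rcases hb with hb | ⟨-, h22, -⟩
        · omega
        have h22' : (0 : ℝ) < s.reg 22 := by exact_mod_cast h22
        rw [q21, q22, div_le_div_iff₀ h22' hd0']
        have h3 := h2.resolve_left (by omega)
        have h4 : s.reg 21 * d ≤ a * s.reg 22 := by omega
        exact_mod_cast h4
      · rw [q21, q22, hval]
  · rw [← not_lt, Expr.eval_unlessFlag_pos (by simpa [r1] using hflag)] at h2
    simp only [Expr.eval, r20, r21, r22, r27, r28, not_or] at h2
    have hb1 : BestSound G start T M s1 := by simpa [BestSound, hs1] using hb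
    have hge : ∀ ν, BestGE s ν → BestGE s1 ν := by intro ν hν; simpa [BestGE, hs1] using hν
    refine ⟨hb1, hge, hge _ ?_⟩
    rcases hb with hb | ⟨hb, h22, -⟩
    · exact absurd hb h2.1
    refine ⟨hb, ?_⟩
    have h22' : (0 : ℝ) < s.reg 22 := by exact_mod_cast h22
    rw [← hval, div_le_div_iff₀ hd0' h22']
    have h3 := h2.2
    have h4 : a * s.reg 22 ≤ s.reg 21 * d := by omega
    exact_mod_cast h4

theorem startTest_pos {s : State} {v : Fin n} (hin : HoldsInput start T s)
    (hv : s.reg 25 = (v : ℕ)) : 0 < startTest.eval s ↔ ∀ v' ∈ start, v = v' := by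
  simp only [startTest, Expr.eval, hin.start, hv]
  cases start with
  | none => simp
  | some w =>
    simp only [Option.elim_some, Option.mem_def, Option.some.injEq, forall_eq']
    constructor
    · intro h
      by_contra hne
      have hne' : ((w : ℕ) : ℤ) + 1 - 1 - (v : ℕ) ≠ 0 := by
        intro h0
        exact hne (Fin.ext (by omega))
      have h1 := mul_self_pos.2 hne'
      have h2 : (0 : ℤ) ≤ (w : ℕ) := by positivity
      nlinarith
    · rintro rfl
      simp

theorem evalCmd_sat (hN : SizeBound G N M) (hT : T.num.natAbs + T.den ≤ N) {s : State}
    {S : Finset (Fin n)} {z : Fin n} {Q P : ℤ} (hQ : 0 < Q) (hs : ScaleLE N Q P)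
    (hG : HoldsGraph G s) (hX : HoldsTable 3 4 (table G true S z Q P n) s)
    (h12 : s.reg 12 = Q) (h13 : s.reg 13 = P) (hin : HoldsInput start T s)
    (hret : ∀ x ∈ insert z S, Returns G ((P : ℝ) / Q) (insert z S) x)
    (hb : BestSound G start T M s) :
    Sat M evalCmd s fun s' => BestSound G start T M s' ∧ (∀ ν, BestGE s ν → BestGE s' ν) ∧
      ∀ v : Fin n, (∀ v' ∈ start, v = v') → ∀ e : ℤ,
        bestEdge G Q P (table G true S z Q P n) v = (e : WithBot ℤ) →
        BestGE s' ((P * ((T : ℝ) + 1) + e) / Q) := by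
  unfold evalCmd
  refine Sat.loop (n := n) (fun j s' => BestSound G start T M s' ∧
    (∀ ν, BestGE s ν → BestGE s' ν) ∧ ∀ v : Fin n, (v : ℕ) < j → (∀ v' ∈ start, v = v') → ∀ e : ℤ,
        bestEdge G Q P (table G true S z Q P n) v = (e : WithBot ℤ) →
        BestGE s' ((P * ((T : ℝ) + 1) + e) / Q)) hG.card rfl ?_ ?_ ?_
  · exact ⟨by simpa [BestSound] using hb, by simp [BestGE], by simp⟩
  · rintro j hj s1 hs1 hj1 ⟨hb1, hge1, hv1⟩
    have in1 := hin.of_same hs1 rfl rfl rfl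
    -- it is enough to keep what was found and to treat the vertex `j`
    have key : ∀ s2 : State, BestSound G start T M s2 → (∀ ν, BestGE s1 ν → BestGE s2 ν) →
        ((∀ v' ∈ start, (⟨j, hj⟩ : Fin n) = v') → ∀ e : ℤ,
          bestEdge G Q P (table G true S z Q P n) ⟨j, hj⟩ = (e : WithBot ℤ) →
          BestGE s2 ((P * ((T : ℝ) + 1) + e) / Q)) →
        BestSound G start T M (s2.setReg 25 (j + 1)) ∧
        (∀ ν, BestGE s ν → BestGE (s2.setReg 25 (j + 1)) ν) ∧ ∀ v : Fin n, (v : ℕ) < j + 1 →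
          (∀ v' ∈ start, v = v') → ∀ e : ℤ,
          bestEdge G Q P (table G true S z Q P n) v = (e : WithBot ℤ) →
          BestGE (s2.setReg 25 (j + 1)) ((P * ((T : ℝ) + 1) + e) / Q) := by
      intro s2 hb2 hge2 hv2
      have ge : ∀ ν, BestGE s2 ν → BestGE (s2.setReg 25 (j + 1)) ν := fun ν h => by
        simpa [BestGE] using h
      refine ⟨by simpa [BestSound] using hb2, fun ν h => ge ν (hge2 ν (hge1 ν h)), ?_⟩
      intro v hv hst e he
      rcases Nat.lt_succ_iff_lt_or_eq.1 hv with h | h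
      · exact ge _ (hge2 _ (hv1 v h hst e he))
      · obtain rfl : v = ⟨j, hj⟩ := Fin.ext h
        exact ge _ (hv2 hst e he)
    refine .ite (fun h => ?_) fun h => .skip (key s1 hb1 (fun _ h => h) fun hst => ?_)
    · have hst := (startTest_pos (v := ⟨j, hj⟩) in1 hj1).1 h
      refine .seq <| .set ?_ <| .seq ?_
      · have := hN.card_le'
        simp only [Expr.eval, hj1, Nat.abs_cast]
        omega
      simp only [Expr.eval, hj1]
      have hb2 : BestSound G start T M (s1.setReg 7 j) := by simpa [BestSound] using hb1
      have hge2 : ∀ ν, BestGE s1 ν → BestGE (s1.setReg 7 j) ν := by simp [BestGE]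
      have hG2 : HoldsGraph G (s1.setReg 7 j) := by
        have h := hG.of_same hs1 rfl rfl rfl
        exact ⟨by simpa using h.card, h.edge, h.weight⟩
      have hX2 : HoldsTable 3 4 (table G true S z Q P n) (s1.setReg 7 j) :=
        fun u => (hX.of_same hs1 rfl rfl) u
      have in2 : HoldsInput start T (s1.setReg 7 j) :=
        ⟨by simpa using in1.num, by simpa using in1.den, by simpa using in1.start⟩
      have r12 : (s1.setReg 7 j).reg 12 = Q := by simpa using (hs1.1 12 rfl).trans h12
      have r13 : (s1.setReg 7 j).reg 13 = P := by simpa using (hs1.1 13 rfl).trans h13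
      refine (bestCmd_sat hN.card_le' hG2 hX2 (v := ⟨j, hj⟩) (by simp) r12 r13
        (hs.sumsLE hN le_rfl)).mono ?_
      rintro s3 hs3 ⟨henc, -⟩
      have hb3 := hb2.of_same hs3 rfl
      have hge3 : ∀ ν, BestGE s1 ν → BestGE s3 ν := fun ν h => (hge2 ν h).of_same hs3 rfl
      refine .ite (fun h9 => ?_) fun h9 => .skip (key s3 hb3 hge3 fun _ e he => ?_)
      · have he := henc.eq_coe h9
        refine (compareCmd_sat hN hT hQ hs (hG2.of_same hs3 rfl rfl rfl) (hX2.of_same hs3 rfl rfl)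
          ((hs3.1 12 rfl).trans r12) ((hs3.1 13 rfl).trans r13) (in2.of_same hs3 rfl rfl rfl) hret
          hb3 (v := ⟨j, hj⟩) ?_ hst he rfl).mono ?_
        · rw [hs3.1 25 rfl]
          simpa using hj1
        · rintro s4 hs4 ⟨hb4, hge4, hv4⟩
          refine key s4 hb4 (fun ν h => hge4 ν (hge3 ν h)) fun _ e he' => ?_
          rw [he, WithBot.coe_inj] at he'
          exact he' ▸ hv4
      · rw [henc.eq_bot h9] at he
        simp at he
    · exact absurd ((startTest_pos (v := ⟨j, hj⟩) in1 hj1).2 hst) (by omega)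
  · rintro s' _ ⟨hb', hge', hv'⟩
    exact ⟨hb', hge', fun v => hv' v v.2⟩

/-- The best value found so far is at least that of every plan that, once it has reached a vertex
of `S` before the time `T`, can sustain the slope of a line that it has not violated before. -/
def BestFor (G : WeightedGraph (Fin n)) (start : Option (Fin n)) (T : ℚ) (S : Finset (Fin n))
    (s : State) : Prop :=
  ∀ (x : ℕ → Fin n) (b ν : ℝ) (t₁ : ℕ), IsPlan G x → StartsAt start x → (t₁ : ℝ) ≤ T →
    Sustains G (x (t₁ + 1)) b → (∀ j ≤ t₁, ν ≤ utility G x j + b * (T - j)) → x (t₁ + 1) ∈ S →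
    BestGE s ν

theorem BestFor.mono {S : Finset (Fin n)} {s s' : State} (h : BestFor G start T S s)
    (hs : ∀ ν, BestGE s ν → BestGE s' ν) : BestFor G start T S s' :=
  fun x b ν t₁ h1 h2 h3 h4 h5 h6 => hs ν (h x b ν t₁ h1 h2 h3 h4 h5 h6)

theorem growCmd_sat (hN : SizeBound G N M) (hT : T.num.natAbs + T.den ≤ N) {s : State}
    {S : Finset (Fin n)} (hG : HoldsGraph G s) (hin : HoldsInput start T s) (hS : HoldsSet S s)
    (hsl : HoldsSlope G N S s) (hb : BestSound G start T M s) (hbf : BestFor G start T S s) :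
    Sat M growCmd s fun s' => ∃ S', S ⊆ S' ∧ HoldsSet S' s' ∧ HoldsSlope G N S' s' ∧
      BestSound G start T M s' ∧ BestFor G start T S' s' ∧
      (s.reg 14 = 1 → ∀ z, Returns G s.slope (insert z S) z → z ∈ S') := by
  refine .ite (fun h14 => ?_) fun h14 => .skip ⟨S, subset_rfl, hS, hsl, hb, hbf, fun h => ?_⟩
  swap
  · simp only [Expr.eval] at h14; omega
  simp only [Expr.eval] at h14
  obtain ⟨h14, h16, hsc, hslope⟩ := hsl.resolve_left (by omega)
  have hM : (1 : ℤ) ≤ M := by exact_mod_cast hN.one_le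
  set Q := s.reg 16 with hQ
  set P := s.reg 15 with hP
  have ha : s.slope = (P : ℝ) / Q := rfl
  rw [ha] at hslope
  refine .seq <| .set ?_ <| .seq <| .set ?_ <| .seq <| .set (by simpa using hM) ?_
  · exact hsc.1.trans (by simpa using hN.pow_le (j := 1) (by omega))
  · simpa using hsc.2.trans (hN.pow_le (by omega))
  simp only [Expr.eval, State.setReg_reg]
  norm_num
  rw [← hQ, ← hP]
  set s0 := ((s.setReg 12 Q).setReg 13 P).setReg 26 1 with hs0
  refine Sat.loop (n := n) (fun j s' => ∃ S', S ⊆ S' ∧ HoldsSet S' s' ∧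
    (∀ x ∈ S', Returns G ((P : ℝ) / Q) S' x) ∧ BestSound G start T M s' ∧
    BestFor G start T S' s' ∧
    ∀ z : Fin n, (z : ℕ) < j → Returns G ((P : ℝ) / Q) (insert z S) z → z ∈ S')
    (by simpa [hs0] using hG.card) rfl ?_ ?_ ?_
  · refine ⟨S, subset_rfl, hS, hslope.returns, by simpa [BestSound, hs0] using hb, ?_, by simp⟩
    exact hbf.mono fun ν h => by simpa [BestGE, hs0] using h
  · rintro j hj s1 hs1 hj1 ⟨S', hSS, hS1, hret1, hb1, hbf1, hz1⟩
    have k1 : Setup G true S' ⟨j, hj⟩ Q P s1 := by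
      refine ⟨⟨?_, ?_, ?_⟩, hS1, hj1, ?_, ?_, ?_⟩
      · simpa [hs0, hG.card] using hs1.1 0 rfl
      · exact fun v u => (hs1.2 0 rfl _).trans (hG.edge v u)
      · exact fun v u hE => (hs1.2 1 rfl _).trans (hG.weight v u hE)
      · simpa [hs0] using hs1.1 12 rfl
      · simpa [hs0] using hs1.1 13 rfl
      · simpa [hs0] using hs1.1 26 rfl
    have in1 : HoldsInput start T s1 := by
      refine ⟨?_, ?_, ?_⟩
      · simpa [hs0, hin.num] using hs1.1 1 rfl
      · simpa [hs0, hin.den] using hs1.1 2 rfl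
      · simpa [hs0, hin.start] using hs1.1 3 rfl
    refine .seq <| (sweepCmd_sat hN k1 hsc).mono fun s2 hs2 hX2 => ?_
    have k2 := k1.of_same hs2 rfl
    have in2 := in1.of_same hs2 rfl rfl rfl
    refine .seq <| .set ?_ <| .seq ?_
    · have := hN.card_le'
      simp only [Expr.eval, k2.vertex, Nat.abs_cast]
      omega
    simp only [Expr.eval, k2.vertex]
    have k3 : Setup G true S' ⟨j, hj⟩ Q P (s2.setReg 7 j) := k2.setReg (by decide)
    have in3 : HoldsInput start T (s2.setReg 7 j) :=
      ⟨by simpa using in2.num, by simpa using in2.den, by simpa using in2.start⟩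
    have hb3 : BestSound G start T M (s2.setReg 7 j) := by
      simpa [BestSound] using hb1.of_same hs2 rfl
    have hge3 : ∀ ν, BestGE s1 ν → BestGE (s2.setReg 7 j) ν := fun ν h => by
      simpa [BestGE] using h.of_same hs2 rfl
    have hX3 : HoldsTable 3 4 (table G true S' ⟨j, hj⟩ Q P n) (s2.setReg 7 j) := hX2
    refine (bestCmd_sat hN.card_le' k3.graph hX3 (v := ⟨j, hj⟩) (by simp) k3.scale k3.shift
      (hsc.sumsLE hN le_rfl)).mono ?_
    rintro s4 hs4 ⟨henc, -⟩
    have k4 := k3.of_same hs4 rfl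
    have in4 := in3.of_same hs4 rfl rfl rfl
    have hb4 := hb3.of_same hs4 rfl
    have hge4 : ∀ ν, BestGE s1 ν → BestGE s4 ν := fun ν h => (hge3 ν h).of_same hs4 rfl
    have hX4 := hX3.of_same hs4 rfl rfl
    refine .ite (fun h => ?_) fun h => .skip ?_
    · simp only [Expr.eval] at h
      have h9 : 0 < s4.reg 9 := by
        rcases henc.flag with h0 | h0
        · rw [h0] at h; simp at h
        · omega
      have he := henc.eq_coe h9
      have h10 : 0 ≤ s4.reg 10 := by
        have := (pos_iff_pos_of_mul_pos h).1 h9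
        omega
      have hzret : Returns G ((P : ℝ) / Q) (insert ⟨j, hj⟩ S') ⟨j, hj⟩ :=
        (returns_iff_bestEdge h16).2 ⟨_, he, h10⟩
      have hret : ∀ x ∈ insert (⟨j, hj⟩ : Fin n) S',
          Returns G ((P : ℝ) / Q) (insert ⟨j, hj⟩ S') x := by
        intro x hx
        rcases Finset.mem_insert.1 hx with rfl | hx
        · exact hzret
        · exact (hret1 x hx).mono le_rfl (Finset.subset_insert _ _)
      refine .seq <| .store (by simpa using hM) ?_
      simp only [Expr.eval, k4.vertex]
      have a5 : ∀ (l : Fin 8) (i : ℤ), l ≠ 2 → (s4.setMem (cell 2 j) 1).arr l i = s4.arr l i :=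
        fun l i hl => by simp [hl]
      have hS5 : HoldsSet (insert ⟨j, hj⟩ S') (s4.setMem (cell 2 j) 1) := by
        intro u
        by_cases hu : (u : ℕ) = j
        · obtain rfl : u = ⟨j, hj⟩ := Fin.ext hu
          simp
        · have hne : u ≠ ⟨j, hj⟩ := fun h => hu (by rw [h])
          simpa [hu, hne] using k4.set u
      refine (evalCmd_sat (start := start) (s := s4.setMem (cell 2 j) 1) hN hT h16 hsc (S := S') (z := ⟨j, hj⟩) ?_ ?_ k4.scale k4.shift ?_ hret
        ?_).mono ?_
      · exact ⟨k4.graph.card, fun v u => (a5 0 _ (by decide)).trans (k4.graph.edge v u),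
          fun v u hE => (a5 1 _ (by decide)).trans (k4.graph.weight v u hE)⟩
      · intro u
        rw [a5 3 _ (by decide), a5 4 _ (by decide)]
        exact hX4 u
      · exact ⟨in4.num, in4.den, in4.start⟩
      · simpa [BestSound] using hb4
      · rintro s6 hs6 ⟨hb6, hge6, hv6⟩
        have hge6' : ∀ ν, BestGE s1 ν → BestGE s6 ν := fun ν h => hge6 ν (hge4 ν h)
        refine ⟨insert ⟨j, hj⟩ S', hSS.trans (Finset.subset_insert _ _), ?_, hret,
          by simpa [BestSound] using hb6, ?_, ?_⟩
        · have h6 := hS5.of_same hs6 rfl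
          exact h6
        · suffices h : BestFor G start T (insert ⟨j, hj⟩ S') s6 from
            h.mono fun ν h => by simpa [BestGE] using h
          intro x b ν t₁ hx hst ht₁ hsus hν hin
          by_cases hold : x (t₁ + 1) ∈ S'
          · exact hge6' ν (hbf1 x b ν t₁ hx hst ht₁ hsus hν hold)
          · have hble := hslope.sustains _ (fun h => hold (hSS h)) b hsus
            obtain ⟨e, he, hle⟩ :=
              le_bestEdge_of_plan h16 (hslope.cycles.mono hSS) hx hble ht₁ hν hin
            obtain ⟨h1, h2⟩ := hv6 (x 0) hst e he
            exact ⟨h1, hle.trans h2⟩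
        · intro z hz hzr
          rcases Nat.lt_succ_iff_lt_or_eq.1 hz with h | h
          · exact Finset.mem_insert_of_mem (hz1 z h hzr)
          · rw [Finset.mem_insert]
            exact .inl (Fin.ext h)
    · simp only [Expr.eval] at h
      refine ⟨S', hSS, k4.set, hret1, by simpa [BestSound] using hb4,
        (hbf1.mono hge4).mono fun ν h => by simpa [BestGE] using h, fun z hz hzr => ?_⟩
      rcases Nat.lt_succ_iff_lt_or_eq.1 hz with h' | h'
      · exact hz1 z h' hzr
      · obtain rfl : z = ⟨j, hj⟩ := Fin.ext h'
        exfalso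
        obtain ⟨e, he, h0⟩ := (returns_iff_bestEdge h16).1
          (hzr.mono le_rfl (Finset.insert_subset_insert _ hSS))
        rw [he, enc_coe] at henc
        rw [henc.1, henc.2] at h
        omega
  · rintro s7 hs7 ⟨S', hSS, hS7, hret7, hb7, hbf7, hz7⟩
    refine ⟨S', hSS, hS7, .inr ⟨?_, ?_, ?_, ?_⟩, hb7, hbf7, fun _ z hz => hz7 z z.2 hz⟩
    · simpa [hs0, h14] using hs7.1 14 rfl
    · rw [hs7.1 16 rfl]; simpa [hs0] using h16
    · rw [hs7.1 16 rfl, hs7.1 15 rfl]; simpa [hs0] using hsc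
    · have : s7.slope = (P : ℝ) / Q := by
        rw [State.slope, hs7.1 16 rfl, hs7.1 15 rfl]; simp [hs0, hQ, hP]
      rw [this]
      exact ⟨hslope.cycles.mono hSS, hret7, fun y hy => hslope.sustains y fun h => hy (hSS h)⟩

end
/-! ### The whole program -/

/-- Copies the input matrices to the arrays `0` and `1`. -/
def loadCmd : Cmd :=
  .loop 7 <| .loop 8 <| .seq
    (.store 0 (.add (.mul (.reg 7) (.reg 0)) (.reg 8))
      (.read (.mul (.lit 2) (.add (.mul (.reg 7) (.reg 0)) (.reg 8)))))
    (.store 1 (.add (.mul (.reg 7) (.reg 0)) (.reg 8))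
      (.read (.add (.mul (.lit 2) (.add (.mul (.reg 7) (.reg 0)) (.reg 8))) (.lit 1))))

/-- The computation of the value and of an optimal plan. -/
def solveCmd : Cmd := .seq loadCmd <| .loop 4 <| .seq searchCmd <| .seq slopeCmd growCmd

/-- Decides whether the value is nonnegative. -/
def decideCmd : Cmd :=
  .seq solveCmd <| .ite (.mul (.reg 20) (.add (.reg 21) (.lit 1))) (.set 0 (.lit 1)) (.set 0 (.lit 0))

/-- Copies the optimal plan to the cells `0, …, n - 1`. -/
def outputCmd : Cmd := .loop 7 (.poke (.reg 7) (.arr 7 (.reg 7)))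

/-- Computes the value and an optimal plan. -/
def optimizeCmd : Cmd :=
  .seq solveCmd <| .ite (.reg 20)
    (.seq outputCmd <| .seq (.set 1 (.reg 21)) <| .seq (.set 2 (.reg 22)) <|
      .seq (.set 3 (.reg 23)) (.set 0 (.lit 1)))
    (.set 0 (.lit 0))

section
variable {n N M : ℕ} {G : WeightedGraph (Fin n)} {start : Option (Fin n)} {T : ℚ}

theorem pair_index_inj {a b c d : Fin n} :
    ((a : ℕ) : ℤ) * n + (b : ℕ) = ((c : ℕ) : ℤ) * n + (d : ℕ) ↔ a = c ∧ b = d := by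
  constructor
  · intro h
    have h' : (b : ℕ) + n * (a : ℕ) = (d : ℕ) + n * (c : ℕ) := by
      have : ((a : ℕ) : ℤ) * n + (b : ℕ) = ((c : ℕ) : ℤ) * n + (d : ℕ) := h
      zify
      linarith
    have hn : 0 < n := a.pos
    have h1 := congrArg (· % n) h'
    have h2 := congrArg (· / n) h'
    simp only [Nat.add_mul_mod_self_left, Nat.mod_eq_of_lt b.2, Nat.mod_eq_of_lt d.2] at h1
    simp only [Nat.add_mul_div_left _ _ hn, Nat.div_eq_of_lt b.2, Nat.div_eq_of_lt d.2,
      zero_add] at h2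
    exact ⟨Fin.ext h2, Fin.ext h1⟩
  · rintro ⟨rfl, rfl⟩
    rfl

theorem graphMemory_edge (v u : Fin n) :
    graphMemory G (2 * (((v : ℕ) : ℤ) * n + (u : ℕ))) = if (v, u) ∈ G.E then 1 else 0 := by
  have : ∀ e : Fin n × Fin n,
      ((if 2 * (((v : ℕ) : ℤ) * n + (u : ℕ)) = 2 * (((e.1 : ℕ) : ℤ) * n + (e.2 : ℕ)) then (1 : ℤ)
        else 0) + if 2 * (((v : ℕ) : ℤ) * n + (u : ℕ)) =
          2 * (((e.1 : ℕ) : ℤ) * n + (e.2 : ℕ)) + 1 then G.w e else 0) =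
      if (v, u) = e then 1 else 0 := by
    rintro ⟨a, b⟩
    rw [if_neg (by omega : ¬ (2 * (((v : ℕ) : ℤ) * n + (u : ℕ)) =
      2 * (((a : ℕ) : ℤ) * n + (b : ℕ)) + 1)), add_zero]
    refine if_congr ?_ rfl rfl
    rw [mul_right_inj' two_ne_zero, pair_index_inj, Prod.mk.injEq]
  rw [graphMemory, Finset.sum_congr rfl fun e _ => this e, Finset.sum_ite_eq]

theorem graphMemory_weight {v u : Fin n} (h : (v, u) ∈ G.E) :
    graphMemory G (2 * (((v : ℕ) : ℤ) * n + (u : ℕ)) + 1) = G.w (v, u) := by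
  have : ∀ e : Fin n × Fin n,
      ((if 2 * (((v : ℕ) : ℤ) * n + (u : ℕ)) + 1 = 2 * (((e.1 : ℕ) : ℤ) * n + (e.2 : ℕ)) then
        (1 : ℤ) else 0) + if 2 * (((v : ℕ) : ℤ) * n + (u : ℕ)) + 1 =
          2 * (((e.1 : ℕ) : ℤ) * n + (e.2 : ℕ)) + 1 then G.w e else 0) =
      if (v, u) = e then G.w e else 0 := by
    rintro ⟨a, b⟩
    rw [if_neg (by omega : ¬ (2 * (((v : ℕ) : ℤ) * n + (u : ℕ)) + 1 =
      2 * (((a : ℕ) : ℤ) * n + (b : ℕ)))), zero_add]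
    refine if_congr ?_ rfl rfl
    rw [add_left_inj, mul_right_inj' two_ne_zero, pair_index_inj, Prod.mk.injEq]
  rw [graphMemory, Finset.sum_congr rfl fun e _ => this e, Finset.sum_ite_eq, if_pos h]

theorem abs_graphMemory_le (hN : SizeBound G N M) (a : ℤ) : |graphMemory G a| ≤ (M : ℤ) := by
  have hN1 : (1 : ℤ) ≤ N := by exact_mod_cast (by have := hN.two_le; omega : 1 ≤ N)
  have hE : (G.E.card : ℤ) ≤ (N : ℤ) ^ 2 := by
    have h1 : G.E.card ≤ n * n := by
      simpa using Finset.card_le_univ G.E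
    have h2 : n * n ≤ N ^ 2 := by rw [sq]; exact Nat.mul_le_mul hN.card_le hN.card_le
    exact_mod_cast h1.trans h2
  calc |graphMemory G a| ≤ ∑ e ∈ G.E, ((N : ℤ) + N) := by
        refine (Finset.abs_sum_le_sum_abs _ _).trans (Finset.sum_le_sum fun e he => ?_)
        refine (abs_add_le _ _).trans (add_le_add ?_ ?_)
        · split_ifs <;> simp; omega
        · split_ifs
          · exact (abs_weight_le he).trans (by exact_mod_cast hN.weight_le)
          · simp
    _ = G.E.card * ((N : ℤ) + N) := by rw [Finset.sum_const, nsmul_eq_mul]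
    _ ≤ (N : ℤ) ^ 2 * (N * N) := by
      have := hN.mul_two_le (x := N) (by positivity)
      gcongr
    _ = (N : ℤ) ^ 4 := by ring
    _ ≤ M := hN.pow_le (by omega)

theorem loadCmd_sat (hN : SizeBound G N M) {s : State} (hs : s = inputState G start T) :
    Sat M loadCmd s (HoldsGraph G) := by
  have hn : s.reg 0 = n := by rw [hs]; rfl
  have hneg : ∀ (k : Fin 8) (v u : ℕ) (a : ℤ), 0 ≤ a → a ≠ cell k ((v : ℤ) * n + u) := by
    intro k v u a ha h
    have : (0 : ℤ) ≤ (v : ℤ) * n + u := by positivity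
    rw [h] at ha
    unfold cell at ha
    omega
  unfold loadCmd
  -- the cells with nonnegative addresses keep the input
  refine (Sat.loop (n := n) (fun i s' => (∀ a, 0 ≤ a → s'.mem a = graphMemory G a) ∧
    ∀ v u : Fin n, (v : ℕ) < i → s'.arr 0 ((v : ℕ) * n + (u : ℕ)) = (if (v, u) ∈ G.E then 1 else 0) ∧
      ((v, u) ∈ G.E → s'.arr 1 ((v : ℕ) * n + (u : ℕ)) = G.w (v, u))) hn rfl
    ⟨fun a _ => by rw [hs]; rfl, by simp⟩ ?_ fun s' hs' h =>
      ⟨(hs'.1 0 rfl).trans hn, fun v u => (h.2 v u v.2).1, fun v u => (h.2 v u v.2).2⟩)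
  rintro i hi s1 hs1 hi1 ⟨hmem1, h1⟩
  have hn1 : s1.reg 0 = n := (hs1.1 0 rfl).trans hn
  refine Sat.loop (n := n) (fun j s' => (∀ a, 0 ≤ a → s'.mem a = graphMemory G a) ∧
    ∀ v u : Fin n, ((v : ℕ) < i ∨ (v : ℕ) = i ∧ (u : ℕ) < j) →
      s'.arr 0 ((v : ℕ) * n + (u : ℕ)) = (if (v, u) ∈ G.E then 1 else 0) ∧
      ((v, u) ∈ G.E → s'.arr 1 ((v : ℕ) * n + (u : ℕ)) = G.w (v, u))) hn1 rfl ?_ ?_ ?_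
  · exact ⟨hmem1, fun v u h => h1 v u (by omega)⟩
  · rintro j hj s2 hs2 hj2 ⟨hmem2, h2⟩
    have hn2 : s2.reg 0 = n := (hs2.1 0 rfl).trans hn1
    have hi2 : s2.reg 7 = i := (hs2.1 7 rfl).trans hi1
    have hij : (0 : ℤ) ≤ (i : ℤ) * n + j := by positivity
    refine .seq <| .store ?_ <| .store ?_ ⟨?_, ?_⟩
    · simp only [Expr.eval, hn2, hi2, hj2]
      rw [hmem2 _ (by omega)]
      exact abs_graphMemory_le hN _
    · simp only [Expr.eval, hn2, hi2, hj2, State.setMem_reg, State.setMem_mem]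
      rw [if_neg (hneg 0 i j _ (by omega)), hmem2 _ (by omega)]
      exact abs_graphMemory_le hN _
    · intro a ha
      simp only [Expr.eval, hn2, hi2, hj2, State.setMem_reg, State.setReg_mem, State.setMem_mem]
      rw [if_neg (hneg 1 i j _ ha), if_neg (hneg 0 i j _ ha), hmem2 a ha]
    · intro v u hvu
      have e0 : s2.mem (2 * ((i : ℤ) * n + j)) =
          if ((⟨i, hi⟩ : Fin n), (⟨j, hj⟩ : Fin n)) ∈ G.E then 1 else 0 :=
        (hmem2 (2 * ((i : ℤ) * n + j)) (by omega)).trans (graphMemory_edge ⟨i, hi⟩ ⟨j, hj⟩)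
      have e1 : ((⟨i, hi⟩ : Fin n), (⟨j, hj⟩ : Fin n)) ∈ G.E →
          s2.mem (2 * ((i : ℤ) * n + j) + 1) = G.w (⟨i, hi⟩, ⟨j, hj⟩) := fun hE =>
        (hmem2 (2 * ((i : ℤ) * n + j) + 1) (by omega)).trans
          (graphMemory_weight (v := ⟨i, hi⟩) (u := ⟨j, hj⟩) hE)
      simp only [Expr.eval, hn2, hi2, hj2, State.setMem_reg, State.arr_setReg, State.arr_setMem,
        State.setMem_mem]
      rw [if_neg (hneg 0 i j _ (by omega : 0 ≤ 2 * ((i : ℤ) * n + j) + 1)), e0]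
      by_cases huv : v = ⟨i, hi⟩ ∧ u = ⟨j, hj⟩
      · obtain ⟨rfl, rfl⟩ := huv
        simp only [and_self, if_true]
        simpa using e1
      · have hne : ¬ ((v : ℕ) : ℤ) * n + (u : ℕ) = (i : ℤ) * n + j := fun h =>
          huv ((pair_index_inj (c := ⟨i, hi⟩) (d := ⟨j, hj⟩)).1 h)
        simp only [hne, and_false, if_false]
        refine h2 v u ?_
        rcases hvu with h | ⟨h, h'⟩
        · exact .inl h
        · rcases Nat.lt_succ_iff_lt_or_eq.1 h' with h' | h'
          · exact .inr ⟨h, h'⟩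
          · exact absurd ⟨Fin.ext h, Fin.ext h'⟩ huv
  · rintro s3 hs3 ⟨hmem3, h3⟩
    exact ⟨hmem3, fun v u hv => h3 v u (by have := u.2; omega)⟩

/-- What `solveCmd` achieves. -/
structure Solved (G : WeightedGraph (Fin n)) (start : Option (Fin n)) (T : ℚ) (M : ℕ) (s : State) :
    Prop where
  card : s.reg 0 = n
  sound : BestSound G start T M s
  complete : ∀ (x : ℕ → Fin n) (ν : ℝ), IsPlan G x → StartsAt start x →
    (ν : EReal) ≤ seqValue (utility G x) (T : ℝ) → BestGE s ν

theorem solveCmd_sat (hN : SizeBound G N M) (hT : T.num.natAbs + T.den ≤ N) (hT0 : 0 ≤ T) :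
    Sat M solveCmd (inputState G start T) (Solved G start T M) := by
  refine .seq <| (loadCmd_sat hN rfl).mono fun s0 hs0 hG0 => ?_
  have in0 : HoldsInput start T s0 := ⟨hs0.1 1 rfl, hs0.1 2 rfl, hs0.1 3 rfl⟩
  have arr0 : ∀ i : ℕ, s0.arr 2 i = 0 := by
    intro i
    rw [hs0.2 2 rfl]
    refine Finset.sum_eq_zero fun e _ => ?_
    have h1 : (0 : ℤ) ≤ ((e.1 : ℕ) : ℤ) * n + ((e.2 : ℕ) : ℤ) := by positivity
    rw [if_neg, if_neg, add_zero]
    all_goals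
      unfold cell
      simp only [Fin.val_two]
      omega
  refine Sat.loop (n := n) (fun i s' => ∃ S, HoldsSet S s' ∧ HoldsSlope G N S s' ∧
    BestSound G start T M s' ∧ BestFor G start T S s' ∧
    (i ≤ S.card ∨ ∀ y b, Sustains G y b → y ∈ S)) hG0.card rfl ?_ ?_ ?_
  · refine ⟨∅, fun u => ?_, .inl ⟨?_, rfl⟩, .inl ?_, ?_, .inl (by simp)⟩
    · simpa using arr0 u
    · have : s0.reg 14 = 0 := (hs0.1 14 rfl).trans rfl
      simpa using this
    · have : s0.reg 20 = 0 := (hs0.1 20 rfl).trans rfl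
      simpa using this
    · intro x b ν t₁ _ _ _ _ _ h
      simp at h
  · rintro i hi s1 hs1 hi1 ⟨S, hS1, hsl1, hb1, hbf1, hp1⟩
    have hG1 := hG0.of_same hs1 rfl rfl rfl
    have in1 := in0.of_same hs1 rfl rfl rfl
    refine .seq <| (searchCmd_sat hN hG1 hS1).mono fun s2 hs2 ⟨hm2, hc2⟩ => ?_
    have hsl2 : HoldsSlope G N S s2 := by
      simpa only [HoldsSlope, State.slope, hs2.1 14 rfl, hs2.1 15 rfl, hs2.1 16 rfl] using hsl1
    refine .seq <| (slopeCmd_sat hN hsl2 hm2 hc2).mono fun s3 hs3 ⟨hsl3, hz3⟩ => ?_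
    have hge3 : ∀ ν, BestGE s1 ν → BestGE s3 ν := fun ν h =>
      (h.of_same hs2 rfl).of_same hs3 rfl
    refine (growCmd_sat hN hT ((hG1.of_same hs2 rfl rfl rfl).of_same hs3 rfl rfl rfl)
      ((in1.of_same hs2 rfl rfl rfl).of_same hs3 rfl rfl rfl)
      ((hS1.of_same hs2 rfl).of_same hs3 rfl) hsl3
      ((hb1.of_same hs2 rfl).of_same hs3 rfl) (hbf1.mono hge3)).mono ?_
    rintro s4 hs4 ⟨S', hSS, hS4, hsl4, hb4, hbf4, hz4⟩
    refine ⟨S', hS4, by simpa [HoldsSlope, State.slope] using hsl4,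
      by simpa [BestSound] using hb4, hbf4.mono fun ν h => by simpa [BestGE] using h, ?_⟩
    by_cases hall : ∀ y b, Sustains G y b → y ∈ S'
    · exact .inr hall
    · push Not at hall
      obtain ⟨y, b, hyb, hyS⟩ := hall
      have hy : y ∉ S := fun h => hyS (hSS h)
      obtain ⟨h14, z, hzS, hz⟩ := hz3 y hy b hyb
      have hcard : S.card < S'.card :=
        Finset.card_lt_card ⟨hSS, fun h => hzS (h (hz4 h14 z hz))⟩
      rcases hp1 with h | h
      · exact .inl (by omega)
      · exact absurd (h y b hyb) hy
  · rintro s5 hs5 ⟨S, -, -, hb5, hbf5, hp5⟩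
    refine ⟨(hs5.1 0 rfl).trans hG0.card, hb5, fun x ν hx hst hν => ?_⟩
    obtain ⟨b, t₁, ht₁, hsus, hj⟩ := hx.exists_slope (by exact_mod_cast hT0) hν
    refine hbf5 x b ν t₁ hx hst ht₁ hsus hj ?_
    rcases hp5 with h | h
    · have : S = Finset.univ := (Finset.card_eq_iff_eq_univ S).1
        (le_antisymm (Finset.card_le_univ S) (by simpa using h))
      rw [this]
      exact Finset.mem_univ _
    · exact h _ _ hsus

/-- A plan has a value, which is not `⊥`. -/
theorem IsPlan.exists_le_seqValue {x : ℕ → Fin n} (hx : IsPlan G x) (T : ℝ) :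
    ∃ ν : ℝ, (ν : EReal) ≤ seqValue (utility G x) T := by
  refine ⟨-(G.maxWeight * (T + 1)), hx.le_seqValue (b := -G.maxWeight) fun t => ?_⟩
  have h1 := abs_pathWeight_le (G := G) (k := t + 1) fun i _ => hx i
  have h2 : -(((t + 1 : ℕ) : ℝ) * G.maxWeight) ≤ pathWeight G x (t + 1) := by
    have := (abs_le.1 h1).1
    exact_mod_cast this
  rw [utility_eq]
  push_cast at h2
  linarith

theorem Solved.spec {s : State} (h : Solved G start T M s) :
    (s.reg 20 = 0 ∧ (¬ ∃ ρ, IsPlan G ρ ∧ StartsAt start ρ) ∧ value G start (T : ℝ) = ⊥) ∨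
    (s.reg 20 = 1 ∧ 0 < s.reg 22 ∧ |s.reg 21| ≤ (M : ℤ) ∧ |s.reg 22| ≤ (M : ℤ) ∧
      value G start (T : ℝ) = (((s.reg 21 : ℝ) / (s.reg 22 : ℝ) : ℝ) : EReal) ∧
      ∃ (σ : Fin n → Fin n) (v : Fin n), s.reg 23 = (v : ℕ) ∧
        (∀ x : Fin n, s.arr 7 (x : ℕ) = (σ x : ℕ)) ∧
        IsPlan G (stationary σ v) ∧ StartsAt start (stationary σ v) ∧
        seqValue (utility G (stationary σ v)) (T : ℝ) = value G start (T : ℝ)) := by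
  have hle : s.reg 20 = 1 → value G start (T : ℝ) ≤
      (((s.reg 21 : ℝ) / (s.reg 22 : ℝ) : ℝ) : EReal) := by
    intro h1
    refine iSup_le fun x => iSup_le fun hx => iSup_le fun hst => ?_
    refine EReal.ge_of_forall_gt_iff_ge.1 fun ν hν => ?_
    exact EReal.coe_le_coe_iff.2 (h.complete x ν hx hst hν.le).2
  rcases h.sound with h0 | ⟨h1, h22, b21, b22, σ, v, h23, hσ, hp, hst, hval⟩
  · have hno : ¬ ∃ ρ, IsPlan G ρ ∧ StartsAt start ρ := by
      rintro ⟨ρ, hρ, hst⟩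
      obtain ⟨ν, hν⟩ := hρ.exists_le_seqValue (T : ℝ)
      have := (h.complete ρ ν hρ hst hν).1
      omega
    refine .inl ⟨h0, hno, ?_⟩
    rw [value, eq_bot_iff]
    exact iSup_le fun x => iSup_le fun hx => iSup_le fun hst => absurd ⟨x, hx, hst⟩ hno
  · have hge : seqValue (utility G (stationary σ v)) (T : ℝ) ≤ value G start (T : ℝ) :=
      le_iSup_of_le _ (le_iSup_of_le hp (le_iSup_of_le hst le_rfl))
    have heq := le_antisymm (hle h1) (hval.trans hge)
    exact .inr ⟨h1, h22, b21, b22, heq, σ, v, h23, hσ, hp, hst, le_antisymm hge (heq ▸ hval)⟩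

theorem decideCmd_sat (hN : SizeBound G N M) (hT : T.num.natAbs + T.den ≤ N) (hT0 : 0 ≤ T) :
    Sat M decideCmd (inputState G start T) (AnswersNonneg G start T) := by
  have hM : (1 : ℤ) ≤ M := by exact_mod_cast hN.one_le
  refine .seq <| (solveCmd_sat hN hT hT0).mono fun s hs h => ?_
  rcases h.spec with ⟨h0, -, hbot⟩ | ⟨h1, h22, -, -, hval, -⟩
  · refine .ite (fun h => ?_) fun _ => .set (by simp) (.inr ⟨by simp [hbot], by simp⟩)
    simp [h0] at h
  · have h22' : (0 : ℝ) < s.reg 22 := by exact_mod_cast h22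
    have hiff : 0 ≤ value G start (T : ℝ) ↔ 0 ≤ s.reg 21 := by
      rw [hval, ← EReal.coe_zero, EReal.coe_le_coe_iff, le_div_iff₀ h22', zero_mul]
      exact_mod_cast Iff.rfl
    refine .ite (fun h => .set (by simpa using hM) (.inl ⟨hiff.2 ?_, by simp⟩)) fun h =>
      .set (by simp) (.inr ⟨fun h' => ?_, by simp⟩)
    · simp only [Expr.eval, h1] at h; omega
    · simp only [Expr.eval, h1] at h
      have := hiff.1 h'
      omega

theorem outputCmd_sat (hM : n ≤ M) {s : State} (hn : s.reg 0 = n) {σ : Fin n → Fin n}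
    (hσ : ∀ x : Fin n, s.arr 7 (x : ℕ) = (σ x : ℕ)) :
    Sat M outputCmd s fun s' => ∀ x : Fin n, s'.mem ((x : ℕ) : ℤ) = (σ x : ℕ) := by
  unfold outputCmd
  refine Sat.loop (n := n) (fun i s' => (∀ x : Fin n, s'.arr 7 (x : ℕ) = (σ x : ℕ)) ∧
    ∀ x : Fin n, (x : ℕ) < i → s'.mem ((x : ℕ) : ℤ) = (σ x : ℕ)) hn rfl
    ⟨hσ, by simp⟩ ?_ fun s' _ h x => h.2 x x.2
  rintro i hi s1 hs1 hi1 ⟨ha, hb⟩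
  have hi' := ha ⟨i, hi⟩
  dsimp only at hi'
  have hev : (Expr.arr 7 (.reg 7)).eval s1 = (σ ⟨i, hi⟩ : ℕ) := by
    rw [Expr.eval_arr, Expr.eval, hi1, hi']
  refine ⟨?_, ?_, ?_⟩
  · change |(Expr.arr 7 (.reg 7)).eval s1| ≤ _
    rw [hev, Nat.abs_cast]
    have := (σ ⟨i, hi⟩).2
    omega
  · intro x
    change (s1.setMem (s1.reg 7) ((Expr.arr 7 (.reg 7)).eval s1)).mem (cell 7 (x : ℕ)) = _
    rw [State.setMem_mem, if_neg]
    · exact ha x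
    · rw [hi1]
      unfold cell
      omega
  · intro x hx
    change (s1.setMem (s1.reg 7) ((Expr.arr 7 (.reg 7)).eval s1)).mem (x : ℕ) = _
    rw [State.setMem_mem, hi1, hev]
    by_cases hxi : (x : ℕ) = i
    · obtain rfl : x = ⟨i, hi⟩ := Fin.ext hxi
      simp
    · rw [if_neg (by exact_mod_cast hxi)]
      exact hb x (by omega)

theorem optimizeCmd_sat (hN : SizeBound G N M) (hT : T.num.natAbs + T.den ≤ N) (hT0 : 0 ≤ T) :
    Sat M optimizeCmd (inputState G start T) (GivesValueAndPlan G start T) := by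
  have hM : (1 : ℤ) ≤ M := by exact_mod_cast hN.one_le
  refine .seq <| (solveCmd_sat hN hT hT0).mono fun s hs h => ?_
  rcases h.spec with ⟨h0, hno, -⟩ | ⟨h1, h22, b21, b22, hval, σ, v, h23, hσ, hp, hst, hopt⟩
  · refine .ite (fun h => ?_) fun _ => .set (by simp) (.inl ⟨hno, by simp⟩)
    simp [h0] at h
  · refine .ite (fun _ => ?_) fun h => by simp [h1] at h
    refine .seq <| (outputCmd_sat hN.card_le' h.card hσ).mono fun s' hs' hmem => ?_
    have e21 : s'.reg 21 = s.reg 21 := hs'.1 21 rfl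
    have e22 : s'.reg 22 = s.reg 22 := hs'.1 22 rfl
    have e23 : s'.reg 23 = s.reg 23 := hs'.1 23 rfl
    have hv : |((v : ℕ) : ℤ)| ≤ M := by
      rw [Nat.abs_cast]
      have := v.2.le.trans hN.card_le'
      exact_mod_cast this
    refine .seq <| .set (by simpa [e21] using b21) <| .seq <| .set (by simpa [e22] using b22) <|
      .seq <| .set (by simpa [e23, h23] using hv) <| .set (by simpa using hM) ?_
    refine .inr ⟨by simp, by simpa [e22] using h22, by simpa [e21, e22] using hval, σ, v,
      by simp [e23, h23], fun x => by simpa using hmem x, hp, hst, hopt⟩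

end

theorem decideCmd_wf : decideCmd.wf = true := rfl

theorem optimizeCmd_wf : optimizeCmd.wf = true := rfl

/-! ### Running time and word length -/

/-- The nesting depth of the loops. -/
def Cmd.depth : Cmd → ℕ
  | .seq p q => max p.depth q.depth
  | .ite _ p q => max p.depth q.depth
  | .loop _ p => p.depth + 1
  | _ => 0

theorem Cmd.cost_le (c : Cmd) {n : ℕ} (hn : 0 < n) : c.cost n ≤ c.cost 1 * n ^ c.depth := by
  have max_le : ∀ a b d e : ℕ, a * n ^ d + b * n ^ e ≤ (a + b) * n ^ max d e := by
    intro a b d e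
    rw [add_mul]
    gcongr
    · exact le_max_left d e
    · exact le_max_right d e
  induction c with
  | skip | set | store | poke => simp [cost, depth]
  | seq p q ihp ihq => exact (add_le_add ihp ihq).trans (max_le _ _ _ _)
  | ite e p q ihp ihq =>
    have h1 : 1 ≤ n ^ max p.depth q.depth := Nat.one_le_pow _ _ hn
    have h2 := (add_le_add ihp ihq).trans (max_le _ _ _ _)
    simp only [cost, depth]
    nlinarith [Nat.le_mul_of_pos_right (e.cost + 1) h1]
  | loop i p ih =>
    have h1 : n ≤ n ^ (p.depth + 1) := Nat.le_self_pow (by omega) n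
    have h2 : n * p.cost n ≤ p.cost 1 * n ^ (p.depth + 1) := by
      calc n * p.cost n ≤ n * (p.cost 1 * n ^ p.depth) := Nat.mul_le_mul_left n ih
        _ = _ := by ring
    simp only [cost, depth]
    nlinarith

/-- A loop program that is correct whenever the stored values stay polynomially bounded yields a
machine program that is correct and runs in time `O(n ^ 16)`, on words of logarithmically many
bits. -/
theorem Cmd.exists_run (c : Cmd) (hc : c.wf = true) (hd : c.depth ≤ 16) {n : ℕ} (hn : 0 < n)
    (G : WeightedGraph (Fin n)) (start : Option (Fin n)) (T : ℚ) {Q : State → Prop}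
    (h : ∀ N M : ℕ, SizeBound G N M → T.num.natAbs + T.den ≤ N →
      Sat M c (inputState G start T) Q) :
    ∃ (t : ℕ) (s : State), Run (wordBound 640 G T) c.compile (inputState G start T) t s ∧
      (t : ℝ) ≤ c.cost 1 * (n : ℝ) ^ 16 ∧ Q s := by
  have hden := T.den_pos
  obtain ⟨N, hNdef⟩ : ∃ N, N = n + G.maxWeight + T.num.natAbs + T.den := ⟨_, rfl⟩
  have hN : SizeBound G N (N ^ 10) := ⟨by omega, by omega, by omega, rfl⟩
  have hM : 8 ≤ N ^ 10 := by
    calc 8 ≤ 2 ^ 10 := by norm_num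
      _ ≤ N ^ 10 := Nat.pow_le_pow_left hN.two_le 10
  have hNM : (N : ℤ) ≤ (N ^ 10 : ℕ) := by
    exact_mod_cast Nat.le_self_pow (by norm_num) N
  have hs : Bounded (N ^ 10) (inputState G start T) := by
    refine ⟨fun i => ?_, abs_graphMemory_le hN⟩
    refine le_trans ?_ hNM
    rcases i with _ | _ | _ | _ | i
    · change |(n : ℤ)| ≤ N
      rw [Nat.abs_cast]; omega
    · change |T.num| ≤ N
      rw [Int.abs_eq_natAbs]; omega
    · change |(T.den : ℤ)| ≤ N
      rw [Nat.abs_cast]; omega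
    · change |start.elim 0 fun v => ((v : ℕ) : ℤ) + 1| ≤ (N : ℤ)
      cases start with
      | none => simp
      | some v =>
        have := v.2
        rw [Option.elim_some, abs_of_nonneg (by positivity)]
        omega
    · change |(0 : ℤ)| ≤ N
      simp
  obtain ⟨hsafe, hQ⟩ := h N (N ^ 10) hN (by omega)
  obtain ⟨t, ht, hrun⟩ := (c.run_compile hM hc _ hs rfl hsafe).1
  have hw : wordBound 640 G T = (N ^ 10) ^ 64 := by rw [wordBound, ← hNdef, ← pow_mul]
  refine ⟨t, _, hw ▸ hrun, ?_, hQ⟩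
  have h16 : n ^ c.depth ≤ n ^ 16 := Nat.pow_le_pow_right hn hd
  exact_mod_cast (ht.trans (c.cost_le hn)).trans (Nat.mul_le_mul_left _ h16)

/-- The logarithmic factors of the time bounds are at least `1 / 2`. -/
theorem one_le_two_mul_log {x : ℝ} (hx : 0 ≤ x) : 1 ≤ 2 * Real.log (x + 2) := by
  have h1 : Real.log 2 ≤ Real.log (x + 2) := Real.log_le_log (by norm_num) (by linarith)
  have := Real.log_two_gt_d9
  linarith

end ExpHorizon

theorem theorem4 :
    (∃ (p : ExpHorizon.Program) (C : ℝ) (k : ℕ),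
      ∀ (n : ℕ) (G : ExpHorizon.WeightedGraph (Fin n)) (start : Option (Fin n)) (T : ℚ),
        0 < n → 0 ≤ T →
        ∃ (t : ℕ) (s : ExpHorizon.State),
          ExpHorizon.Run (ExpHorizon.wordBound k G T) p (ExpHorizon.inputState G start T) t s ∧
          (t : ℝ) ≤ C * (n : ℝ) ^ 16 * Real.log ((T : ℝ) + 2) ∧
          ExpHorizon.AnswersNonneg G start T s) ∧
    (∃ (p : ExpHorizon.Program) (C : ℝ) (k : ℕ),
      ∀ (n : ℕ) (G : ExpHorizon.WeightedGraph (Fin n)) (start : Option (Fin n)) (T : ℚ),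
        0 < n → 0 ≤ T →
        ∃ (t : ℕ) (s : ExpHorizon.State),
          ExpHorizon.Run (ExpHorizon.wordBound k G T) p (ExpHorizon.inputState G start T) t s ∧
          (t : ℝ) ≤ C * (n : ℝ) ^ 16 * Real.log ((G.maxWeight : ℝ) * (n : ℝ) + 2) *
            Real.log ((T : ℝ) + 2) ∧
          ExpHorizon.GivesValueAndPlan G start T s) := by

  open ExpHorizon in
  constructor
  · refine ⟨decideCmd.compile, 2 * decideCmd.cost 1, 640, fun n G start T hn hT => ?_⟩
    obtain ⟨t, s, hrun, ht, hs⟩ := decideCmd.exists_run decideCmd_wf (by decide) hn G start T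
      fun N M hN hNT => decideCmd_sat hN hNT hT
    refine ⟨t, s, hrun, ht.trans ?_, hs⟩
    have h1 := one_le_two_mul_log (x := (T : ℝ)) (by exact_mod_cast hT)
    calc (decideCmd.cost 1 : ℝ) * (n : ℝ) ^ 16
        ≤ decideCmd.cost 1 * (n : ℝ) ^ 16 * (2 * Real.log ((T : ℝ) + 2)) :=
          le_mul_of_one_le_right (by positivity) h1
      _ = _ := by ring
  · refine ⟨optimizeCmd.compile, 4 * optimizeCmd.cost 1, 640, fun n G start T hn hT => ?_⟩
    obtain ⟨t, s, hrun, ht, hs⟩ := optimizeCmd.exists_run optimizeCmd_wf (by decide) hn G start T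
      fun N M hN hNT => optimizeCmd_sat hN hNT hT
    refine ⟨t, s, hrun, ht.trans ?_, hs⟩
    have h1 := one_le_two_mul_log (x := (T : ℝ)) (by exact_mod_cast hT)
    have h2 := one_le_two_mul_log (x := (G.maxWeight : ℝ) * n) (by positivity)
    calc (optimizeCmd.cost 1 : ℝ) * (n : ℝ) ^ 16
        ≤ optimizeCmd.cost 1 * (n : ℝ) ^ 16 * ((2 * Real.log ((G.maxWeight : ℝ) * n + 2)) *
            (2 * Real.log ((T : ℝ) + 2))) :=
          le_mul_of_one_le_right (by positivity) (one_le_mul_of_one_le_of_one_le h2 h1)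
      _ = _ := by ring
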